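/- **Setting.** Let $M=(S,A,R,P,\gamma,d_0)$ be a finite MDP with $\gamma\in[0,1)$ and at least two actions; write $S,A$ also for the numbers of states and actions. Policies $\pi:S\to A$ are deterministic and stationary, with value functions $V^\pi_M$, $Q^\pi_M$, discounted state distribution $\mu^\pi_M(s)=(1-\gamma)\sum_{t\ge0}\gamma^t\Pr[s_t=s\mid s_0\sim d_0,\pi]$ and score $\rho^\pi_M=(1-\gamma)\sum_s d_0(s)V^\pi_M(s)$; $\rho^*_M=\max_\pi\rho^\pi_M$. Let $\mu_{\min}=\min_{\pi,s}\mu^\pi_M(s)$ and $R_{\rm range}=\max R-\min R$, and assume $R_{\rm range}>0$. The reward in step $(s,a)$ is $r=R(s,a)+\xi$, where, given $(s,a)$, $\xi$ is independent of the past and of the next state, and is $\sigma$-sub-Gaussian ($E\,e^{x\xi}\le e^{\sigma^2x^2/2}$ for all $x\in\mathbb R$); its law may depend on $(s,a)$. Let $\pi_\dagger$ be a target policy, $\pi\{s;a\}$ the policy that takes $a$ in $s$ and agrees with $\pi$ elsewhere, $\epsilon>0$, $\lambda\ge0$, and $$\Delta^*_M(s,a)=\max\Big\{0,\;Q^{\pi_\dagger}_M(s,a)-V^{\pi_\dagger}_M(s)+\epsilon/\mu^{\pi_\dagger\{s;a\}}_M(s)\Big\}\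 (a\ne\pi_\dagger(s)),\qquad \Delta^*_M(s,\pi_\dagger(s))=0 .$$ **Learners.** $L\ge1$ learners interact with the environment one after the other, each for $T\ge1$ steps starting from $d_0$. A learner is a randomized rule that chooses each action from the states, actions and shown rewards that it has seen, and after $T$ steps outputs a policy. A pair $(s,a)$ is $\epsilon$-suboptimal in an MDP $M'$ if $\rho^\pi_{M'}\le\rho^*_{M'}-\epsilon$ for every $\pi$ with $\pi(s)=a$; a step is $\epsilon$-suboptimal if its pair is. For parameters $\alpha,\beta>0$ and a function $\textsc{SubOpt}$, each learner has these two guarantees for unmanipulated interaction with environments that have the dynamics $P,\gamma,d_0$: (i) for all reward distributions on $[-1,1]$ (depending on $(s,a)$), with probability at least $1-\beta$ the output policy has score at least $\rho^*-\alpha$; (ii) for all mean rewards $R'$, with the noise above, all $\epsilon'>0$ and all $\delta\in(0,1)$, with probability at least $1-\delta$ at most $\textsc{SubOpt}(T,\epsilon',\delta)$ of the $T$ steps are $\epsilon'$-suboptimal. **The attack U2.** The attacker knows $S,A,\gamma,d_0,\sigma$, but neither $R,P$ nor the learners; it sees states, actions and true rewards $r$ and shows $r'$ to the learner. In the exploration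 phase, $r'$ is an independent uniform element of $\{-1,1\}$. Let $N(s,a)$ be the number of observations so far of $(s,a)$, $\widehat R,\widehat P$ the empirical means and $N_{\min}=\min N(s,a)$. Put $$u(n)=\sigma\sqrt{2\log\tfrac{4SA\,n(n+1)}{p}},\qquad w(n)=\sqrt{2\log\tfrac{2^S\cdot2SA\,n(n+1)}{p}} .$$ Let $\mathcal M$ be the set of MDPs $(S,A,\widetilde R,\widetilde P,\gamma,d_0)$ such that, for all $(s,a)$ with $N(s,a)>0$, $|\widetilde R(s,a)-\widehat R(s,a)|\le u(N(s,a))/\sqrt{N(s,a)}$ and $\|\widetilde P(s,a,\cdot)-\widehat P(s,a,\cdot)\|_1\le w(N(s,a))/\sqrt{N(s,a)}$. Over $\mathcal M$, let $Q^{\pi_\dagger}_{\rm high}(s,a)$ be the supremum of $Q^{\pi_\dagger}(s,a)$, and $V^{\pi_\dagger}_{\rm low}(s)$, $\mu^{\pi}_{\rm low}(s)$ the infima of $V^{\pi_\dagger}(s)$, $\mu^\pi(s)$. Put $\widehat R_{\rm range}=\max_{s,a}\big(\widehat R+u(N)/\sqrt N\big)-\min_{s,a}\big(\widehat R-u(N)/\sqrt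 N\big)$ and $$\widehat e_Q=\frac{2u(N_{\min})+2\gamma\widehat R_{\rm range}w(N_{\min})}{(1-\gamma)^2\sqrt{N_{\min}}},\qquad e_\mu=\frac{2\gamma w(N_{\min})}{(1-\gamma)\sqrt{N_{\min}}} .$$ The exploration phase ends after the first learner after which $N_{\min}>0$ and, for all $s$ and $a\ne\pi_\dagger(s)$, $\mu^{\pi_\dagger\{s;a\}}_{\rm low}(s)>0$ and $$2\widehat e_Q+\frac{\epsilon}{\mu^{\pi_\dagger\{s;a\}}_{\rm low}(s)}-\frac{\epsilon}{\mu^{\pi_\dagger\{s;a\}}_{\rm low}(s)+e_\mu}\le m .$$ For all later learners (attack phase), $r'=r-\widehat\Delta(s,a)$ with $\widehat\Delta(s,\pi_\dagger(s))=0$ and $\widehat\Delta(s,a)=\max\{0,\,Q^{\pi_\dagger}_{\rm high}(s,a)-V^{\pi_\dagger}_{\rm low}(s)+\epsilon/\mu^{\pi_\dagger\{s;a\}}_{\rm low}(s)\}$ for $a\neq\pi_\dagger(s)$, where $\mathcal M$ is the set at the end of the exploration phase. The cost is $$\textsc{Cost}(T,L)=\frac1{LT}\sum_{l=1}^L\sum_{t=1}^T\Big(|r^{(l)}_t-r'^{(l)}_t|+\lambda\,\mathbf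 1[a^{(l)}_t\ne\pi_\dagger(s^{(l)}_t)]\Big).$$ **The number $k_0$.** Let $N_0$ be the least integer $N\ge1$ such that every integer $n\ge N$ satisfies $$n\ge\max\left\{\Big(\frac{4u(n)}{R_{\rm range}}\Big)^2,\ \Big(\frac{8u(n)+16\gamma R_{\rm range}w(n)}{(1-\gamma)^2m}\Big)^2,\ \Big(\frac{2\gamma w(n)}{1-\gamma}\cdot\frac{6\epsilon+m\mu_{\min}}{m\mu_{\min}^2}\Big)^2\right\},$$ and, with $X=\log\frac1{8SA\beta}$, let $$k_0=\left\lceil\max\left\{8\log\frac1p,\ \ 4N_0\cdot\frac{\alpha^2}{\mu_{\min}^2}\cdot\frac{\log(16SA)+2X}{X^2/8}\right\}\right\rceil .$$ It does not depend on $T$, $L$, $\lambda$ or the learners. **Theorem.** Let $m>0$, $p\in(0,1)$, $0<\alpha<\frac{\mu_{\min}}{2\sqrt2}$ and $0<\beta<\frac1{8SA}$. Then, with probability at least $1-4p$, $$\textsc{Cost}(T,L)\le\frac{k_0}{L}\Big(\|R\|_\infty+\sigma\sqrt{2\log\tfrac{2k_0T}{p}}+1+\lambda\Big)+\big(\|\Delta^*_M\|_\infty+\lambda+m\big)\frac{\textsc{SubOpt}(T,\epsilon,p/L)}{T}.$$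 -/

import Mathlib

open MeasureTheory ProbabilityTheory
open scoped ENNReal NNReal Matrix

namespace RewardPoisoning

/-! ## Markov decision processes -/

/-- A finite discounted MDP `(S, A, R, P, γ, d₀)`. -/
structure MDP (S A : Type*) where
  /-- mean rewards -/
  R : S → A → ℝ
  /-- transition probabilities -/
  P : S → A → PMF S
  /-- discount factor -/
  γ : ℝ
  γ_nonneg : 0 ≤ γ
  γ_lt_one : γ < 1
  /-- initial state distribution -/
  d₀ : PMF S

namespace MDP

noncomputable section

variable {S A : Type*}

/-- The MDP with the mean rewards replaced by `R'`. -/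
def withReward (M : MDP S A) (R' : S → A → ℝ) : MDP S A := { M with R := R' }

/-- The MDP with the mean rewards and the transition probabilities replaced. -/
def withModel (M : MDP S A) (X : (S → A → ℝ) × (S → A → PMF S)) : MDP S A :=
  { M with R := X.1, P := X.2 }

variable [Fintype S] [DecidableEq S]

/-- Transition matrix of the Markov chain of a deterministic stationary policy `π`. -/
def transMatrix (M : MDP S A) (π : S → A) : Matrix S S ℝ :=
  Matrix.of fun s s' => (M.P s (π s) s').toReal

/-- Value function `V^π(s) = E[∑_{t ≥ 0} γ^t R(s_t, π(s_t)) | s_0 = s]`. -/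
def V (M : MDP S A) (π : S → A) (s : S) : ℝ :=
  ∑' t : ℕ, M.γ ^ t * ((M.transMatrix π ^ t) *ᵥ fun x => M.R x (π x)) s

/-- Action-value function. -/
def Q (M : MDP S A) (π : S → A) (s : S) (a : A) : ℝ :=
  M.R s a + M.γ * ∑ s' : S, (M.P s a s').toReal * M.V π s'

/-- Discounted state distribution `μ^π(s) = (1 - γ) ∑_{t ≥ 0} γ^t Pr[s_t = s | s_0 ∼ d₀, π]`. -/
def occ (M : MDP S A) (π : S → A) (s : S) : ℝ :=
  (1 - M.γ) * ∑' t : ℕ, M.γ ^ t * ((fun x => (M.d₀ x).toReal) ᵥ* (M.transMatrix π ^ t)) s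

/-- Score `ρ^π = (1 - γ) E[∑_{t ≥ 0} γ^t R(s_t, π(s_t)) | s_0 ∼ d₀, π]`. -/
def score (M : MDP S A) (π : S → A) : ℝ :=
  (1 - M.γ) * ∑ s : S, (M.d₀ s).toReal * M.V π s

/-- Score of an optimal policy. -/
def optScore (M : MDP S A) : ℝ := ⨆ π : S → A, M.score π

/-- The pair `(s, a)` is `ε`-suboptimal: every deterministic policy that takes `a` in `s` loses
at least `ε` against the optimal score. -/
def IsSubopt (M : MDP S A) (ε : ℝ) (s : S) (a : A) : Prop :=
  ∀ π : S → A, π s = a → M.score π ≤ M.optScore - ε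

/-- Smallest discounted state probability over all deterministic policies and states. -/
def occMin (M : MDP S A) : ℝ := ⨅ x : (S → A) × S, M.occ x.1 x.2

/-- `max R - min R`. -/
def rewardRange (M : MDP S A) : ℝ := (⨆ x : S × A, M.R x.1 x.2) - ⨅ x : S × A, M.R x.1 x.2

/-- The white-box attack `Δ*_M` for the target policy `πT`; `Function.update πT s a` is the
neighbour policy that takes `a` in `s` and agrees with `πT` elsewhere. -/
def whiteBox [DecidableEq A] (M : MDP S A) (ε : ℝ) (πT : S → A) (s : S) (a : A) : ℝ :=
  if a = πT s then 0
  else max 0 (M.Q πT s a - M.V πT s + ε / M.occ (Function.update πT s a) s)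

end

end MDP

/-! ## Learners and their interaction with an environment -/

/-- A learner for horizon `T`: a randomized, history dependent rule for choosing actions, and a
randomized rule for the deterministic policy it has learned after `T` steps. The learner sees the
past states, actions and (possibly manipulated) rewards and the current state. -/
structure Learner (S A : Type*) [MeasurableSpace S] [MeasurableSpace A] (T : ℕ) where
  act : (n : ℕ) → Kernel ((Fin n → S × A × ℝ) × S) A
  act_markov : ∀ n, IsMarkovKernel (act n)
  out : Kernel ((Fin T → S × A × ℝ) × S) (S → A)
  out_markov : IsMarkovKernel out

attribute [instance] Learner.act_markov Learner.out_markov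

/-- Record of one step: `((s, a), (r, r'), s')` with state, action, true reward, reward shown to
the learner, next state. -/
abbrev Rec (S A : Type*) := (S × A) × (ℝ × ℝ) × S

noncomputable section

variable {S A : Type*}

/-- The part of a history which the learner sees. -/
def shown {n : ℕ} (h : (Fin n → Rec S A) × S) : (Fin n → S × A × ℝ) × S :=
  (fun i => ((h.1 i).1.1, (h.1 i).1.2, (h.1 i).2.1.2), h.2)

/-- Append a record to a history and move to the next state. -/
def push {n : ℕ} (x : ((Fin n → Rec S A) × S) × Rec S A) : (Fin (n + 1) → Rec S A) × S :=
  (Fin.snoc (α := fun _ => Rec S A) x.1.1 x.2, x.2.2.2)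

variable [MeasurableSpace S] [MeasurableSpace A]

lemma measurable_shown {n : ℕ} : Measurable (shown (S := S) (A := A) (n := n)) := by
  unfold shown
  fun_prop

lemma measurable_push {n : ℕ} : Measurable (push (S := S) (A := A) (n := n)) := by
  unfold push
  refine Measurable.prodMk (measurable_pi_iff.2 fun i => ?_) (by fun_prop)
  refine Fin.lastCases ?_ (fun j => ?_) i
  · simpa using measurable_snd
  · simp only [Fin.snoc_castSucc]
    fun_prop

variable [Fintype S] [MeasurableSingletonClass S] [Fintype A] [MeasurableSingletonClass A]

/-- Transition kernel of an MDP. -/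
def transKernel (M : MDP S A) : Kernel (S × A) S :=
  Kernel.ofFunOfCountable fun x => (M.P x.1 x.2).toMeasure

instance (M : MDP S A) : IsMarkovKernel (transKernel M) :=
  ⟨fun x => inferInstanceAs (IsProbabilityMeasure (M.P x.1 x.2).toMeasure)⟩

variable {Θ : Type*} [MeasurableSpace Θ] {T : ℕ}

/-- One step from a given history. `C` generates the pair (true reward, shown reward) from the
state-action pair and a parameter `θ`. -/
def stepKernel (M : MDP S A) (C : Kernel (Θ × (S × A)) (ℝ × ℝ)) (ℓ : Learner S A T) (n : ℕ) :
    Kernel (Θ × ((Fin n → Rec S A) × S)) (Rec S A) :=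
  (Kernel.deterministic (fun x : Θ × ((Fin n → Rec S A) × S) => x.2.2) (by fun_prop) ×ₖ
      (ℓ.act n).comap (fun x => shown x.2) (measurable_shown.comp measurable_snd)) ⊗ₖ
    (C.comap (fun y : (Θ × ((Fin n → Rec S A) × S)) × (S × A) => (y.1.1, y.2)) (by fun_prop) ×ₖ
      (transKernel M).comap (fun y : (Θ × ((Fin n → Rec S A) × S)) × (S × A) => y.2)
        (by fun_prop))

/-- Law of the first `n` records and of the state reached after them. -/
def run (M : MDP S A) (C : Kernel (Θ × (S × A)) (ℝ × ℝ)) (ℓ : Learner S A T) :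
    (n : ℕ) → Kernel Θ ((Fin n → Rec S A) × S)
  | 0 => Kernel.const Θ (M.d₀.toMeasure.map fun s => (Fin.elim0, s))
  | n + 1 => (run M C ℓ n ⊗ₖ stepKernel M C ℓ n).map push

instance (M : MDP S A) (C : Kernel (Θ × (S × A)) (ℝ × ℝ)) [IsMarkovKernel C]
    (ℓ : Learner S A T) (n : ℕ) : IsMarkovKernel (stepKernel M C ℓ n) := by
  unfold stepKernel
  infer_instance

instance run_markov (M : MDP S A) (C : Kernel (Θ × (S × A)) (ℝ × ℝ)) [IsMarkovKernel C]
    (ℓ : Learner S A T) (n : ℕ) : IsMarkovKernel (run M C ℓ n) := by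
  induction n with
  | zero =>
    have : IsProbabilityMeasure (M.d₀.toMeasure.map
        fun s => ((Fin.elim0 : Fin 0 → Rec S A), s)) :=
      Measure.isProbabilityMeasure_map (by fun_prop)
    unfold run
    infer_instance
  | succ n ih =>
    unfold run
    exact Kernel.IsMarkovKernel.map _ measurable_push

/-! ### Learners without an attacker, and their guarantees -/

/-- Reward kernel with mean rewards `R` and additive noise `ν`. -/
def noisyReward (R : S → A → ℝ) (ν : Kernel (S × A) ℝ) : Kernel (S × A) ℝ :=
  Kernel.ofFunOfCountable fun x => (ν x).map fun y => R x.1 x.2 + y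

instance (R : S → A → ℝ) (ν : Kernel (S × A) ℝ) [IsMarkovKernel ν] :
    IsMarkovKernel (noisyReward R ν) :=
  ⟨fun x => Measure.isProbabilityMeasure_map (μ := ν x) (f := fun y => R x.1 x.2 + y)
    (by fun_prop)⟩

/-- Law of `T` steps of a learner in an environment with reward kernel `κ` without any attacker:
the shown reward is the true reward. -/
def cleanRun (M : MDP S A) (κ : Kernel (S × A) ℝ) (ℓ : Learner S A T) :
    Measure ((Fin T → Rec S A) × S) :=
  run (Θ := Unit) M ((κ.map fun r => (r, r)).comap Prod.snd measurable_snd) ℓ T ()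

instance (M : MDP S A) (κ : Kernel (S × A) ℝ) [IsMarkovKernel κ] (ℓ : Learner S A T) :
    IsProbabilityMeasure (cleanRun M κ ℓ) := by
  have : IsMarkovKernel (κ.map fun r => (r, r)) := Kernel.IsMarkovKernel.map _ (by fun_prop)
  unfold cleanRun
  infer_instance

/-- The learner is `(α, β)`-PAC with respect to the dynamics of `M`: for all reward
distributions on `[-1, 1]`, the policy learned after `T` steps is `α`-optimal with probability at
least `1 - β`. -/
def IsPAC [DecidableEq S] (M : MDP S A) (α β : ℝ) (ℓ : Learner S A T) : Prop :=
  ∀ κ : Kernel (S × A) ℝ, IsMarkovKernel κ → (∀ x, ∀ᵐ r ∂κ x, r ∈ Set.Icc (-1 : ℝ) 1) →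
    1 - β ≤ (ℓ.out ∘ₘ (cleanRun M κ ℓ).map shown).real
      {π | (M.withReward fun s a => ∫ r, r ∂κ (s, a)).optScore - α
        ≤ (M.withReward fun s a => ∫ r, r ∂κ (s, a)).score π}

open Classical in
/-- Number of `ε`-suboptimal steps among the `T` steps of a trajectory. -/
def suboptSteps [DecidableEq S] (M : MDP S A) (ε : ℝ) (τ : Fin T → Rec S A) : ℕ :=
  (Finset.univ.filter fun t : Fin T => M.IsSubopt ε (τ t).1.1 (τ t).1.2).card

/-- For all mean rewards `R'` (dynamics of `M`, noise `ν`), with probability at least `1 - δ` the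
learner takes at most `b` `ε`-suboptimal steps. -/
def HasSuboptBound [DecidableEq S] (M : MDP S A) (ν : Kernel (S × A) ℝ) (ε δ b : ℝ)
    (ℓ : Learner S A T) : Prop :=
  ∀ R' : S → A → ℝ, 1 - δ ≤ (cleanRun M (noisyReward R' ν) ℓ).real
    {τ | (suboptSteps (M.withReward R') ε τ.1 : ℝ) ≤ b}

/-! ### The attack -/

/-- What the attacker can do to a learner: explore, or subtract a fixed `Δ` from the rewards. A
mode `(b, Δ)` with `b = true` means exploration. -/
abbrev Mode (S A : Type*) := Bool × (S → A → ℝ)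

/-- Uniform distribution on `{-1, 1}`. -/
def coin : Measure ℝ := (2 : ℝ≥0∞)⁻¹ • (Measure.dirac 1 + Measure.dirac (-1))

instance : IsProbabilityMeasure coin := ⟨by
  simp only [coin, Measure.smul_apply, Measure.add_apply, measure_univ, smul_eq_mul]
  rw [one_add_one_eq_two]
  exact ENNReal.inv_mul_cancel (by simp) (by simp)⟩

/-- The reward shown to the learner: an independent fair coin in the exploration phase, and
`r - Δ(s, a)` in the attack phase. The argument is `((mode, (s, a)), (r, coin))`. -/
def manipulate (x : (Mode S A × (S × A)) × (ℝ × ℝ)) : ℝ × ℝ :=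
  (x.2.1, if x.1.1.1 = true then x.2.2 else x.2.1 - x.1.1.2 x.1.2.1 x.1.2.2)

lemma measurable_manipulate : Measurable (manipulate (S := S) (A := A)) := by
  have h : Measurable fun x : (Mode S A × (S × A)) × (ℝ × ℝ) =>
      x.1.1.2 x.1.2.1 x.1.2.2 := by
    have h' : Measurable (Function.uncurry fun (y : S × A) (D : S → A → ℝ) => D y.1 y.2) :=
      measurable_from_prod_countable_right fun y => by
        simp only [Function.uncurry_apply_pair]
        fun_prop
    exact h'.comp (g := Function.uncurry fun (y : S × A) (D : S → A → ℝ) => D y.1 y.2)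
      (f := fun x : (Mode S A × (S × A)) × (ℝ × ℝ) => (x.1.2, x.1.1.2)) (by fun_prop)
  unfold manipulate
  refine Measurable.prodMk (by fun_prop) (Measurable.ite ?_ (by fun_prop) (by fun_prop))
  exact (measurableSet_singleton true).preimage
    (f := fun x : (Mode S A × (S × A)) × (ℝ × ℝ) => x.1.1.1) (by fun_prop)

/-- The pair (true reward, shown reward) under attack, given the mode and the state-action pair. -/
def attackChannel (M : MDP S A) (ν : Kernel (S × A) ℝ) :
    Kernel (Mode S A × (S × A)) (ℝ × ℝ) :=
  (Kernel.id ×ₖ ((noisyReward M.R ν).comap Prod.snd measurable_snd ×ₖ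
    Kernel.const _ coin)).map manipulate

instance (M : MDP S A) (ν : Kernel (S × A) ℝ) [IsMarkovKernel ν] :
    IsMarkovKernel (attackChannel M ν) :=
  Kernel.IsMarkovKernel.map _ measurable_manipulate

/-- Statistics of the attacker: visit counts and empirical means. -/
structure Stats (S A : Type*) where
  N : S → A → ℕ
  Rhat : S → A → ℝ
  Phat : S → A → S → ℝ

/-- The steps of the first `j` learners in which the pair `(s, a)` was visited. -/
def visits [DecidableEq S] [DecidableEq A] {l : ℕ} (d : Fin l → Fin T → Rec S A) (j : ℕ)
    (s : S) (a : A) : Finset (Fin l × Fin T) :=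
  Finset.univ.filter fun x => x.1.val < j ∧ (d x.1 x.2).1 = (s, a)

/-- Statistics from the true rewards and the transitions of the first `j` learners. -/
def statsOf [DecidableEq S] [DecidableEq A] {l : ℕ} (d : Fin l → Fin T → Rec S A) (j : ℕ) :
    Stats S A where
  N s a := (visits d j s a).card
  Rhat s a := (∑ x ∈ visits d j s a, (d x.1 x.2).2.1.1) / (visits d j s a).card
  Phat s a s' :=
    ((visits d j s a).filter fun x => (d x.1 x.2).2.2 = s').card / (visits d j s a).card

/-- Numerator `u(n)` of the confidence radius `u(n) / √n` for mean rewards. -/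
def uConf (S A : Type*) [Fintype S] [Fintype A] (σ p : ℝ) (n : ℕ) : ℝ :=
  σ * √(2 * Real.log (4 * Fintype.card S * Fintype.card A * (n * (n + 1)) / p))

/-- Numerator `w(n)` of the confidence radius `w(n) / √n` for transition probabilities. -/
def wConf (S A : Type*) [Fintype S] [Fintype A] (p : ℝ) (n : ℕ) : ℝ :=
  √(2 * Real.log
    (2 ^ Fintype.card S * (2 * Fintype.card S * Fintype.card A * (n * (n + 1))) / p))

namespace Stats

/-- Least number of visits of a pair. -/
def Nmin (D : Stats S A) : ℕ := ⨅ x : S × A, D.N x.1 x.2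

/-- Confidence set of models. -/
def confSet (D : Stats S A) (σ p : ℝ) : Set ((S → A → ℝ) × (S → A → PMF S)) :=
  {X | ∀ s a, D.N s a ≠ 0 →
    |X.1 s a - D.Rhat s a| ≤ uConf S A σ p (D.N s a) / √(D.N s a) ∧
    ∑ s' : S, |(X.2 s a s').toReal - D.Phat s a s'| ≤ wConf S A p (D.N s a) / √(D.N s a)}

variable [DecidableEq S] [DecidableEq A]

/-- Largest value of `Q^{πT}(s, a)` over the confidence set. -/
def Qhigh (M : MDP S A) (D : Stats S A) (σ p : ℝ) (πT : S → A) (s : S) (a : A) : ℝ :=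
  ⨆ X : D.confSet σ p, (M.withModel X).Q πT s a

/-- Smallest value of `V^{πT}(s)` over the confidence set. -/
def Vlow (M : MDP S A) (D : Stats S A) (σ p : ℝ) (πT : S → A) (s : S) : ℝ :=
  ⨅ X : D.confSet σ p, (M.withModel X).V πT s

/-- Smallest value of `μ^π(s)` over the confidence set. -/
def occLow (M : MDP S A) (D : Stats S A) (σ p : ℝ) (π : S → A) (s : S) : ℝ :=
  ⨅ X : D.confSet σ p, (M.withModel X).occ π s

/-- Largest reward range over the confidence set. -/
def rangeHat (D : Stats S A) (σ p : ℝ) : ℝ :=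
  (⨆ x : S × A, (D.Rhat x.1 x.2 + uConf S A σ p (D.N x.1 x.2) / √(D.N x.1 x.2))) -
    ⨅ x : S × A, (D.Rhat x.1 x.2 - uConf S A σ p (D.N x.1 x.2) / √(D.N x.1 x.2))

/-- Error bound for `Q`. -/
def eQ (M : MDP S A) (D : Stats S A) (σ p : ℝ) : ℝ :=
  (2 * uConf S A σ p D.Nmin + 2 * M.γ * D.rangeHat σ p * wConf S A p D.Nmin) /
    ((1 - M.γ) ^ 2 * √D.Nmin)

/-- Error bound for `μ`. -/
def eMu (M : MDP S A) (D : Stats S A) (p : ℝ) : ℝ :=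
  2 * M.γ * wConf S A p D.Nmin / ((1 - M.γ) * √D.Nmin)

/-- Condition for ending the exploration phase. -/
def Stop (M : MDP S A) (D : Stats S A) (σ p m ε : ℝ) (πT : S → A) : Prop :=
  0 < D.Nmin ∧ ∀ s a, a ≠ πT s →
    0 < D.occLow M σ p (Function.update πT s a) s ∧
    2 * D.eQ M σ p + ε / D.occLow M σ p (Function.update πT s a) s -
      ε / (D.occLow M σ p (Function.update πT s a) s + D.eMu M p) ≤ m

/-- The attack `Δ̂` computed from the confidence set. -/
def deltaHat (M : MDP S A) (D : Stats S A) (σ p ε : ℝ) (πT : S → A) (s : S) (a : A) : ℝ :=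
  if a = πT s then 0
  else max 0 (D.Qhigh M σ p πT s a - D.Vlow M σ p πT s +
    ε / D.occLow M σ p (Function.update πT s a) s)

end Stats

variable [DecidableEq S] [DecidableEq A]

open Classical in
/-- Mode of the attacker after `l` learners: if the stopping condition was met after some of them,
attack with the `Δ̂` of the first such time; otherwise explore. Only `γ` and `d₀` of `M` are
used. -/
def attackMode (M : MDP S A) (σ p m ε : ℝ) (πT : S → A) {l : ℕ} (d : Fin l → Fin T → Rec S A) :
    Mode S A :=
  if h : ∃ j, j ≤ l ∧ (statsOf d j).Stop M σ p m ε πT then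
    (false, (statsOf d (Nat.find h)).deltaHat M σ p ε πT)
  else (true, 0)

/-- Law of the trajectories of the first `l` learners under the attack. -/
def attackLaw (M : MDP S A) (ν : Kernel (S × A) ℝ) (σ p m ε : ℝ) (πT : S → A)
    (ℓ : ℕ → Learner S A T) : (l : ℕ) → Measure (Fin l → Fin T → Rec S A)
  | 0 => Measure.dirac Fin.elim0
  | l + 1 => (attackLaw M ν σ p m ε πT ℓ l).bind fun d =>
      ((run M (attackChannel M ν) (ℓ l) T (attackMode M σ p m ε πT d)).map Prod.fst).map
        fun τ => Fin.snoc (α := fun _ => Fin T → Rec S A) d τ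

/-- Average cost per learner and step. -/
def cost (lam : ℝ) (πT : S → A) {L : ℕ} (d : Fin L → Fin T → Rec S A) : ℝ :=
  1 / (L * T) * ∑ l : Fin L, ∑ t : Fin T,
    (|(d l t).2.1.1 - (d l t).2.1.2| + lam * if (d l t).1.2 ≠ πT (d l t).1.1 then 1 else 0)

/-! ### The number of exploration learners -/

/-- Visits of each pair that suffice for ending the exploration phase: the least `N ≥ 1` such that
every `n ≥ N` satisfies the three lower bounds. -/
def N0 (M : MDP S A) (σ p m ε : ℝ) : ℕ :=
  sInf {N : ℕ | 1 ≤ N ∧ ∀ n : ℕ, N ≤ n →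
    (4 * uConf S A σ p n / M.rewardRange) ^ 2 ≤ n ∧
    ((8 * uConf S A σ p n + 16 * M.γ * M.rewardRange * wConf S A p n) /
      ((1 - M.γ) ^ 2 * m)) ^ 2 ≤ n ∧
    (2 * M.γ * wConf S A p n / (1 - M.γ) *
      ((6 * ε + m * M.occMin) / (m * M.occMin ^ 2))) ^ 2 ≤ n}

/-- The number `k₀`. -/
def k0 (M : MDP S A) (σ p α β m ε : ℝ) : ℕ :=
  ⌈max (8 * Real.log (1 / p))
    (4 * N0 M σ p m ε * (α ^ 2 / M.occMin ^ 2) *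
      ((Real.log (16 * Fintype.card S * Fintype.card A) +
          2 * Real.log (1 / (8 * Fintype.card S * Fintype.card A * β))) /
        (1 / 8 * Real.log (1 / (8 * Fintype.card S * Fintype.card A * β)) ^ 2)))⌉₊

end

end RewardPoisoning

open RewardPoisoning

set_option linter.unusedSectionVars false

namespace RewardPoisoning

/-! ## Analysis of finite MDPs -/

namespace MDP

variable {S A : Type*} [Fintype S]

/-! The cost separates into that of the learners met while exploring and that of the learners met
while attacking. An exploration step costs at most `‖R‖` plus the noise plus `1 + λ`, so there only
the number of exploring learners matters. In the attack phase a learner sees mean rewards `R - Δ̂`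
with the original noise, that is, a clean environment. All actions other than those of the target
policy are `ε`-suboptimal in it, so guarantee (ii) limits the deviations from the target, and these
are the only steps with a cost.

Why deviations are suboptimal: by the performance difference lemma, changing the target in one state
`s` changes the score by `μ(s)` times the advantage, so an advantage of at most `-ε / μ(s)` loses
`ε`. Any other policy is led back to a single deviation by repairing one state at a time without
lowering the score (`score_le_of_neighbours`, `isSubopt_withReward_sub`). Larger reductions off the
target do no harm. Hence `Δ̂` works as soon as it dominates the white-box attack, which it does when
the confidence set contains the true model (`le_deltaHat`). The simulation lemmas and the stopping
rule limit the excess to `m` (`deltaHat_le`).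

Why exploration is short: a learner that is shown fair coins and rarely visits a pair can hardly
tell them from coins with bias `η` or `-η` at that pair. These two environments demand opposite
decisions about the pair, so a PAC learner cannot be right in both. The change of measure
`lintegral_run_eq` and an exponential supermartingale for the log-likelihood ratio make this
quantitative: every exploring learner visits all pairs `visitBound` times with probability at least
`1 / 2` (`run_exists_few_visits_le`). A Chernoff argument then yields a quarter of `k₀` such
learners (`attackLaw_few_good_le`), and `k₀` is chosen so that their visits add up to `N₀` per pair,
which triggers the stopping rule (`stop_of_N0_le`).

Adaptivity is handled throughout by Ville's inequality along the sequence of learners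
(`attackLaw_exists_le`). Four events of probability at most `p` are excluded: a confidence set
misses the model, few exploring learners are thorough, the noise is large early on, or an attacked
learner deviates too often. Outside them the bound is deterministic (`cost_le`). The attack involves
suprema over an uncountable set of models; it is measurable because they are Lipschitz in the
empirical means. -/

lemma sum_pmf_toReal (q : PMF S) : ∑ s, (q s).toReal = 1 := by
  rw [← ENNReal.toReal_sum fun s _ => q.apply_ne_top s, ← tsum_fintype (L := .unconditional S),
    q.tsum_coe, ENNReal.toReal_one]

lemma abs_sum_pmf_mul_le (q : PMF S) {f : S → ℝ} {c : ℝ} (hf : ∀ s, |f s| ≤ c) :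
    |∑ s, (q s).toReal * f s| ≤ c :=
  calc |∑ s, (q s).toReal * f s| ≤ ∑ s, |(q s).toReal * f s| := Finset.abs_sum_le_sum_abs _ _
    _ ≤ ∑ s, (q s).toReal * c := by
        refine Finset.sum_le_sum fun s _ => ?_
        rw [abs_mul, abs_of_nonneg ENNReal.toReal_nonneg]
        exact mul_le_mul_of_nonneg_left (hf s) ENNReal.toReal_nonneg
    _ = c := by rw [← Finset.sum_mul, sum_pmf_toReal, one_mul]

lemma sum_pmf_mul_le (q : PMF S) {f : S → ℝ} {c : ℝ} (hf : ∀ s, f s ≤ c) :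
    ∑ s, (q s).toReal * f s ≤ c :=
  calc ∑ s, (q s).toReal * f s ≤ ∑ s, (q s).toReal * c :=
        Finset.sum_le_sum fun s _ => mul_le_mul_of_nonneg_left (hf s) ENNReal.toReal_nonneg
    _ = c := by rw [← Finset.sum_mul, sum_pmf_toReal, one_mul]

/-- Discounted maximum principle. -/
lemma le_div_of_le_add_discounted {γ : ℝ} (h0 : 0 ≤ γ) (h1 : γ < 1) (q : S → PMF S)
    {g : S → ℝ} {c : ℝ} (hg : ∀ s, g s ≤ c + γ * ∑ s', (q s s').toReal * g s') (s : S) :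
    g s ≤ c / (1 - γ) := by
  have : Nonempty S := ⟨s⟩
  -- At a maximiser the averaged term is at most the maximum itself, so `g t ≤ c + γ * g t`.
  obtain ⟨t, ht⟩ := Finite.exists_max g
  have h := hg t
  have h2 := mul_le_mul_of_nonneg_left (sum_pmf_mul_le (q t) ht) h0
  rw [le_div_iff₀ (by linarith)]
  nlinarith [ht s]

variable [DecidableEq S] (M : MDP S A) (π : S → A)

lemma transMatrix_mulVec (f : S → ℝ) (s : S) :
    (M.transMatrix π *ᵥ f) s = ∑ s', (M.P s (π s) s').toReal * f s' := rfl

lemma vecMul_transMatrix (x : S → ℝ) (s' : S) :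
    (x ᵥ* M.transMatrix π) s' = ∑ s, x s * (M.P s (π s) s').toReal := rfl

lemma abs_transMatrix_pow_mulVec_le (f : S → ℝ) (t : ℕ) (s : S) :
    |((M.transMatrix π ^ t) *ᵥ f) s| ≤ ‖f‖ := by
  induction t generalizing s with
  | zero => simpa using norm_le_pi_norm f s
  | succ t ih =>
    rw [pow_succ', ← Matrix.mulVec_mulVec, transMatrix_mulVec]
    exact abs_sum_pmf_mul_le _ ih

lemma summable_V (f : S → ℝ) (s : S) :
    Summable fun t : ℕ => M.γ ^ t * ((M.transMatrix π ^ t) *ᵥ f) s := by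
  refine Summable.of_norm_bounded
    ((summable_geometric_of_lt_one M.γ_nonneg M.γ_lt_one).mul_right ‖f‖) fun t => ?_
  rw [Real.norm_eq_abs, abs_mul, abs_of_nonneg (pow_nonneg M.γ_nonneg t)]
  exact mul_le_mul_of_nonneg_left (M.abs_transMatrix_pow_mulVec_le π f t s)
    (pow_nonneg M.γ_nonneg t)

/-- Bellman equation. -/
lemma V_eq_Q (s : S) : M.V π s = M.Q π s (π s) := by
  rw [Q]
  conv_lhs => rw [V, (M.summable_V π _ s).tsum_eq_zero_add]
  simp only [pow_zero, Matrix.one_mulVec, one_mul, V, ← tsum_mul_left]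
  congr 1
  rw [← Summable.tsum_finsetSum fun s' _ => (M.summable_V π _ s').mul_left _, ← tsum_mul_left]
  refine tsum_congr fun t => ?_
  rw [pow_succ' (M.transMatrix π), ← Matrix.mulVec_mulVec, transMatrix_mulVec, Finset.mul_sum,
    Finset.mul_sum]
  exact Finset.sum_congr rfl fun _ _ => by ring

lemma vecMul_transMatrix_pow (t : ℕ) :
    (∀ s, 0 ≤ ((fun x => (M.d₀ x).toReal) ᵥ* (M.transMatrix π ^ t)) s) ∧
      ∑ s, ((fun x => (M.d₀ x).toReal) ᵥ* (M.transMatrix π ^ t)) s = 1 := by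
  induction t with
  | zero => simp [sum_pmf_toReal]
  | succ t ih =>
    simp only [pow_succ, ← Matrix.vecMul_vecMul, vecMul_transMatrix]
    refine ⟨fun s => Finset.sum_nonneg fun x _ => mul_nonneg (ih.1 x) ENNReal.toReal_nonneg, ?_⟩
    rw [Finset.sum_comm]
    simp only [← Finset.mul_sum, sum_pmf_toReal, mul_one, ih.2]

lemma summable_occ (s : S) : Summable fun t : ℕ =>
    M.γ ^ t * ((fun x => (M.d₀ x).toReal) ᵥ* (M.transMatrix π ^ t)) s := by
  refine Summable.of_norm_bounded (summable_geometric_of_lt_one M.γ_nonneg M.γ_lt_one) fun t => ?_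
  obtain ⟨h0, h1⟩ := M.vecMul_transMatrix_pow π t
  rw [Real.norm_eq_abs, abs_of_nonneg (mul_nonneg (pow_nonneg M.γ_nonneg t) (h0 s))]
  refine mul_le_of_le_one_right (pow_nonneg M.γ_nonneg t) ?_
  rw [← h1]
  exact Finset.single_le_sum (fun x _ => h0 x) (Finset.mem_univ s)

lemma occ_nonneg (s : S) : 0 ≤ M.occ π s :=
  mul_nonneg (by linarith [M.γ_lt_one]) (tsum_nonneg fun t =>
    mul_nonneg (pow_nonneg M.γ_nonneg t) ((M.vecMul_transMatrix_pow π t).1 s))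

/-- Flow equation of the discounted state distribution. -/
lemma occ_eq (s' : S) : M.occ π s' =
    (1 - M.γ) * (M.d₀ s').toReal + M.γ * ∑ s, M.occ π s * (M.P s (π s) s').toReal := by
  conv_lhs => rw [occ, (M.summable_occ π s').tsum_eq_zero_add]
  simp only [pow_zero, Matrix.vecMul_one, one_mul, occ, mul_add]
  congr 1
  simp only [mul_assoc, ← Finset.mul_sum]
  rw [mul_left_comm]
  congr 1
  simp only [← tsum_mul_right]
  rw [← Summable.tsum_finsetSum fun s _ => (M.summable_occ π s).mul_right _, ← tsum_mul_left]
  refine tsum_congr fun t => ?_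
  rw [pow_succ (M.transMatrix π), ← Matrix.vecMul_vecMul, vecMul_transMatrix, Finset.mul_sum,
    Finset.mul_sum]
  exact Finset.sum_congr rfl fun _ _ => by ring

/-- This is the flow equation tested against `f`: the operator `1 - γP` is moved from the occupancy
to the function. Taking `f = 1` gives total mass one, `f = V^π` the score as an average reward, and
the value function of another policy the performance difference lemma. -/
lemma sum_occ_mul_sub (f : S → ℝ) :
    ∑ s, M.occ π s * (f s - M.γ * ∑ s', (M.P s (π s) s').toReal * f s') =
      (1 - M.γ) * ∑ s, (M.d₀ s).toReal * f s := by
  have h : ∑ s', M.occ π s' * f s' = (1 - M.γ) * ∑ s, (M.d₀ s).toReal * f s +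
      M.γ * ∑ s, M.occ π s * ∑ s', (M.P s (π s) s').toReal * f s' := by
    calc ∑ s', M.occ π s' * f s' = ∑ s', ((1 - M.γ) * (M.d₀ s').toReal +
          M.γ * ∑ s, M.occ π s * (M.P s (π s) s').toReal) * f s' :=
          Finset.sum_congr rfl fun s' _ => by rw [← M.occ_eq π s']
      _ = _ := by
          simp only [add_mul, Finset.sum_add_distrib, Finset.mul_sum, Finset.sum_mul]
          rw [Finset.sum_comm (γ := S)]
          simp only [mul_assoc]
  simp only [mul_sub, Finset.sum_sub_distrib]
  rw [h, Finset.mul_sum (s := Finset.univ) (a := M.γ)]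
  simp only [mul_left_comm]
  ring

lemma sum_occ : ∑ s, M.occ π s = 1 := by
  have h := M.sum_occ_mul_sub π fun _ => 1
  simp only [mul_one, sum_pmf_toReal, ← Finset.sum_mul] at h
  have := M.γ_lt_one
  nlinarith

lemma score_eq : M.score π = ∑ s, M.occ π s * M.R s (π s) := by
  rw [score, ← M.sum_occ_mul_sub π]
  refine Finset.sum_congr rfl fun s _ => ?_
  have h := M.V_eq_Q π s
  rw [Q] at h
  rw [h]
  ring

/-- Performance difference lemma. -/
lemma score_sub_score (π' : S → A) :
    M.score π - M.score π' = ∑ s, M.occ π s * (M.Q π' s (π s) - M.V π' s) := by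
  rw [M.score_eq π, score, ← M.sum_occ_mul_sub π, ← Finset.sum_sub_distrib]
  refine Finset.sum_congr rfl fun s _ => ?_
  rw [Q]
  ring

/-- Subtracting the Bellman equation leaves `f - V ≤ γP(f - V)`, and the discounted maximum
principle with `c = 0` applies. Together with its mirror image below, it replaces monotone iteration
of the Bellman operator. -/
lemma le_V_of_le {f : S → ℝ}
    (hf : ∀ s, f s ≤ M.R s (π s) + M.γ * ∑ s', (M.P s (π s) s').toReal * f s') (s : S) :
    f s ≤ M.V π s := by
  have h := le_div_of_le_add_discounted M.γ_nonneg M.γ_lt_one (fun s => M.P s (π s))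
    (g := fun s => f s - M.V π s) (c := 0) (fun s => by
      have h1 := hf s
      have h2 := M.V_eq_Q π s
      rw [Q] at h2
      simp only [mul_sub, Finset.sum_sub_distrib]
      linarith) s
  simp only [zero_div] at h
  linarith

lemma V_le_of_le {f : S → ℝ}
    (hf : ∀ s, M.R s (π s) + M.γ * ∑ s', (M.P s (π s) s').toReal * f s' ≤ f s) (s : S) :
    M.V π s ≤ f s := by
  have h := le_div_of_le_add_discounted M.γ_nonneg M.γ_lt_one (fun s => M.P s (π s))
    (g := fun s => M.V π s - f s) (c := 0) (fun s => by
      have h1 := hf s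
      have h2 := M.V_eq_Q π s
      rw [Q] at h2
      simp only [mul_sub, Finset.sum_sub_distrib]
      linarith) s
  simp only [zero_div] at h
  linarith

/-- If every deviation of `πT` in a single state loses at least `ε`, and all deviating actions
have negative advantage, then every policy other than `πT` loses at least `ε`. -/
lemma score_le_of_neighbours [DecidableEq A] {πT : S → A} {ε : ℝ}
    (hneg : ∀ s a, a ≠ πT s → M.Q πT s a < M.V πT s)
    (hnb : ∀ s a, a ≠ πT s → M.score (Function.update πT s a) ≤ M.score πT - ε) (n : ℕ) :
    ∀ π : S → A, (Finset.univ.filter fun s => π s ≠ πT s).card = n + 1 →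
      M.score π ≤ M.score πT - ε := by
  induction n with
  | zero =>
    intro π hπ
    obtain ⟨s, hs⟩ := Finset.card_eq_one.1 hπ
    have hmem : ∀ x, π x ≠ πT x ↔ x = s := fun x => by
      have := Finset.ext_iff.1 hs x
      simpa using this
    have : π = Function.update πT s (π s) := by
      ext x
      by_cases hx : x = s
      · subst hx; simp
      · rw [Function.update_of_ne hx]
        by_contra h
        exact hx ((hmem x).1 h)
    rw [this]
    exact hnb s _ ((hmem s).2 rfl)
  | succ n ih =>
    intro π hπ
    -- Some state improves when it returns to the target action. Otherwise the Bellman inequalities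
    -- give `V^πT ≤ V^π`, while the negative advantages give `V^π ≤ V^πT`. The values then agree,
    -- and the strict inequality at a state where the policies differ is violated.
    obtain ⟨s, hs, hQ⟩ : ∃ s, π s ≠ πT s ∧ M.V π s < M.Q π s (πT s) := by
      by_contra! hcon
      have hall : ∀ s, M.Q π s (πT s) ≤ M.V π s := fun s => by
        by_cases h : π s = πT s
        · rw [← h, ← M.V_eq_Q]
        · exact hcon s h
      have h1 : ∀ s, M.V πT s ≤ M.V π s := M.V_le_of_le πT fun s => hall s
      have h2 : ∀ s, M.V π s ≤ M.V πT s := M.V_le_of_le π fun s => by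
        change M.Q πT s (π s) ≤ _
        by_cases h : π s = πT s
        · rw [h, ← M.V_eq_Q]
        · exact (hneg s _ h).le
      obtain ⟨s, hs⟩ := Finset.card_pos.1 (by omega : 0 < (Finset.univ.filter fun s =>
        π s ≠ πT s).card)
      have hs' : π s ≠ πT s := by simpa using hs
      have h3 := hneg s _ hs'
      have h4 : M.V π s = M.Q πT s (π s) := by
        rw [M.V_eq_Q π s, Q, Q, funext fun s => le_antisymm (h2 s) (h1 s)]
      exact absurd (h1 s) (by rw [h4]; exact not_le.2 h3)
    -- The repaired policy has one disagreement less and, by the performance difference lemma, at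
    -- least the score of `π`.
    have h := ih (Function.update π s (πT s)) (by
      have : (Finset.univ.filter fun x => Function.update π s (πT s) x ≠ πT x) =
          (Finset.univ.filter fun x => π x ≠ πT x).erase s := by
        ext x
        by_cases hx : x = s
        · subst hx; simp
        · simp [hx]
      rw [this, Finset.card_erase_of_mem (by simpa using hs), hπ]
      rfl)
    refine le_trans ?_ h
    have hd := M.score_sub_score (Function.update π s (πT s)) π
    have : 0 ≤ M.score (Function.update π s (πT s)) - M.score π := by
      rw [hd]
      refine Finset.sum_nonneg fun x _ => mul_nonneg (M.occ_nonneg _ _) ?_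
      by_cases hx : x = s
      · subst hx; simp [hQ.le]
      · rw [Function.update_of_ne hx, ← M.V_eq_Q, sub_self]
    linarith

lemma score_le_optScore [Finite A] : M.score π ≤ M.optScore :=
  le_ciSup (Set.finite_range _).bddAbove π

lemma occMin_le [Finite A] (s : S) : M.occMin ≤ M.occ π s :=
  ciInf_le (Set.finite_range fun x : (S → A) × S => M.occ x.1 x.2).bddBelow (π, s)

lemma occ_withReward (R' : S → A → ℝ) (s : S) : (M.withReward R').occ π s = M.occ π s := rfl

/-- Subtracting at least the white-box attack from the rewards outside `πT`, and nothing on `πT`,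
makes every deviation from `πT` an `ε`-suboptimal action. -/
lemma isSubopt_withReward_sub [DecidableEq A] [Finite A] {πT : S → A} {ε : ℝ} (hε : 0 < ε)
    (hocc : ∀ π s, 0 < M.occ π s) {D : S → A → ℝ} (hD0 : ∀ s, D s (πT s) = 0)
    (hD : ∀ s a, a ≠ πT s →
      M.Q πT s a - M.V πT s + ε / M.occ (Function.update πT s a) s ≤ D s a)
    {s : S} {a : A} (ha : a ≠ πT s) :
    (M.withReward fun s a => M.R s a - D s a).IsSubopt ε s a := by
  set M' := M.withReward fun s a => M.R s a - D s a with hM'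
  -- The reduction vanishes along the target policy, so it lowers the action values of the
  -- deviations without touching the values they are compared with.
  have hV : ∀ s, M'.V πT s = M.V πT s := fun s => by
    simp only [V, hM', withReward, hD0, sub_zero]
    rfl
  have hQ : ∀ s a, M'.Q πT s a = M.Q πT s a - D s a := fun s a => by
    simp only [Q, hV]
    simp only [hM', withReward]
    ring
  have hadv : ∀ s a, a ≠ πT s →
      M'.Q πT s a - M'.V πT s ≤ -(ε / M.occ (Function.update πT s a) s) := fun s a ha => by
    rw [hQ, hV]
    linarith [hD s a ha]
  have hnb : ∀ s a, a ≠ πT s → M'.score (Function.update πT s a) ≤ M'.score πT - ε := by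
    intro s a ha
    have h := M'.score_sub_score (Function.update πT s a) πT
    -- Only the changed state has a nonzero advantage. The loss is its occupancy under the neighbour
    -- policy times an advantage of at most `-ε` over that same occupancy.
    rw [Finset.sum_eq_single s] at h
    · have h1 := mul_le_mul_of_nonneg_left (hadv s a ha) (hocc (Function.update πT s a) s).le
      rw [mul_neg, mul_div_cancel₀ _ (hocc _ _).ne'] at h1
      rw [Function.update_self, occ_withReward] at h
      linarith
    · intro x _ hx
      rw [Function.update_of_ne hx, ← M'.V_eq_Q, sub_self, mul_zero]
    · simp
  have hneg : ∀ s a, a ≠ πT s → M'.Q πT s a < M'.V πT s := fun s a ha => by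
    have := div_pos hε (hocc (Function.update πT s a) s)
    linarith [hadv s a ha]
  intro π hπ
  have hpos : 0 < (Finset.univ.filter fun s => π s ≠ πT s).card :=
    Finset.card_pos.2 ⟨s, by simpa [hπ] using ha⟩
  have h := M'.score_le_of_neighbours hneg hnb
    ((Finset.univ.filter fun s => π s ≠ πT s).card - 1) π (by omega)
  linarith [M'.score_le_optScore πT]

end MDP
end RewardPoisoning

namespace RewardPoisoning

/-! ## Perturbation of MDPs -/

namespace MDP

variable {S A : Type*} [Fintype S] [DecidableEq S] (M : MDP S A) (π : S → A)

lemma V_mem_Icc {lo hi : ℝ} (h : ∀ s, M.R s (π s) ∈ Set.Icc lo hi) (s : S) :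
    M.V π s ∈ Set.Icc (lo / (1 - M.γ)) (hi / (1 - M.γ)) := by
  have hγ : (1 - M.γ) ≠ 0 := by linarith [M.γ_lt_one]
  constructor
  · refine M.le_V_of_le π (f := fun _ => lo / (1 - M.γ)) (fun s => ?_) s
    rw [← Finset.sum_mul, sum_pmf_toReal, one_mul]
    have : lo / (1 - M.γ) = lo + M.γ * (lo / (1 - M.γ)) := by field_simp; ring
    linarith [(h s).1]
  · refine M.V_le_of_le π (f := fun _ => hi / (1 - M.γ)) (fun s => ?_) s
    rw [← Finset.sum_mul, sum_pmf_toReal, one_mul]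
    have : hi / (1 - M.γ) = hi + M.γ * (hi / (1 - M.γ)) := by field_simp; ring
    linarith [(h s).2]

variable {X Y : (S → A → ℝ) × (S → A → PMF S)}

/-- This is the one-step model error after the difference of future values has been split off. Two
transition laws have equal mass, so the value function may be centred at any `c`; hence a reward
range, not a reward norm, enters the error bounds. -/
lemma Q_sub_Q_withModel_le {eR eP c B : ℝ}
    (hR : ∀ s a, |X.1 s a - Y.1 s a| ≤ eR)
    (hP : ∀ s a, ∑ s', |(X.2 s a s').toReal - (Y.2 s a s').toReal| ≤ eP)
    (hV : ∀ s, |(M.withModel Y).V π s - c| ≤ B) (s : S) (a : A) :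
    |(M.withModel X).Q π s a - (M.withModel Y).Q π s a -
      M.γ * ∑ s', (X.2 s a s').toReal * ((M.withModel X).V π s' - (M.withModel Y).V π s')| ≤
      eR + M.γ * (eP * B) := by
  have hB : 0 ≤ B := (abs_nonneg _).trans (hV s)
  have h1 : (M.withModel X).Q π s a - (M.withModel Y).Q π s a -
      M.γ * ∑ s', (X.2 s a s').toReal * ((M.withModel X).V π s' - (M.withModel Y).V π s') =
      (X.1 s a - Y.1 s a) + M.γ * ∑ s', ((X.2 s a s').toReal - (Y.2 s a s').toReal) *
        ((M.withModel Y).V π s' - c) := by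
    have h2 : ∑ s', ((X.2 s a s').toReal - (Y.2 s a s').toReal) * c = 0 := by
      rw [← Finset.sum_mul, Finset.sum_sub_distrib, sum_pmf_toReal, sum_pmf_toReal]
      ring
    simp only [mul_sub, Finset.sum_sub_distrib] at h2 ⊢
    rw [h2]
    simp only [Q, withModel, sub_mul, Finset.sum_sub_distrib]
    ring
  rw [h1]
  refine (abs_add_le _ _).trans (add_le_add (hR s a) ?_)
  rw [abs_mul, abs_of_nonneg M.γ_nonneg]
  refine mul_le_mul_of_nonneg_left ?_ M.γ_nonneg
  calc _ ≤ ∑ s', |((X.2 s a s').toReal - (Y.2 s a s').toReal) *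
        ((M.withModel Y).V π s' - c)| := Finset.abs_sum_le_sum_abs _ _
    _ ≤ ∑ s', |(X.2 s a s').toReal - (Y.2 s a s').toReal| * B := by
        refine Finset.sum_le_sum fun s' _ => ?_
        rw [abs_mul]
        exact mul_le_mul_of_nonneg_left (hV s') (abs_nonneg _)
    _ ≤ eP * B := by
        rw [← Finset.sum_mul]
        exact mul_le_mul_of_nonneg_right (hP s a) hB

/-- Along the policy, the one-step error makes both `V_X - V_Y` and its negative satisfy a
discounted inequality with the transitions of `X`. The maximum principle turns each into a factor `1
/ (1 - γ)`. -/
lemma abs_V_sub_V_withModel_le {eR eP c B : ℝ}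
    (hR : ∀ s a, |X.1 s a - Y.1 s a| ≤ eR)
    (hP : ∀ s a, ∑ s', |(X.2 s a s').toReal - (Y.2 s a s').toReal| ≤ eP)
    (hV : ∀ s, |(M.withModel Y).V π s - c| ≤ B) (s : S) :
    |(M.withModel X).V π s - (M.withModel Y).V π s| ≤ (eR + M.γ * (eP * B)) / (1 - M.γ) := by
  have key := fun s => abs_le.1 (M.Q_sub_Q_withModel_le π hR hP hV s (π s))
  have hX := fun s => (M.withModel X).V_eq_Q π s
  have hY := fun s => (M.withModel Y).V_eq_Q π s
  refine abs_le.2 ⟨?_, ?_⟩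
  · rw [neg_le, neg_sub]
    refine le_div_of_le_add_discounted M.γ_nonneg M.γ_lt_one (fun s => X.2 s (π s))
      (g := fun s => (M.withModel Y).V π s - (M.withModel X).V π s) (fun s => ?_) s
    have h1 := (key s).1
    rw [← hX, ← hY] at h1
    have h2 : ∑ s', (X.2 s (π s) s').toReal *
        ((M.withModel Y).V π s' - (M.withModel X).V π s') =
        - ∑ s', (X.2 s (π s) s').toReal *
        ((M.withModel X).V π s' - (M.withModel Y).V π s') := by
      rw [← Finset.sum_neg_distrib]
      exact Finset.sum_congr rfl fun _ _ => by ring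
    rw [h2]
    linarith
  · refine le_div_of_le_add_discounted M.γ_nonneg M.γ_lt_one (fun s => X.2 s (π s))
      (g := fun s => (M.withModel X).V π s - (M.withModel Y).V π s) (fun s => ?_) s
    have h1 := (key s).2
    rw [← hX, ← hY] at h1
    linarith

/-- Simulation lemma for action values. -/
lemma abs_Q_sub_Q_withModel_le {eR eP c B : ℝ}
    (hR : ∀ s a, |X.1 s a - Y.1 s a| ≤ eR)
    (hP : ∀ s a, ∑ s', |(X.2 s a s').toReal - (Y.2 s a s').toReal| ≤ eP)
    (hV : ∀ s, |(M.withModel Y).V π s - c| ≤ B) (s : S) (a : A) :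
    |(M.withModel X).Q π s a - (M.withModel Y).Q π s a| ≤
      (eR + M.γ * (eP * B)) / (1 - M.γ) := by
  have h1 := abs_le.1 (M.Q_sub_Q_withModel_le π hR hP hV s a)
  have h2 := abs_le.1 (abs_sum_pmf_mul_le (X.2 s a) (M.abs_V_sub_V_withModel_le π hR hP hV))
  set K := eR + M.γ * (eP * B)
  have hγ := M.γ_lt_one
  -- One step of error plus discounted propagation of the value error reproduces the value bound, so
  -- action values need no larger constant.
  have h3 : K / (1 - M.γ) = K + M.γ * (K / (1 - M.γ)) := by
    have : 1 - M.γ ≠ 0 := by linarith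
    field_simp; ring
  have h4 := mul_le_mul_of_nonneg_left h2.1 M.γ_nonneg
  have h5 := mul_le_mul_of_nonneg_left h2.2 M.γ_nonneg
  rw [h3]
  exact abs_le.2 ⟨by linarith, by linarith⟩

/-- Simulation lemma for the discounted state distribution. -/
lemma abs_occ_sub_occ_withModel_le {eP : ℝ}
    (hP : ∀ s a, ∑ s', |(X.2 s a s').toReal - (Y.2 s a s').toReal| ≤ eP) (s : S) :
    |(M.withModel X).occ π s - (M.withModel Y).occ π s| ≤ M.γ * eP / (1 - M.γ) := by
  set x := (M.withModel X).occ π with hx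
  set y := (M.withModel Y).occ π with hy
  -- The `ℓ¹` distance contracts: write `xP_X - yP_Y` as `(x - y)P_X + y(P_X - P_Y)`. Stochastic
  -- matrices do not increase the first term, and `y` has mass one.
  have hle : ∑ s', |x s' - y s'| ≤ M.γ * (∑ s, |x s - y s| + eP) := by
    calc ∑ s', |x s' - y s'| = ∑ s', |M.γ * ∑ s, ((x s - y s) * (X.2 s (π s) s').toReal +
          y s * ((X.2 s (π s) s').toReal - (Y.2 s (π s) s').toReal))| := by
          refine Finset.sum_congr rfl fun s' _ => ?_
          have h1 := (M.withModel X).occ_eq π s'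
          have h2 := (M.withModel Y).occ_eq π s'
          rw [← hx] at h1
          rw [← hy] at h2
          rw [h1, h2]
          simp only [withModel, sub_mul, mul_sub, Finset.sum_sub_distrib, Finset.sum_add_distrib]
          congr 1
          ring
      _ ≤ ∑ s', M.γ * ∑ s, (|x s - y s| * (X.2 s (π s) s').toReal +
          y s * |(X.2 s (π s) s').toReal - (Y.2 s (π s) s').toReal|) := by
          refine Finset.sum_le_sum fun s' _ => ?_
          rw [abs_mul, abs_of_nonneg M.γ_nonneg]
          refine mul_le_mul_of_nonneg_left ((Finset.abs_sum_le_sum_abs _ _).trans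
            (Finset.sum_le_sum fun s _ => (abs_add_le _ _).trans ?_)) M.γ_nonneg
          rw [abs_mul, abs_mul, abs_of_nonneg ENNReal.toReal_nonneg,
            abs_of_nonneg ((M.withModel Y).occ_nonneg π s)]
      _ = M.γ * (∑ s, |x s - y s| + ∑ s, y s *
          ∑ s', |(X.2 s (π s) s').toReal - (Y.2 s (π s) s').toReal|) := by
          rw [← Finset.mul_sum, Finset.sum_comm]
          simp only [Finset.sum_add_distrib, ← Finset.mul_sum, sum_pmf_toReal, mul_one]
      _ ≤ _ := by
          refine mul_le_mul_of_nonneg_left (add_le_add le_rfl ?_) M.γ_nonneg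
          calc _ ≤ ∑ s, y s * eP := Finset.sum_le_sum fun s _ =>
                mul_le_mul_of_nonneg_left (hP s _) ((M.withModel Y).occ_nonneg π s)
            _ = eP := by rw [← Finset.sum_mul, hy, sum_occ, one_mul]
  have hγ := M.γ_lt_one
  have h1 : |x s - y s| ≤ ∑ s, |x s - y s| :=
    Finset.single_le_sum (f := fun s => |x s - y s|) (fun _ _ => abs_nonneg _)
      (Finset.mem_univ s)
  rw [le_div_iff₀ (by linarith)]
  nlinarith

end MDP

/-! ## Confidence radii -/

section radii

variable (S A : Type*) [Fintype S] [Fintype A] {σ p : ℝ}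

/-- Passing from `n` to `n + 1` multiplies the argument by `1 + 2 / n` and so adds at most `2 / n`
to the logarithm. The quotient decreases once the logarithm is at least `2`; `c ≥ 8` puts it above
`log 16`. This monotonicity lets `Nmin` stand for all visit counts in the radii. -/
lemma antitone_log_div {c : ℝ} (hc : 8 ≤ c) :
    AntitoneOn (fun n : ℕ => Real.log (c * (n * (n + 1))) / n) (Set.Ici 1) := by
  have hstep : ∀ n : ℕ, 1 ≤ n → Real.log (c * ((n + 1 : ℕ) * ((n + 1 : ℕ) + 1))) / (n + 1 : ℕ) ≤
      Real.log (c * (n * (n + 1))) / n := by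
    intro n hn
    have hn' : (1 : ℝ) ≤ n := by exact_mod_cast hn
    have h0 : (0 : ℝ) < c * (n * (n + 1)) := by positivity
    have e1 : c * (((n + 1 : ℕ) : ℝ) * ((n + 1 : ℕ) + 1)) =
        (c * (n * (n + 1))) * (1 + 2 / n) := by
      push_cast
      field_simp
      ring
    have h1 : Real.log (1 + 2 / n) ≤ 2 / n := by
      have := Real.log_le_sub_one_of_pos (show (0 : ℝ) < 1 + 2 / n by positivity)
      linarith
    have h2 : 2 ≤ Real.log (c * (n * (n + 1))) := by
      have : Real.log 16 ≤ Real.log (c * (n * (n + 1))) :=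
        Real.log_le_log (by norm_num) (by
          have : (2 : ℝ) ≤ n * (n + 1) := by nlinarith
          nlinarith)
      have h16 : Real.log 16 = 4 * Real.log 2 := by
        rw [show (16 : ℝ) = 2 ^ 4 by norm_num, Real.log_pow]
        norm_num
      linarith [Real.log_two_gt_d9]
    rw [e1, Real.log_mul h0.ne' (by positivity), div_le_div_iff₀ (by positivity) (by positivity)]
    have h3 : Real.log (1 + 2 / n) * n ≤ 2 := by
      rwa [← le_div_iff₀ (by positivity)]
    push_cast
    nlinarith
  intro a ha b _ hab
  induction b, hab using Nat.le_induction with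
  | base => exact le_rfl
  | succ k hk ih => exact (hstep k (le_trans ha hk)).trans (ih (le_trans ha hk))

lemma uConf_div_sqrt (n : ℕ) : uConf S A σ p n / √n =
    σ * √(2 * (Real.log (4 * Fintype.card S * Fintype.card A / p * (n * (n + 1))) / n)) := by
  rw [uConf, mul_div_assoc, ← Real.sqrt_div' _ (Nat.cast_nonneg n), mul_div_assoc, mul_div_right_comm]

lemma wConf_div_sqrt (n : ℕ) : wConf S A p n / √n =
    √(2 * (Real.log (2 ^ Fintype.card S * (2 * Fintype.card S * Fintype.card A) / p *
      (n * (n + 1))) / n)) := by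
  rw [wConf, ← Real.sqrt_div' _ (Nat.cast_nonneg n), mul_div_assoc, ← mul_assoc, mul_div_right_comm]

variable [Nonempty S] [Nontrivial A]

lemma eight_le_uConst (hp : p ∈ Set.Ioo (0 : ℝ) 1) :
    8 ≤ 4 * Fintype.card S * Fintype.card A / p := by
  have h1 : (1 : ℝ) ≤ Fintype.card S := by exact_mod_cast Fintype.card_pos (α := S)
  have h2 : (2 : ℝ) ≤ Fintype.card A := by exact_mod_cast Fintype.one_lt_card (α := A)
  rw [le_div_iff₀ hp.1]
  nlinarith [hp.2, hp.1]

lemma eight_le_wConst (hp : p ∈ Set.Ioo (0 : ℝ) 1) :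
    8 ≤ 2 ^ Fintype.card S * (2 * Fintype.card S * Fintype.card A) / p := by
  have h1 : (1 : ℝ) ≤ Fintype.card S := by exact_mod_cast Fintype.card_pos (α := S)
  have h2 : (2 : ℝ) ≤ Fintype.card A := by exact_mod_cast Fintype.one_lt_card (α := A)
  have h3 : (2 : ℝ) ≤ 2 ^ Fintype.card S := by
    calc (2 : ℝ) = 2 ^ 1 := by norm_num
      _ ≤ _ := pow_le_pow_right₀ (by norm_num) Fintype.card_pos
  have h4 : (4 : ℝ) ≤ 2 * Fintype.card S * Fintype.card A := by nlinarith
  rw [le_div_iff₀ hp.1]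
  nlinarith [hp.2, hp.1]

lemma uConf_div_sqrt_anti (hσ : 0 ≤ σ) (hp : p ∈ Set.Ioo (0 : ℝ) 1) {n k : ℕ} (hn : 1 ≤ n)
    (hk : n ≤ k) : uConf S A σ p k / √k ≤ uConf S A σ p n / √n := by
  rw [uConf_div_sqrt, uConf_div_sqrt]
  refine mul_le_mul_of_nonneg_left (Real.sqrt_le_sqrt (mul_le_mul_of_nonneg_left ?_ (by norm_num)))
    hσ
  exact antitone_log_div (eight_le_uConst S A hp) hn (hn.trans hk : 1 ≤ k) hk

lemma wConf_div_sqrt_anti (hp : p ∈ Set.Ioo (0 : ℝ) 1) {n k : ℕ} (hn : 1 ≤ n)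
    (hk : n ≤ k) : wConf S A p k / √k ≤ wConf S A p n / √n := by
  rw [wConf_div_sqrt, wConf_div_sqrt]
  refine Real.sqrt_le_sqrt (mul_le_mul_of_nonneg_left ?_ (by norm_num))
  exact antitone_log_div (eight_le_wConst S A hp) hn (hn.trans hk : 1 ≤ k) hk

/-- For `n ≥ 1` one has `1 ≤ n(n + 1) ≤ 2n²`, which squeezes the quotient between multiples of `1 /
n` and `log n / n`. -/
lemma tendsto_log_div {c : ℝ} (hc : 0 < c) :
    Filter.Tendsto (fun n : ℕ => Real.log (c * (n * (n + 1))) / n) Filter.atTop (nhds 0) := by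
  have h0 : Filter.Tendsto (fun n : ℕ => Real.log n / (n : ℝ)) Filter.atTop (nhds 0) :=
    (Real.isLittleO_log_id_atTop.tendsto_div_nhds_zero).comp tendsto_natCast_atTop_atTop
  have hc0 : Filter.Tendsto (fun n : ℕ => (Real.log c + Real.log 2) / (n : ℝ)) Filter.atTop
      (nhds 0) := tendsto_const_nhds.div_atTop tendsto_natCast_atTop_atTop
  have h1 : Filter.Tendsto (fun n : ℕ => Real.log c / (n : ℝ)) Filter.atTop
      (nhds 0) := tendsto_const_nhds.div_atTop tendsto_natCast_atTop_atTop
  have hu := hc0.add (h0.const_mul 2)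
  rw [mul_zero, add_zero] at hu
  refine tendsto_of_tendsto_of_tendsto_of_le_of_le' h1 hu ?_ ?_
  · filter_upwards [Filter.eventually_ge_atTop 1] with n hn
    have hn' : (1 : ℝ) ≤ n := by exact_mod_cast hn
    refine div_le_div_of_nonneg_right (Real.log_le_log hc ?_) (by positivity)
    exact le_mul_of_one_le_right hc.le (by nlinarith)
  · filter_upwards [Filter.eventually_ge_atTop 1] with n hn
    have hn' : (1 : ℝ) ≤ n := by exact_mod_cast hn
    have hn0 : (0 : ℝ) < n := by linarith
    rw [show (Real.log c + Real.log 2) / (n : ℝ) + 2 * (Real.log n / n) =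
      (Real.log c + Real.log 2 + 2 * Real.log n) / n by ring]
    refine div_le_div_of_nonneg_right ?_ (by positivity)
    have h2 : Real.log c + Real.log 2 + 2 * Real.log n = Real.log (c * (n * (2 * n))) := by
      rw [Real.log_mul hc.ne' (by positivity), Real.log_mul hn0.ne' (by positivity),
        Real.log_mul (by norm_num) hn0.ne']
      ring
    rw [h2]
    refine Real.log_le_log (by positivity) (mul_le_mul_of_nonneg_left ?_ hc.le)
    nlinarith

lemma tendsto_uConf (hp : p ∈ Set.Ioo (0 : ℝ) 1) :
    Filter.Tendsto (fun n : ℕ => uConf S A σ p n / √n) Filter.atTop (nhds 0) := by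
  simp only [uConf_div_sqrt]
  have h := (((tendsto_log_div (lt_of_lt_of_le (by norm_num) (eight_le_uConst S A hp))).const_mul
    2).sqrt).const_mul σ
  simpa using h

lemma tendsto_wConf (hp : p ∈ Set.Ioo (0 : ℝ) 1) :
    Filter.Tendsto (fun n : ℕ => wConf S A p n / √n) Filter.atTop (nhds 0) := by
  simp only [wConf_div_sqrt]
  have h := ((tendsto_log_div (lt_of_lt_of_le (by norm_num) (eight_le_wConst S A hp))).const_mul
    2).sqrt
  simpa using h

end radii

/-! ### The defining property of the visit threshold -/

section N0

variable {S A : Type*} [Fintype S] [DecidableEq S] [Nonempty S] [Fintype A] [Nontrivial A]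

lemma eventually_sq_le {f : ℕ → ℝ} (hf : Filter.Tendsto (fun n : ℕ => f n / √n) Filter.atTop (nhds 0)) :
    ∀ᶠ n : ℕ in Filter.atTop, f n ^ 2 ≤ n := by
  have h2 := hf.pow 2
  rw [zero_pow two_ne_zero] at h2
  filter_upwards [h2.eventually (ge_mem_nhds one_pos), Filter.eventually_ge_atTop 1] with n hn h1
  have hn' : (0 : ℝ) < n := by exact_mod_cast h1
  rwa [div_pow, Real.sq_sqrt hn'.le, div_le_one hn'] at hn

/-- An infimum of natural numbers is attained only if the set is nonempty. Nonemptiness holds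
because each requirement says that a combination of vanishing radii is eventually at most one. -/
lemma N0_spec (M : MDP S A) (σ m ε : ℝ) {p : ℝ} (hp : p ∈ Set.Ioo (0 : ℝ) 1) :
    1 ≤ N0 M σ p m ε ∧ ∀ n : ℕ, N0 M σ p m ε ≤ n →
    (4 * uConf S A σ p n / M.rewardRange) ^ 2 ≤ n ∧
    ((8 * uConf S A σ p n + 16 * M.γ * M.rewardRange * wConf S A p n) /
      ((1 - M.γ) ^ 2 * m)) ^ 2 ≤ n ∧
    (2 * M.γ * wConf S A p n / (1 - M.γ) *
      ((6 * ε + m * M.occMin) / (m * M.occMin ^ 2))) ^ 2 ≤ n := by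
  have hu := tendsto_uConf S A (σ := σ) hp
  have hw := tendsto_wConf S A hp
  have e1 := eventually_sq_le (f := fun n => 4 * uConf S A σ p n / M.rewardRange) (by
    have := hu.const_mul (4 / M.rewardRange)
    rw [mul_zero] at this
    exact this.congr fun n => by ring)
  have e2 := eventually_sq_le (f := fun n => (8 * uConf S A σ p n +
      16 * M.γ * M.rewardRange * wConf S A p n) / ((1 - M.γ) ^ 2 * m)) (by
    have := ((hu.const_mul 8).add (hw.const_mul (16 * M.γ * M.rewardRange))).div_const
      ((1 - M.γ) ^ 2 * m)
    rw [mul_zero, mul_zero, add_zero, zero_div] at this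
    exact this.congr fun n => by ring)
  have e3 := eventually_sq_le (f := fun n => 2 * M.γ * wConf S A p n / (1 - M.γ) *
      ((6 * ε + m * M.occMin) / (m * M.occMin ^ 2))) (by
    have := hw.const_mul (2 * M.γ / (1 - M.γ) * ((6 * ε + m * M.occMin) / (m * M.occMin ^ 2)))
    rw [mul_zero] at this
    exact this.congr fun n => by ring)
  obtain ⟨N, hN⟩ := Filter.eventually_atTop.1 (e1.and (e2.and e3))
  exact Nat.sInf_mem (s := {N : ℕ | 1 ≤ N ∧ ∀ n : ℕ, N ≤ n →
    (4 * uConf S A σ p n / M.rewardRange) ^ 2 ≤ n ∧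
    ((8 * uConf S A σ p n + 16 * M.γ * M.rewardRange * wConf S A p n) /
      ((1 - M.γ) ^ 2 * m)) ^ 2 ≤ n ∧
    (2 * M.γ * wConf S A p n / (1 - M.γ) *
      ((6 * ε + m * M.occMin) / (m * M.occMin ^ 2))) ^ 2 ≤ n})
    ⟨max 1 N, le_max_left _ _, fun n hn => hN n ((le_max_right _ _).trans hn)⟩

end N0

end RewardPoisoning

namespace RewardPoisoning

/-! ## Consequences of the confidence set -/

namespace Stats

variable {S A : Type*} [Fintype S] [Fintype A] [DecidableEq S] [DecidableEq A]
  [Nonempty S] [Nontrivial A]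

section

variable {D : Stats S A} {σ p : ℝ} {X Y : (S → A → ℝ) × (S → A → PMF S)}

lemma Nmin_le (D : Stats S A) (s : S) (a : A) : D.Nmin ≤ D.N s a :=
  ciInf_le (OrderBot.bddBelow _) (s, a)

lemma le_Nmin {n : ℕ} (h : ∀ s a, n ≤ D.N s a) : n ≤ D.Nmin :=
  le_ciInf fun x => h x.1 x.2

lemma uConf_nonneg (hσ : 0 ≤ σ) (n : ℕ) : 0 ≤ uConf S A σ p n :=
  mul_nonneg hσ (Real.sqrt_nonneg _)

lemma wConf_nonneg (n : ℕ) : 0 ≤ wConf S A p n := Real.sqrt_nonneg _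

variable (hN : 0 < D.Nmin)
include hN

lemma N_ne_zero (s : S) (a : A) : D.N s a ≠ 0 := (hN.trans_le (D.Nmin_le s a)).ne'

lemma uConf_N_le (hσ : 0 ≤ σ) (hp : p ∈ Set.Ioo (0 : ℝ) 1) (s : S) (a : A) :
    uConf S A σ p (D.N s a) / √(D.N s a) ≤ uConf S A σ p D.Nmin / √D.Nmin :=
  uConf_div_sqrt_anti S A hσ hp hN (D.Nmin_le s a)

lemma wConf_N_le (hp : p ∈ Set.Ioo (0 : ℝ) 1) (s : S) (a : A) :
    wConf S A p (D.N s a) / √(D.N s a) ≤ wConf S A p D.Nmin / √D.Nmin :=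
  wConf_div_sqrt_anti S A hp hN (D.Nmin_le s a)

lemma reward_mem_Icc (hX : X ∈ D.confSet σ p) (s : S) (a : A) :
    X.1 s a ∈ Set.Icc
      (⨅ x : S × A, (D.Rhat x.1 x.2 - uConf S A σ p (D.N x.1 x.2) / √(D.N x.1 x.2)))
      (⨆ x : S × A, (D.Rhat x.1 x.2 + uConf S A σ p (D.N x.1 x.2) / √(D.N x.1 x.2))) := by
  have h := abs_le.1 (hX s a (N_ne_zero hN s a)).1
  constructor
  · exact (ciInf_le (Set.finite_range _).bddBelow (s, a)).trans (by dsimp only; linarith)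
  · exact le_trans (by dsimp only; linarith) (le_ciSup (f := fun x : S × A =>
      D.Rhat x.1 x.2 + uConf S A σ p (D.N x.1 x.2) / √(D.N x.1 x.2))
      (Set.finite_range _).bddAbove (s, a))

lemma rangeHat_nonneg (hX : X ∈ D.confSet σ p) : 0 ≤ D.rangeHat σ p := by
  obtain ⟨s⟩ := ‹Nonempty S›
  obtain ⟨a⟩ : Nonempty A := inferInstance
  have h := reward_mem_Icc hN hX s a
  exact sub_nonneg.2 (h.1.trans h.2)

/-- Each end of the range moves by at most two radii: one from the empirical error and one added on
purpose. -/
lemma rangeHat_le (hσ : 0 ≤ σ) (hp : p ∈ Set.Ioo (0 : ℝ) 1) (M : MDP S A)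
    (hM : (M.R, M.P) ∈ D.confSet σ p) :
    D.rangeHat σ p ≤ M.rewardRange + 4 * (uConf S A σ p D.Nmin / √D.Nmin) := by
  have h1 : ∀ x : S × A, D.Rhat x.1 x.2 + uConf S A σ p (D.N x.1 x.2) / √(D.N x.1 x.2) ≤
      (⨆ x : S × A, M.R x.1 x.2) + 2 * (uConf S A σ p D.Nmin / √D.Nmin) := fun x => by
    have h := abs_le.1 (hM x.1 x.2 (N_ne_zero hN _ _)).1
    have h2 := uConf_N_le hN hσ hp x.1 x.2
    have h3 := le_ciSup (f := fun x : S × A => M.R x.1 x.2) (Set.finite_range _).bddAbove x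
    dsimp only at h h3
    linarith
  have h2 : ∀ x : S × A, (⨅ x : S × A, M.R x.1 x.2) - 2 * (uConf S A σ p D.Nmin / √D.Nmin) ≤
      D.Rhat x.1 x.2 - uConf S A σ p (D.N x.1 x.2) / √(D.N x.1 x.2) := fun x => by
    have h := abs_le.1 (hM x.1 x.2 (N_ne_zero hN _ _)).1
    have h2 := uConf_N_le hN hσ hp x.1 x.2
    have h3 := ciInf_le (f := fun x : S × A => M.R x.1 x.2) (Set.finite_range _).bddBelow x
    dsimp only at h h3
    linarith
  have h3 := ciSup_le h1
  have h4 := le_ciInf h2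
  rw [rangeHat, MDP.rewardRange]
  linarith

/-- Both models are within one radius of the empirical mean, and the radius at any pair is at most
the one at the least visited pair. -/
lemma abs_reward_sub_le (hσ : 0 ≤ σ) (hp : p ∈ Set.Ioo (0 : ℝ) 1) (hX : X ∈ D.confSet σ p)
    (hY : Y ∈ D.confSet σ p) (s : S) (a : A) :
    |X.1 s a - Y.1 s a| ≤ 2 * (uConf S A σ p D.Nmin / √D.Nmin) := by
  have h1 := abs_le.1 (hX s a (N_ne_zero hN s a)).1
  have h2 := abs_le.1 (hY s a (N_ne_zero hN s a)).1
  have h3 := uConf_N_le hN hσ hp s a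
  exact abs_le.2 ⟨by linarith, by linarith⟩

lemma sum_abs_trans_sub_le (hp : p ∈ Set.Ioo (0 : ℝ) 1) (hX : X ∈ D.confSet σ p)
    (hY : Y ∈ D.confSet σ p) (s : S) (a : A) :
    ∑ s', |(X.2 s a s').toReal - (Y.2 s a s').toReal| ≤
      2 * (wConf S A p D.Nmin / √D.Nmin) := by
  have h1 := (hX s a (N_ne_zero hN s a)).2
  have h2 := (hY s a (N_ne_zero hN s a)).2
  have h3 := wConf_N_le hN hp s a
  have h4 : ∑ s', |(X.2 s a s').toReal - (Y.2 s a s').toReal| ≤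
      ∑ s' : S, |(X.2 s a s').toReal - D.Phat s a s'| +
      ∑ s' : S, |(Y.2 s a s').toReal - D.Phat s a s'| := by
    rw [← Finset.sum_add_distrib]
    refine Finset.sum_le_sum fun s' _ => ?_
    rw [abs_sub_comm (Y.2 s a s').toReal]
    exact abs_sub_le _ _ _
  linarith

variable (M : MDP S A) (π : S → A)

/-- This provides the centre `c` and the bound `B` for the simulation lemmas. The centre is the
lower end of the possible values, so `B` is computable by the attacker. -/
lemma abs_V_sub_le (hX : X ∈ D.confSet σ p) (s : S) :
    |(M.withModel X).V π s - (⨅ x : S × A,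
      (D.Rhat x.1 x.2 - uConf S A σ p (D.N x.1 x.2) / √(D.N x.1 x.2))) / (1 - M.γ)| ≤
      D.rangeHat σ p / (1 - M.γ) := by
  have h := (M.withModel X).V_mem_Icc π (fun s => reward_mem_Icc hN hX s (π s)) s
  change (M.withModel X).V π s ∈ Set.Icc (_ / (1 - M.γ)) (_ / (1 - M.γ)) at h
  have hr := rangeHat_nonneg hN hX
  have hγ : 0 < 1 - M.γ := by linarith [M.γ_lt_one]
  have hr' : 0 ≤ D.rangeHat σ p / (1 - M.γ) := div_nonneg hr hγ.le
  rw [abs_le]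
  refine ⟨by linarith [h.1], ?_⟩
  rw [rangeHat, sub_div]
  linarith [h.2]

/-- There is slack in the reward part: `eQ` divides it by `(1 - γ)²`, where the simulation lemma
needs only `1 - γ`. -/
lemma error_le_eQ (hσ : 0 ≤ σ) :
    (2 * (uConf S A σ p D.Nmin / √D.Nmin) + M.γ * (2 * (wConf S A p D.Nmin / √D.Nmin) *
      (D.rangeHat σ p / (1 - M.γ)))) / (1 - M.γ) ≤ D.eQ M σ p := by
  have hγ : 0 < 1 - M.γ := by linarith [M.γ_lt_one]
  have hs : (0 : ℝ) < √D.Nmin := Real.sqrt_pos.2 (by exact_mod_cast hN)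
  have e : D.eQ M σ p = (2 * (uConf S A σ p D.Nmin / √D.Nmin) / (1 - M.γ) +
      M.γ * (2 * (wConf S A p D.Nmin / √D.Nmin) * (D.rangeHat σ p / (1 - M.γ)))) /
      (1 - M.γ) := by
    rw [eQ]
    field_simp
  rw [e]
  refine div_le_div_of_nonneg_right (add_le_add ?_ le_rfl) hγ.le
  refine le_div_self ?_ hγ (by linarith [M.γ_nonneg])
  have := uConf_nonneg (S := S) (A := A) (p := p) hσ D.Nmin
  positivity

lemma abs_Q_sub_Q_le (hσ : 0 ≤ σ) (hp : p ∈ Set.Ioo (0 : ℝ) 1) (hX : X ∈ D.confSet σ p)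
    (hY : Y ∈ D.confSet σ p) (s : S) (a : A) :
    |(M.withModel X).Q π s a - (M.withModel Y).Q π s a| ≤ D.eQ M σ p :=
  (M.abs_Q_sub_Q_withModel_le π (abs_reward_sub_le hN hσ hp hX hY)
    (sum_abs_trans_sub_le hN hp hX hY) (abs_V_sub_le hN M π hY) s a).trans
    (error_le_eQ hN M hσ)

lemma abs_V_sub_V_le (hσ : 0 ≤ σ) (hp : p ∈ Set.Ioo (0 : ℝ) 1) (hX : X ∈ D.confSet σ p)
    (hY : Y ∈ D.confSet σ p) (s : S) :
    |(M.withModel X).V π s - (M.withModel Y).V π s| ≤ D.eQ M σ p :=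
  (M.abs_V_sub_V_withModel_le π (abs_reward_sub_le hN hσ hp hX hY)
    (sum_abs_trans_sub_le hN hp hX hY) (abs_V_sub_le hN M π hY) s).trans
    (error_le_eQ hN M hσ)

lemma abs_occ_sub_occ_le (hp : p ∈ Set.Ioo (0 : ℝ) 1) (hX : X ∈ D.confSet σ p)
    (hY : Y ∈ D.confSet σ p) (s : S) :
    |(M.withModel X).occ π s - (M.withModel Y).occ π s| ≤ D.eMu M p := by
  refine (M.abs_occ_sub_occ_withModel_le π (sum_abs_trans_sub_le hN hp hX hY) s).trans_eq ?_
  have hγ : 1 - M.γ ≠ 0 := by linarith [M.γ_lt_one]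
  have hs : √(D.Nmin : ℝ) ≠ 0 := (Real.sqrt_pos.2 (by exact_mod_cast hN)).ne'
  rw [eMu]
  field_simp

variable {M} (hM : (M.R, M.P) ∈ D.confSet σ p)
include hM

/-- The lower end holds because the true model competes in the supremum, the upper end because all
models of the set are within `eQ` of it. The latter also gives the boundedness without which a real
supremum means nothing. -/
lemma Qhigh_mem (hσ : 0 ≤ σ) (hp : p ∈ Set.Ioo (0 : ℝ) 1) (s : S) (a : A) :
    D.Qhigh M σ p π s a ∈ Set.Icc (M.Q π s a) (M.Q π s a + D.eQ M σ p) := by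
  have hb : ∀ X : D.confSet σ p, (M.withModel X).Q π s a ≤ M.Q π s a + D.eQ M σ p := fun X => by
    have := (abs_le.1 (abs_Q_sub_Q_le hN M π hσ hp X.2 hM s a)).2
    change _ - M.Q π s a ≤ _ at this
    linarith
  have : Nonempty (D.confSet σ p) := ⟨⟨_, hM⟩⟩
  exact ⟨le_ciSup (f := fun X : D.confSet σ p => (M.withModel X).Q π s a)
    ⟨_, Set.forall_mem_range.2 hb⟩ ⟨_, hM⟩, ciSup_le hb⟩

lemma Vlow_mem (hσ : 0 ≤ σ) (hp : p ∈ Set.Ioo (0 : ℝ) 1) (s : S) :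
    D.Vlow M σ p π s ∈ Set.Icc (M.V π s - D.eQ M σ p) (M.V π s) := by
  have hb : ∀ X : D.confSet σ p, M.V π s - D.eQ M σ p ≤ (M.withModel X).V π s := fun X => by
    have := (abs_le.1 (abs_V_sub_V_le hN M π hσ hp X.2 hM s)).1
    change _ ≤ _ - M.V π s at this
    linarith
  have : Nonempty (D.confSet σ p) := ⟨⟨_, hM⟩⟩
  exact ⟨le_ciInf hb, ciInf_le (f := fun X : D.confSet σ p => (M.withModel X).V π s)
    ⟨_, Set.forall_mem_range.2 hb⟩ ⟨_, hM⟩⟩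

lemma occLow_mem (hp : p ∈ Set.Ioo (0 : ℝ) 1) (s : S) :
    D.occLow M σ p π s ∈ Set.Icc (M.occ π s - D.eMu M p) (M.occ π s) := by
  have hb : ∀ X : D.confSet σ p, M.occ π s - D.eMu M p ≤ (M.withModel X).occ π s := fun X => by
    have := (abs_le.1 (abs_occ_sub_occ_le hN M π hp X.2 hM s)).1
    change _ ≤ _ - M.occ π s at this
    linarith
  have : Nonempty (D.confSet σ p) := ⟨⟨_, hM⟩⟩
  exact ⟨le_ciInf hb, ciInf_le (f := fun X : D.confSet σ p => (M.withModel X).occ π s)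
    ⟨_, Set.forall_mem_range.2 hb⟩ ⟨_, hM⟩⟩

end

/-! ### The empirical attack against the white-box attack -/

variable {D : Stats S A} {σ p m ε : ℝ} {M : MDP S A} {πT : S → A}

lemma deltaHat_nonneg (s : S) (a : A) : 0 ≤ D.deltaHat M σ p ε πT s a := by
  rw [deltaHat]
  split_ifs
  · exact le_rfl
  · exact le_max_left _ _

/-- Each of the three terms of `Δ̂` errs upwards. For the last one this needs `occLow` to be
positive, which the stopping rule checks. -/
lemma le_deltaHat (hσ : 0 ≤ σ) (hp : p ∈ Set.Ioo (0 : ℝ) 1) (hε : 0 < ε)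
    (hM : (M.R, M.P) ∈ D.confSet σ p) (hS : D.Stop M σ p m ε πT) {s : S} {a : A}
    (ha : a ≠ πT s) :
    M.Q πT s a - M.V πT s + ε / M.occ (Function.update πT s a) s ≤
      D.deltaHat M σ p ε πT s a := by
  have h1 := (Qhigh_mem hS.1 πT hM hσ hp s a).1
  have h2 := (Vlow_mem hS.1 πT hM hσ hp s).2
  have h3 := (occLow_mem hS.1 (Function.update πT s a) hM hp s).2
  have h4 := div_le_div_of_nonneg_left hε.le (hS.2 s a ha).1 h3
  rw [deltaHat, if_neg ha]
  exact le_max_of_le_right (by linarith)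

/-- The excess is one `eQ` from `Qhigh`, one from `Vlow`, and the gap between `ε / occLow` and the
true `ε / μ`, where `μ ≤ occLow + eMu`. Their sum is exactly what the stopping rule compares with
`m`. -/
lemma deltaHat_le (hσ : 0 ≤ σ) (hp : p ∈ Set.Ioo (0 : ℝ) 1) (hε : 0 < ε) (hm : 0 ≤ m)
    (hM : (M.R, M.P) ∈ D.confSet σ p) (hS : D.Stop M σ p m ε πT)
    (hocc : ∀ π s, 0 < M.occ π s) (s : S) (a : A) :
    D.deltaHat M σ p ε πT s a ≤ M.whiteBox ε πT s a + m := by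
  rw [deltaHat, MDP.whiteBox]
  split_ifs with ha
  · linarith
  · have h1 := (Qhigh_mem hS.1 πT hM hσ hp s a).2
    have h2 := (Vlow_mem hS.1 πT hM hσ hp s).1
    have h3 := (occLow_mem hS.1 (Function.update πT s a) hM hp s).1
    have h4 := div_le_div_of_nonneg_left hε.le (hocc (Function.update πT s a) s)
      (show _ ≤ D.occLow M σ p (Function.update πT s a) s + D.eMu M p by linarith)
    have h5 := (hS.2 s a ha).2
    refine max_le (by linarith [le_max_left 0 (M.Q πT s a - M.V πT s +
      ε / M.occ (Function.update πT s a) s)]) ?_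
    linarith [le_max_right 0 (M.Q πT s a - M.V πT s + ε / M.occ (Function.update πT s a) s)]

/-- Visiting every pair `N0` times suffices for ending the exploration phase. -/
lemma stop_of_N0_le (hσ : 0 ≤ σ) (hp : p ∈ Set.Ioo (0 : ℝ) 1) (hε : 0 < ε) (hm : 0 < m)
    (hR : 0 < M.rewardRange) (hocc : 0 < M.occMin)
    (hM : (M.R, M.P) ∈ D.confSet σ p) (hN : N0 M σ p m ε ≤ D.Nmin) :
    D.Stop M σ p m ε πT := by
  obtain ⟨hN1, hN2⟩ := N0_spec M σ m ε hp
  obtain ⟨c1, c2, c3⟩ := hN2 _ hN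
  have hN0 : 0 < D.Nmin := by omega
  have hNr : (0 : ℝ) < D.Nmin := by exact_mod_cast hN0
  have hs : (0 : ℝ) < √D.Nmin := Real.sqrt_pos.2 hNr
  have hγ : 0 < 1 - M.γ := by linarith [M.γ_lt_one]
  have hγ0 := M.γ_nonneg
  have hu := uConf_nonneg (S := S) (A := A) (p := p) hσ D.Nmin
  have hw := wConf_nonneg (S := S) (A := A) (p := p) D.Nmin
  have hrange := rangeHat_le hN0 hσ hp M hM
  have d1 := Real.le_sqrt_of_sq_le c1
  have d2 := Real.le_sqrt_of_sq_le c2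
  have d3 := Real.le_sqrt_of_sq_le c3
  set u := uConf S A σ p D.Nmin
  set w := wConf S A p D.Nmin
  set q := √(D.Nmin : ℝ)
  set μ := M.occMin
  -- The first requirement in `N0` makes the excess of four radii at most the true range. Only then
  -- can the second requirement, stated with the true range, control `eQ`.
  have hrange2 : D.rangeHat σ p ≤ 2 * M.rewardRange := by
    have : 4 * (u / q) ≤ M.rewardRange := by
      rw [div_le_iff₀ hR] at d1
      rw [← mul_div_assoc, div_le_iff₀ hs]
      linarith
    linarith
  have heQ : 2 * D.eQ M σ p ≤ m / 2 := by
    rw [div_le_iff₀ (by positivity)] at d2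
    rw [eQ, ← mul_div_assoc, div_le_iff₀ (by positivity)]
    have h1 : M.γ * D.rangeHat σ p * w ≤ M.γ * (2 * M.rewardRange) * w :=
      mul_le_mul_of_nonneg_right (mul_le_mul_of_nonneg_left hrange2 hγ0) hw
    nlinarith
  have hE : D.eMu M p ≤ m * μ ^ 2 / (6 * ε + m * μ) := by
    have e1 : D.eMu M p = 2 * M.γ * w / (1 - M.γ) / q := by
      rw [eMu, div_div]
    rw [e1, div_le_div_iff₀ hs (by positivity)]
    rw [← mul_div_assoc, div_le_iff₀ (by positivity)] at d3
    linarith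
  have hE0 : 0 ≤ D.eMu M p := by
    rw [eMu]
    positivity
  refine ⟨hN0, fun s a ha => ?_⟩
  have h1 := (occLow_mem hN0 (Function.update πT s a) hM hp s).1
  have h2 := M.occMin_le (Function.update πT s a) s
  set x := D.occLow M σ p (Function.update πT s a) s
  set e := D.eMu M p
  -- The third requirement is tuned so that `μ - eMu` keeps this fraction of `μ`; in particular
  -- `occLow` is positive.
  have hx1 : μ * (6 * ε / (6 * ε + m * μ)) ≤ x := by
    have : μ * (6 * ε / (6 * ε + m * μ)) = μ - m * μ ^ 2 / (6 * ε + m * μ) := by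
      field_simp
      ring
    linarith
  have hx0 : 0 < x := lt_of_lt_of_le (by positivity) hx1
  have hx2 : μ ≤ x + e := by linarith
  refine ⟨hx0, ?_⟩
  -- The difference is `εe / (x(x + e))`, and inserting the bounds on `e`, `x` and `x + e` gives
  -- precisely `m / 6`. With `2 * eQ ≤ m / 2` the total is `2m / 3`.
  have h3 : ε / x - ε / (x + e) ≤ m / 6 := by
    have hxe : 0 < x + e := by linarith
    rw [div_sub_div _ _ hx0.ne' hxe.ne', div_le_iff₀ (by positivity)]
    have h4 : μ * (6 * ε / (6 * ε + m * μ)) * μ ≤ x * (x + e) :=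
      mul_le_mul hx1 hx2 hocc.le hx0.le
    have h5 : ε * e ≤ ε * (m * μ ^ 2 / (6 * ε + m * μ)) := mul_le_mul_of_nonneg_left hE hε.le
    have h6 : m / 6 * (μ * (6 * ε / (6 * ε + m * μ)) * μ) =
        ε * (m * μ ^ 2 / (6 * ε + m * μ)) := by
      field_simp
    have h7 := mul_le_mul_of_nonneg_left h4 (show 0 ≤ m / 6 by positivity)
    linarith
  linarith

end Stats

end RewardPoisoning

namespace RewardPoisoning

/-! ## The law of the interaction of one learner with an environment -/

section run

variable {S A : Type*} [MeasurableSpace S] [MeasurableSpace A]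
  [Fintype S] [MeasurableSingletonClass S] [Fintype A] [MeasurableSingletonClass A]
  {Θ Θ' : Type*} [MeasurableSpace Θ] [MeasurableSpace Θ'] {T : ℕ}
  (M : MDP S A) (C : Kernel (Θ × (S × A)) (ℝ × ℝ)) [IsMarkovKernel C]
  (C' : Kernel (Θ' × (S × A)) (ℝ × ℝ)) [IsMarkovKernel C'] (ℓ : Learner S A T)

/-- Given the pair, the rewards and the next state are independent, so a step is an iterated
integral: action, rewards, next state. All later computations with runs start from this form. -/
lemma lintegral_stepKernel (n : ℕ) (θ : Θ) (h : (Fin n → Rec S A) × S)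
    {F : Rec S A → ℝ≥0∞} (hF : Measurable F) :
    ∫⁻ x, F x ∂stepKernel M C ℓ n (θ, h) = ∫⁻ a, ∫⁻ z, ∫⁻ s', F ((h.2, a), z, s')
      ∂(M.P h.2 a).toMeasure ∂C (θ, (h.2, a)) ∂ℓ.act n (shown h) := by
  rw [stepKernel, Kernel.lintegral_compProd _ _ _ hF, Kernel.lintegral_prod,
    Kernel.lintegral_deterministic, Kernel.comap_apply]
  · refine lintegral_congr fun a => ?_
    rw [Kernel.lintegral_prod _ _ _ (by fun_prop), Kernel.comap_apply, Kernel.comap_apply]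
    rfl
  · exact Measurable.lintegral_kernel_prod_right' (κ := ((C.comap
      (fun y : (Θ × ((Fin n → Rec S A) × S)) × (S × A) => (y.1.1, y.2)) (by fun_prop) ×ₖ
      (transKernel M).comap (fun y : (Θ × ((Fin n → Rec S A) × S)) × (S × A) => y.2)
        (by fun_prop)).comap (fun b : S × A => ((θ, h), b)) (by fun_prop))) hF

lemma lintegral_run_succ (n : ℕ) (θ : Θ) {F : (Fin (n + 1) → Rec S A) × S → ℝ≥0∞}
    (hF : Measurable F) :
    ∫⁻ h, F h ∂run M C ℓ (n + 1) θ =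
      ∫⁻ h, ∫⁻ x, F (push (h, x)) ∂stepKernel M C ℓ n (θ, h) ∂run M C ℓ n θ := by
  rw [run, Kernel.lintegral_map _ measurable_push _ hF,
    Kernel.lintegral_compProd _ _ _ (f := fun x => F (push x)) (hF.comp measurable_push)]

/-- A multiplicative functional whose conditional expectation in every step is at most `1` is a
supermartingale along a run. -/
lemma lintegral_run_prod_le {g : Rec S A → ℝ≥0∞} (hg : Measurable g) (θ : Θ)
    (h1 : ∀ s a, ∫⁻ z, ∫⁻ s', g ((s, a), z, s') ∂(M.P s a).toMeasure ∂C (θ, (s, a)) ≤ 1)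
    (n : ℕ) : ∫⁻ h, ∏ i, g (h.1 i) ∂run M C ℓ n θ ≤ 1 := by
  induction n with
  | zero => simp
  | succ n ih =>
    rw [lintegral_run_succ _ _ _ _ _ (by fun_prop)]
    refine le_trans (lintegral_mono fun h => ?_) ih
    calc ∫⁻ x, ∏ i, g ((push (h, x)).1 i) ∂stepKernel M C ℓ n (θ, h)
        = ∫⁻ x, (∏ i, g (h.1 i)) * g x ∂stepKernel M C ℓ n (θ, h) := by
          simp [push, Fin.prod_univ_castSucc]
      _ = (∏ i, g (h.1 i)) * ∫⁻ x, g x ∂stepKernel M C ℓ n (θ, h) :=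
          lintegral_const_mul _ hg
      _ ≤ (∏ i, g (h.1 i)) * 1 := by
          gcongr
          rw [lintegral_stepKernel _ _ _ _ _ _ hg]
          exact (lintegral_mono fun a => h1 h.2 a).trans (by simp)
      _ = _ := mul_one _

/-- Union bound over the steps of a run. -/
lemma run_exists_le {B : Set (Rec S A)} (hB : MeasurableSet B) (θ : Θ) {δ : ℝ≥0∞}
    (h1 : ∀ s a, ∫⁻ z, ∫⁻ s', B.indicator 1 ((s, a), z, s') ∂(M.P s a).toMeasure
      ∂C (θ, (s, a)) ≤ δ) (n : ℕ) :
    run M C ℓ n θ {h | ∃ i, h.1 i ∈ B} ≤ n * δ := by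
  have hind : Measurable (B.indicator (1 : Rec S A → ℝ≥0∞)) := measurable_one.indicator hB
  have hset : MeasurableSet {h : (Fin n → Rec S A) × S | ∃ i, h.1 i ∈ B} := by
    rw [Set.ofPred_exists]
    exact MeasurableSet.iUnion fun i => hB.preimage (by fun_prop)
  -- The expected number of bad steps dominates the probability of having one, and it is additive
  -- along the run.
  have hsum : ∫⁻ h, ∑ i, B.indicator 1 (h.1 i) ∂run M C ℓ n θ ≤ n * δ := by
    clear hset
    induction n with
    | zero => simp
    | succ n ih =>
      rw [lintegral_run_succ _ _ _ _ _ (by fun_prop)]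
      calc _ ≤ ∫⁻ h, (∑ i, B.indicator 1 (h.1 i) + δ) ∂run M C ℓ n θ := by
            refine lintegral_mono fun h => ?_
            simp only [push, Fin.sum_univ_castSucc, Fin.snoc_castSucc, Fin.snoc_last]
            rw [lintegral_add_left measurable_const]
            simp only [lintegral_const, measure_univ, mul_one]
            gcongr
            rw [lintegral_stepKernel _ _ _ _ _ _ hind]
            exact (lintegral_mono fun a => h1 h.2 a).trans (by simp)
        _ ≤ _ := by
            rw [lintegral_add_right _ measurable_const]
            simp only [lintegral_const, measure_univ, mul_one, Nat.cast_add, Nat.cast_one,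
              add_mul, one_mul]
            gcongr
  refine le_trans ?_ hsum
  rw [← lintegral_indicator_one hset]
  refine lintegral_mono fun h => Set.indicator_apply_le' (fun hh => ?_) fun _ => zero_le
  obtain ⟨i, hi⟩ := hh
  calc (1 : ℝ≥0∞) = B.indicator 1 (h.1 i) := by simp [hi]
    _ ≤ _ := Finset.single_le_sum (f := fun i => B.indicator (1 : Rec S A → ℝ≥0∞) (h.1 i))
        (fun _ _ => zero_le) (Finset.mem_univ i)

/-- Replace the true reward of a record by the shown one. -/
def relabel (x : Rec S A) : Rec S A := (x.1, (x.2.1.2, x.2.1.2), x.2.2)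

/-- Replace the true rewards of a history by the shown ones. -/
def relabelHist {n : ℕ} (h : (Fin n → Rec S A) × S) : (Fin n → Rec S A) × S :=
  (fun i => relabel (h.1 i), h.2)

lemma measurable_relabel : Measurable (relabel (S := S) (A := A)) := by
  unfold relabel
  fun_prop

lemma measurable_relabelHist {n : ℕ} : Measurable (relabelHist (S := S) (A := A) (n := n)) := by
  unfold relabelHist
  exact Measurable.prodMk (measurable_pi_iff.2 fun i => measurable_relabel.comp (by fun_prop))
    (by fun_prop)

lemma push_relabel {n : ℕ} (h : (Fin n → Rec S A) × S) (x : Rec S A) :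
    push (relabelHist h, relabel x) = relabelHist (push (h, x)) := by
  refine Prod.ext (funext fun i => ?_) rfl
  refine Fin.lastCases ?_ (fun j => ?_) i
  · simp [push, relabelHist]
  · simp [push, relabelHist]

/-- Change of measure: if the reward channel `C'` duplicates the shown reward of the channel `C`
reweighted by `D`, then the run with channel `C'` is the relabelled run with channel `C`, reweighted
by the product of the weights. -/
lemma lintegral_run_eq (θ : Θ) (θ' : Θ') {D : (S × A) × (ℝ × ℝ) → ℝ≥0∞} (hD : Measurable D)
    (hC : ∀ y, ∀ f : ℝ × ℝ → ℝ≥0∞, Measurable f →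
      ∫⁻ z, f z ∂C' (θ', y) = ∫⁻ z, D (y, z) * f (z.2, z.2) ∂C (θ, y))
    (n : ℕ) {F : (Fin n → Rec S A) × S → ℝ≥0∞} (hF : Measurable F) :
    ∫⁻ h, F h ∂run M C' ℓ n θ' =
      ∫⁻ h, (∏ i, D ((h.1 i).1, (h.1 i).2.1)) * F (relabelHist h) ∂run M C ℓ n θ := by
  induction n with
  | zero =>
    simp only [run, Kernel.const_apply, Finset.univ_eq_empty, Finset.prod_empty, one_mul]
    refine lintegral_congr fun h => congrArg F (Prod.ext (Subsingleton.elim _ _) rfl)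
  | succ n ih =>
    have hG : Measurable fun h : (Fin n → Rec S A) × S =>
        ∫⁻ x, F (push (h, x)) ∂stepKernel M C' ℓ n (θ', h) :=
      Measurable.lintegral_kernel_prod_right' (κ := (stepKernel M C' ℓ n).comap
        (fun h => (θ', h)) (by fun_prop)) (hF.comp measurable_push)
    have hDm : Measurable fun x : Rec S A => D (x.1, x.2.1) := by fun_prop
    rw [lintegral_run_succ _ _ _ _ _ hF, ih hG, lintegral_run_succ]
    · refine lintegral_congr fun h => ?_
      have e1 : ∀ x : Rec S A, (∏ i, D (((push (h, x)).1 i).1, ((push (h, x)).1 i).2.1)) *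
          F (relabelHist (push (h, x))) = (∏ i, D ((h.1 i).1, (h.1 i).2.1)) *
          (D (x.1, x.2.1) * F (push (relabelHist h, relabel x))) := fun x => by
        rw [push_relabel, Fin.prod_univ_castSucc, ← mul_assoc]
        simp [push]
      have hm1 : Measurable fun x : Rec S A => F (push (relabelHist h, x)) :=
        (hF.comp measurable_push).comp (by fun_prop)
      have hm2 : Measurable fun x : Rec S A => F (push (relabelHist h, relabel x)) :=
        hm1.comp measurable_relabel
      have hm3 : Measurable fun x : Rec S A =>
          D (x.1, x.2.1) * F (push (relabelHist h, relabel x)) := hDm.mul hm2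
      simp only [e1]
      rw [lintegral_const_mul _ hm3]
      congr 1
      rw [lintegral_stepKernel _ _ _ _ _ _ hm1, lintegral_stepKernel _ _ _ _ _ _ hm3]
      -- Relabelling leaves the shown part of a history unchanged, so the learner draws its action
      -- from the same law on both sides.
      refine lintegral_congr fun a => ?_
      rw [hC]
      · exact lintegral_congr fun z => (lintegral_const_mul (D ((h.2, a), z))
          (f := fun s' => F (push (relabelHist h, relabel ((h.2, a), z, s'))))
          (hm2.comp (by fun_prop))).symm
      · exact Measurable.lintegral_prod_right' (f := fun q : (ℝ × ℝ) × S =>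
          F (push (relabelHist h, (((relabelHist h).2, a), q.1, q.2)))) (hm1.comp (by fun_prop))
    · refine Measurable.mul ?_ (hF.comp measurable_relabelHist)
      exact Finset.measurable_prod _ fun i _ => hDm.comp (by fun_prop)

end run

end RewardPoisoning

namespace RewardPoisoning

/-! ## Exploration by a PAC learner -/

lemma lintegral_coin (f : ℝ → ℝ≥0∞) (hf : Measurable f) :
    ∫⁻ r, f r ∂coin = 2⁻¹ * (f 1 + f (-1)) := by
  rw [coin, lintegral_smul_measure, lintegral_add_measure, lintegral_dirac' _ hf,
    lintegral_dirac' _ hf, smul_eq_mul]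

section explore

variable {S A : Type*} [MeasurableSpace S] [MeasurableSpace A]
  [Fintype S] [MeasurableSingletonClass S] [Fintype A] [MeasurableSingletonClass A] {T : ℕ}

lemma lintegral_noisyReward (R : S → A → ℝ) (ν : Kernel (S × A) ℝ) (y : S × A)
    {f : ℝ → ℝ≥0∞} (hf : Measurable f) :
    ∫⁻ r, f r ∂noisyReward R ν y = ∫⁻ x, f (R y.1 y.2 + x) ∂ν y := by
  change ∫⁻ r, f r ∂((ν y).map fun x => R y.1 y.2 + x) = _
  rw [lintegral_map hf (by fun_prop)]

/-- The coin is drawn in both modes and ignored while attacking, so one formula serves both phases.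
-/
lemma lintegral_attackChannel (M : MDP S A) (ν : Kernel (S × A) ℝ) [IsMarkovKernel ν]
    (θ : Mode S A) (y : S × A) {f : ℝ × ℝ → ℝ≥0∞} (hf : Measurable f) :
    ∫⁻ z, f z ∂attackChannel M ν (θ, y) = ∫⁻ x, ∫⁻ c, f (M.R y.1 y.2 + x,
      if θ.1 = true then c else M.R y.1 y.2 + x - θ.2 y.1 y.2) ∂coin ∂ν y := by
  have hfm := hf.comp (measurable_manipulate (S := S) (A := A))
  rw [attackChannel, Kernel.lintegral_map _ measurable_manipulate _ hf,
    Kernel.lintegral_prod _ _ _ (g := fun x => f (manipulate x)) hfm, Kernel.lintegral_id'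
      (f := fun b => ∫⁻ c, f (manipulate (b, c)) ∂((noisyReward M.R ν).comap Prod.snd
        measurable_snd ×ₖ Kernel.const _ coin) (θ, y))]
  · rw [Kernel.lintegral_prod _ _ _ (g := fun q => f (manipulate ((θ, y), q)))
        (hfm.comp (by fun_prop)),
      Kernel.comap_apply, Kernel.const_apply, lintegral_noisyReward]
    · rfl
    · exact Measurable.lintegral_prod_right' (f := fun q : ℝ × ℝ =>
        f (manipulate ((θ, y), q))) (hfm.comp (by fun_prop))
  · exact Measurable.lintegral_prod_right' (f := fun q : (Mode S A × S × A) × ℝ × ℝ =>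
        f (manipulate q)) hfm

/-- Number of visits of a pair in a trajectory. -/
def stepVisits [DecidableEq S] [DecidableEq A] (τ : Fin T → Rec S A) (s : S) (a : A) : ℕ :=
  (Finset.univ.filter fun t => (τ t).1 = (s, a)).card

/-- Rewards `±1` with mean `c y` at the pair `y`. -/
noncomputable def signReward (c : S × A → ℝ) : Kernel (S × A) ℝ :=
  Kernel.ofFunOfCountable fun y => ENNReal.ofReal ((1 + c y) / 2) • Measure.dirac (1 : ℝ) +
    ENNReal.ofReal ((1 - c y) / 2) • Measure.dirac (-1 : ℝ)

lemma signReward_apply (c : S × A → ℝ) (y : S × A) : signReward c y =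
    ENNReal.ofReal ((1 + c y) / 2) • Measure.dirac (1 : ℝ) +
    ENNReal.ofReal ((1 - c y) / 2) • Measure.dirac (-1 : ℝ) := rfl

lemma isMarkovKernel_signReward {c : S × A → ℝ} (hc : ∀ y, |c y| ≤ 1) :
    IsMarkovKernel (signReward c) := by
  refine ⟨fun y => ⟨?_⟩⟩
  have h := abs_le.1 (hc y)
  simp only [signReward_apply, Measure.add_apply, Measure.smul_apply, measure_univ, smul_eq_mul,
    mul_one]
  rw [← ENNReal.ofReal_add (by linarith) (by linarith)]
  ring_nf
  simp

lemma lintegral_signReward (c : S × A → ℝ) (y : S × A) {f : ℝ → ℝ≥0∞} (hf : Measurable f) :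
    ∫⁻ r, f r ∂signReward c y =
      ENNReal.ofReal ((1 + c y) / 2) * f 1 + ENNReal.ofReal ((1 - c y) / 2) * f (-1) := by
  rw [signReward_apply, lintegral_add_measure, lintegral_smul_measure, lintegral_smul_measure,
    lintegral_dirac' _ hf, lintegral_dirac' _ hf, smul_eq_mul, smul_eq_mul]

lemma ae_signReward (c : S × A → ℝ) (y : S × A) :
    ∀ᵐ r ∂signReward c y, r ∈ Set.Icc (-1 : ℝ) 1 := by
  rw [signReward_apply, ae_add_measure_iff]
  constructor
  · exact Measure.ae_smul_measure ((ae_dirac_iff measurableSet_Icc).2 (by norm_num)) _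
  · exact Measure.ae_smul_measure ((ae_dirac_iff measurableSet_Icc).2 (by norm_num)) _

lemma integral_signReward {c : S × A → ℝ} (hc : ∀ y, |c y| ≤ 1) (y : S × A) :
    ∫ r, r ∂signReward c y = c y := by
  have h := abs_le.1 (hc y)
  have hi : ∀ (a : ℝ≥0∞) (x : ℝ), a ≠ ∞ → Integrable (fun r : ℝ => r) (a • Measure.dirac x) :=
    fun a x ha => (integrable_dirac (by simp)).smul_measure ha
  rw [signReward_apply, integral_add_measure (hi _ _ ENNReal.ofReal_ne_top)
    (hi _ _ ENNReal.ofReal_ne_top), integral_smul_measure, integral_smul_measure, integral_dirac,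
    integral_dirac, ENNReal.toReal_ofReal (by linarith), ENNReal.toReal_ofReal (by linarith),
    smul_eq_mul, smul_eq_mul]
  ring

/-- Logarithm of the likelihood ratio of `signReward c` to the fair coin. -/
noncomputable def signLogRatio (c : S × A → ℝ) (x : (S × A) × (ℝ × ℝ)) : ℝ :=
  if x.2.2 = 1 then Real.log (1 + c x.1) else if x.2.2 = -1 then Real.log (1 - c x.1) else 0

lemma measurable_signLogRatio (c : S × A → ℝ) : Measurable (signLogRatio c) := by
  have hc : Measurable c := measurable_of_countable c
  unfold signLogRatio
  refine Measurable.ite ((measurableSet_singleton (1 : ℝ)).preimage (by fun_prop)) (by fun_prop)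
    (Measurable.ite ((measurableSet_singleton (-1 : ℝ)).preimage (by fun_prop)) (by fun_prop)
      measurable_const)

/-- A learner that explores under attack, seen as a change of measure of a learner with rewards
`signReward c`. -/
lemma lintegral_cleanRun_signReward (M : MDP S A) (ν : Kernel (S × A) ℝ) [IsMarkovKernel ν]
    (ℓ : Learner S A T) {c : S × A → ℝ} (hc : ∀ y, |c y| < 1) {θ : Mode S A} (hθ : θ.1 = true)
    {F : (Fin T → Rec S A) × S → ℝ≥0∞} (hF : Measurable F) :
    ∫⁻ h, F h ∂cleanRun M (signReward c) ℓ =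
      ∫⁻ h, ENNReal.ofReal (Real.exp (∑ i, signLogRatio c ((h.1 i).1, (h.1 i).2.1))) *
        F (relabelHist h) ∂run M (attackChannel M ν) ℓ T θ := by
  have := isMarkovKernel_signReward (fun y => (hc y).le)
  have : IsMarkovKernel ((signReward c).map fun r => (r, r)) :=
    Kernel.IsMarkovKernel.map _ (by fun_prop)
  have hD : Measurable fun x => ENNReal.ofReal (Real.exp (signLogRatio c x)) :=
    (measurable_signLogRatio c).exp.ennreal_ofReal
  rw [cleanRun, lintegral_run_eq M (attackChannel M ν) _ ℓ θ ()
    (D := fun x => ENNReal.ofReal (Real.exp (signLogRatio c x))) hD ?_ T hF]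
  · refine lintegral_congr fun h => ?_
    rw [Real.exp_sum, ENNReal.ofReal_prod_of_nonneg fun _ _ => (Real.exp_pos _).le]
  · intro y f hf
    have h := abs_lt.1 (hc y)
    rw [Kernel.comap_apply, Kernel.lintegral_map _ (by fun_prop) _ hf,
      lintegral_signReward _ _ (by fun_prop), lintegral_attackChannel]
    · simp only [hθ, if_true]
      have e : ∀ x : ℝ, ∫⁻ r, ENNReal.ofReal (Real.exp (signLogRatio c (y, M.R y.1 y.2 + x, r))) *
          f (r, r) ∂coin = 2⁻¹ * (ENNReal.ofReal (1 + c y) * f (1, 1) +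
          ENNReal.ofReal (1 - c y) * f (-1, -1)) := fun x => by
        rw [lintegral_coin]
        · have h2 : ¬ ((-1 : ℝ) = 1) := by norm_num
          simp only [signLogRatio, if_true, h2, if_false]
          rw [Real.exp_log (by linarith), Real.exp_log (by linarith)]
        · exact (hD.comp (by fun_prop)).mul (by fun_prop)
      simp only [e, lintegral_const, measure_univ, mul_one, mul_add, ← mul_assoc]
      have h3 : ∀ x : ℝ, ENNReal.ofReal (x / 2) = 2⁻¹ * ENNReal.ofReal x := fun x => by
        rw [ENNReal.ofReal_div_of_pos (by norm_num), ENNReal.div_eq_inv_mul]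
        norm_num
      rw [h3, h3]
    · exact (hD.comp (by fun_prop)).mul (by fun_prop)

/-- From `log y ≥ 1 - 1 / y` it remains to compare with `x / (1 + x)`, and there the claim is `x²(1
+ 2x) ≥ 0`. -/
lemma sub_two_mul_sq_le_log {x : ℝ} (hx : |x| ≤ 1 / 2) : x - 2 * x ^ 2 ≤ Real.log (1 + x) := by
  have h := abs_le.1 hx
  have h1 := Real.one_sub_inv_le_log_of_pos (show 0 < 1 + x by linarith)
  refine le_trans ?_ h1
  have h2 : 1 - (1 + x)⁻¹ = x / (1 + x) := by
    have : 1 + x ≠ 0 := by linarith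
    field_simp
    ring
  rw [h2, le_div_iff₀ (by linarith)]
  nlinarith [mul_nonneg (sq_nonneg x) (show 0 ≤ 1 + 2 * x by linarith)]

/-- The log-likelihood ratio of a biased coin at one pair is small with small probability unless
the pair is visited often. -/
lemma run_logRatio_lt_le [DecidableEq S] [DecidableEq A] (M : MDP S A) (ν : Kernel (S × A) ℝ)
    [IsMarkovKernel ν] (ℓ : Learner S A T) {θ : Mode S A} (hθ : θ.1 = true) (y₀ : S × A)
    {c : ℝ} (hc : |c| ≤ 1 / 2) {k X n : ℝ} (hk : 0 ≤ k) :
    run M (attackChannel M ν) ℓ T θ {h | (stepVisits h.1 y₀.1 y₀.2 : ℝ) < n ∧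
      ∑ i, signLogRatio (fun y => if y = y₀ then c else 0) ((h.1 i).1, (h.1 i).2.1) < -X} ≤
      ENNReal.ofReal (Real.exp (-(k * X - (2 * k * c ^ 2 + k ^ 2 * c ^ 2 / 2) * n))) := by
  set cf : S × A → ℝ := fun y => if y = y₀ then c else 0 with hcf
  -- `K` compensates one visit of `y₀`. Under a fair coin the mean of `exp(-k log(1 ± c))` is at
  -- most `exp(2kc²) cosh(kc)`, hence at most `exp K`. So `exp(-k·logratio - K·visits)` is a
  -- supermartingale; at other pairs the log-ratio is zero.
  set K := 2 * k * c ^ 2 + k ^ 2 * c ^ 2 / 2 with hK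
  have hK0 : 0 ≤ K := by positivity
  set e : Rec S A → ℝ := fun x => -k * signLogRatio cf (x.1, x.2.1) - if x.1 = y₀ then K else 0
    with he
  have hem : Measurable e := by
    refine Measurable.sub ?_ ?_
    · exact measurable_const.mul ((measurable_signLogRatio cf).comp (by fun_prop))
    · exact Measurable.ite ((measurableSet_singleton y₀).preimage (by fun_prop)) measurable_const
        measurable_const
  have hgm : Measurable fun x => ENNReal.ofReal (Real.exp (e x)) := hem.exp.ennreal_ofReal
  have hexp : ∀ h : (Fin T → Rec S A) × S, ∏ i, ENNReal.ofReal (Real.exp (e (h.1 i))) =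
      ENNReal.ofReal (Real.exp (-k * ∑ i, signLogRatio cf ((h.1 i).1, (h.1 i).2.1) -
        K * stepVisits h.1 y₀.1 y₀.2)) := fun h => by
    rw [← ENNReal.ofReal_prod_of_nonneg fun _ _ => (Real.exp_pos _).le, ← Real.exp_sum]
    congr 2
    rw [he, Finset.sum_sub_distrib, ← Finset.mul_sum, Finset.sum_ite, Finset.sum_const,
      Finset.sum_const_zero, add_zero, nsmul_eq_mul, mul_comm K]
    rfl
  have hsuper := lintegral_run_prod_le M (attackChannel M ν) ℓ hgm θ (fun s a => by
    have hm : Measurable fun z : ℝ × ℝ => ∫⁻ s', ENNReal.ofReal (Real.exp (e ((s, a), z, s')))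
        ∂(M.P s a).toMeasure :=
      Measurable.lintegral_prod_right' (f := fun q : (ℝ × ℝ) × S =>
        ENNReal.ofReal (Real.exp (e ((s, a), q.1, q.2)))) (hgm.comp (by fun_prop))
    rw [lintegral_attackChannel _ _ _ _ hm]
    have hcoin : ∀ x : ℝ, ∫⁻ r, ∫⁻ s', ENNReal.ofReal (Real.exp (e ((s, a),
        (M.R s a + x, if θ.1 = true then r else M.R s a + x - θ.2 s a), s')))
        ∂(M.P s a).toMeasure ∂coin ≤ 1 := fun x => by
      have e2 : ∀ r, ∫⁻ s', ENNReal.ofReal (Real.exp (e ((s, a), (M.R s a + x, r), s')))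
          ∂(M.P s a).toMeasure = ENNReal.ofReal (Real.exp (-k * signLogRatio cf
            ((s, a), (M.R s a + x, r)) - if (s, a) = y₀ then K else 0)) := fun r => by
        change ∫⁻ _, ENNReal.ofReal (Real.exp (-k * signLogRatio cf
            ((s, a), (M.R s a + x, r)) - if (s, a) = y₀ then K else 0)) ∂_ = _
        rw [lintegral_const, measure_univ, mul_one]
      simp only [hθ, if_true, e2]
      rw [lintegral_coin]
      · have h2 : ¬ ((-1 : ℝ) = 1) := by norm_num
        simp only [signLogRatio, if_true, h2, if_false]
        rw [← ENNReal.ofReal_add (Real.exp_pos _).le (Real.exp_pos _).le]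
        by_cases hy : (s, a) = y₀
        · simp only [hcf, hy, if_true]
          have l1 := sub_two_mul_sq_le_log hc
          have l2 := sub_two_mul_sq_le_log (x := -c) (by rwa [abs_neg])
          have b1 : Real.exp (-k * Real.log (1 + c) - K) ≤
              Real.exp (-(k * c)) * Real.exp (-(k * c) ^ 2 / 2) := by
            rw [← Real.exp_add]
            refine Real.exp_le_exp.2 ?_
            have := mul_le_mul_of_nonneg_left l1 hk
            rw [hK]; linarith
          have b2 : Real.exp (-k * Real.log (1 - c) - K) ≤
              Real.exp (k * c) * Real.exp (-(k * c) ^ 2 / 2) := by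
            rw [← Real.exp_add]
            refine Real.exp_le_exp.2 ?_
            have := mul_le_mul_of_nonneg_left l2 hk
            rw [← sub_eq_add_neg] at this
            rw [hK]; linarith
          have b3 := Real.cosh_le_exp_half_sq (k * c)
          rw [Real.cosh_eq] at b3
          have b4 : Real.exp ((k * c) ^ 2 / 2) * Real.exp (-(k * c) ^ 2 / 2) = 1 := by
            rw [← Real.exp_add]
            simp [neg_div]
          have b5 : Real.exp (-k * Real.log (1 + c) - K) + Real.exp (-k * Real.log (1 - c) - K) ≤
              2 := by
            have := mul_le_mul_of_nonneg_right b3 (Real.exp_pos (-(k * c) ^ 2 / 2)).le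
            linarith
          calc _ ≤ 2⁻¹ * ENNReal.ofReal 2 := by gcongr
            _ = 1 := by
              rw [ENNReal.ofReal_ofNat]
              exact ENNReal.inv_mul_cancel (by simp) (by simp)
        · simp only [hcf, hy, if_false]
          norm_num
      · exact hgm.comp (f := fun r => ((s, a), (M.R s a + x, r), s)) (by fun_prop)
    calc _ ≤ ∫⁻ _, 1 ∂ν (s, a) := lintegral_mono hcoin
      _ = 1 := by simp) T
  set b := k * X - K * n with hb
  -- Markov's inequality: on the event the exponent is at least `kX - Kn`.
  have hmark := mul_meas_ge_le_lintegral (μ := run M (attackChannel M ν) ℓ T θ)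
    (f := fun h => ∏ i, ENNReal.ofReal (Real.exp (e (h.1 i)))) (by fun_prop)
    (ENNReal.ofReal (Real.exp b))
  have hpos : ENNReal.ofReal (Real.exp b) ≠ 0 := by simp [Real.exp_pos]
  rw [Real.exp_neg, ENNReal.ofReal_inv_of_pos (Real.exp_pos _),
    ENNReal.le_inv_iff_mul_le, mul_comm]
  refine le_trans ?_ (hmark.trans hsuper)
  gcongr
  rename_i h
  intro hh
  rw [hexp]
  refine ENNReal.ofReal_le_ofReal (Real.exp_le_exp.2 ?_)
  have h1 := mul_le_mul_of_nonneg_left hh.1.le hK0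
  have h2 := mul_le_mul_of_nonneg_left hh.2.le hk
  rw [hb]
  linarith

end explore

end RewardPoisoning

namespace RewardPoisoning

/-! ### From likelihood ratios to visits of a PAC learner -/

section explore

variable {S A : Type*} [MeasurableSpace S] [MeasurableSpace A]
  [Fintype S] [MeasurableSingletonClass S] [Fintype A] [MeasurableSingletonClass A] {T : ℕ}
  [DecidableEq S] [DecidableEq A]

lemma measurable_out (ℓ : Learner S A T) {B : Set (S → A)} (hB : MeasurableSet B) :
    Measurable fun h : (Fin T → Rec S A) × S => ℓ.out (shown h) B :=
  (ℓ.out.measurable_coe hB).comp measurable_shown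

/-- A PAC learner outputs clearly suboptimal policies with small probability. -/
lemma lintegral_out_le_of_isPAC {M : MDP S A} {α β : ℝ} {ℓ : Learner S A T}
    (h : IsPAC M α β ℓ) {c : S × A → ℝ} (hc : ∀ y, |c y| ≤ 1) {B : Set (S → A)}
    (hB : MeasurableSet B)
    (hopt : ∀ π ∈ B, (M.withReward fun s a => c (s, a)).score π <
      (M.withReward fun s a => c (s, a)).optScore - α) :
    ∫⁻ h, ℓ.out (shown h) B ∂cleanRun M (signReward c) ℓ ≤ ENNReal.ofReal β := by
  have := isMarkovKernel_signReward hc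
  have h1 := h (signReward c) this (ae_signReward c)
  simp only [integral_signReward hc] at h1
  have : IsProbabilityMeasure ((cleanRun M (signReward c) ℓ).map shown) :=
    Measure.isProbabilityMeasure_map measurable_shown.aemeasurable
  have h2 : ∫⁻ h, ℓ.out (shown h) B ∂cleanRun M (signReward c) ℓ =
      (ℓ.out ∘ₘ (cleanRun M (signReward c) ℓ).map shown) B := by
    rw [Measure.bind_apply hB ℓ.out.aemeasurable, lintegral_map (ℓ.out.measurable_coe hB)
      measurable_shown]
  rw [h2, ← ofReal_measureReal (measure_ne_top _ _)]
  refine ENNReal.ofReal_le_ofReal ?_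
  have h3 := probReal_compl_eq_one_sub (μ := ℓ.out ∘ₘ (cleanRun M (signReward c) ℓ).map shown) hB
  have h4 := h1.trans (measureReal_mono (μ := ℓ.out ∘ₘ (cleanRun M (signReward c) ℓ).map shown)
    (s₂ := Bᶜ) (fun π hπ hπB => absurd hπ (not_le.2 (hopt π hπB))) (measure_ne_top _ _))
  linarith

/-- In the formula of the score as an occupancy average only `s₀` contributes. The score thus shows
just whether the policy uses the pair, with a gap of at least `|c|` times `occMin`. -/
lemma score_withReward_single (M : MDP S A) (s₀ : S) (a₀ : A) (c : ℝ) (π : S → A) :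
    (M.withReward fun s a => if (s, a) = (s₀, a₀) then c else 0).score π =
      if π s₀ = a₀ then c * M.occ π s₀ else 0 := by
  rw [MDP.score_eq, Finset.sum_eq_single s₀]
  · rw [MDP.occ_withReward]
    simp only [MDP.withReward, Prod.mk.injEq, true_and]
    split_ifs <;> ring
  · intro s _ hs
    simp [MDP.withReward, hs]
  · simp

/-- Change of measure bound for an event that a PAC learner avoids under biased rewards. -/
lemma lintegral_low_visits_le {M : MDP S A} (ν : Kernel (S × A) ℝ) [IsMarkovKernel ν]
    {ℓ : Learner S A T} {θ : Mode S A} (hθ : θ.1 = true) {y₀ : S × A}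
    {c k X n β : ℝ} (hc : |c| ≤ 1 / 2) (hk : 0 ≤ k) {B : Set (S → A)} (hB : MeasurableSet B)
    (hout : ∫⁻ h, ℓ.out (shown h) B
      ∂cleanRun M (signReward fun y => if y = y₀ then c else 0) ℓ ≤ ENNReal.ofReal β) :
    ∫⁻ h in {h | (stepVisits h.1 y₀.1 y₀.2 : ℝ) < n}, ℓ.out (shown h) B
      ∂run M (attackChannel M ν) ℓ T θ ≤ ENNReal.ofReal (Real.exp X * β) +
      ENNReal.ofReal (Real.exp (-(k * X - (2 * k * c ^ 2 + k ^ 2 * c ^ 2 / 2) * n))) := by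
  set cf : S × A → ℝ := fun y => if y = y₀ then c else 0 with hcf
  have hcf1 : ∀ y, |cf y| < 1 := fun y => by
    rw [hcf]
    dsimp only
    split_ifs
    · linarith
    · simp
  have hw : Measurable fun h : (Fin T → Rec S A) × S =>
      ∑ i, signLogRatio cf ((h.1 i).1, (h.1 i).2.1) :=
    Finset.measurable_sum _ fun i _ => (measurable_signLogRatio cf).comp (by fun_prop)
  have hv : Measurable fun h : (Fin T → Rec S A) × S => (stepVisits h.1 y₀.1 y₀.2 : ℝ) := by
    have : (fun h : (Fin T → Rec S A) × S => (stepVisits h.1 y₀.1 y₀.2 : ℝ)) =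
        fun h => ∑ i, if (h.1 i).1 = y₀ then (1 : ℝ) else 0 := by
      funext h
      simp [stepVisits]
    rw [this]
    exact Finset.measurable_sum _ fun i _ => Measurable.ite
      ((measurableSet_singleton y₀).preimage (by fun_prop)) measurable_const measurable_const
  have hG := measurable_out ℓ hB
  set ρ := run M (attackChannel M ν) ℓ T θ
  set Low : Set ((Fin T → Rec S A) × S) := {h | (stepVisits h.1 y₀.1 y₀.2 : ℝ) < n} with hLow
  have hLowm : MeasurableSet Low := measurableSet_lt hv measurable_const
  set Bad : Set ((Fin T → Rec S A) × S) := {h | (stepVisits h.1 y₀.1 y₀.2 : ℝ) < n ∧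
      ∑ i, signLogRatio cf ((h.1 i).1, (h.1 i).2.1) < -X} with hBad
  have hBadm : MeasurableSet Bad := hLowm.inter (measurableSet_lt hw measurable_const)
  -- Off `Bad` the likelihood ratio is at least `exp(-X)`, so `exp X` times it is at least one and
  -- the mass is charged to the biased environment. On `Bad` the output probability is bounded by
  -- one.
  have hpt : ∀ h, Low.indicator (fun h => ℓ.out (shown h) B) h ≤
      ENNReal.ofReal (Real.exp X) * (ENNReal.ofReal (Real.exp (∑ i, signLogRatio cf
        ((h.1 i).1, (h.1 i).2.1))) * ℓ.out (shown (relabelHist h)) B) + Bad.indicator 1 h := by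
    intro h
    have hsh : shown (relabelHist h) = shown h := rfl
    by_cases hL : h ∈ Low
    · rw [Set.indicator_of_mem hL]
      by_cases hb : h ∈ Bad
      · rw [Set.indicator_of_mem hb]
        exact (prob_le_one).trans le_add_self
      · have hX : -X ≤ ∑ i, signLogRatio cf ((h.1 i).1, (h.1 i).2.1) := by
          by_contra hX
          exact hb ⟨hL, not_le.1 hX⟩
        rw [hsh, ← mul_assoc, ← ENNReal.ofReal_mul (Real.exp_pos _).le, ← Real.exp_add]
        refine le_add_right ?_
        refine le_mul_of_one_le_left zero_le ?_
        rw [← ENNReal.ofReal_one]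
        exact ENNReal.ofReal_le_ofReal (Real.one_le_exp (by linarith))
    · rw [Set.indicator_of_notMem hL]
      exact zero_le
  have hm : Measurable fun h : (Fin T → Rec S A) × S => ENNReal.ofReal (Real.exp (∑ i,
      signLogRatio cf ((h.1 i).1, (h.1 i).2.1))) * ℓ.out (shown (relabelHist h)) B :=
    hw.exp.ennreal_ofReal.mul (hG.comp measurable_relabelHist)
  rw [← lintegral_indicator hLowm]
  refine (lintegral_mono hpt).trans ?_
  rw [lintegral_add_right _ (measurable_one.indicator hBadm), lintegral_indicator_one hBadm,
    lintegral_const_mul _ hm,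
    ← lintegral_cleanRun_signReward M ν ℓ hcf1 hθ hG, ENNReal.ofReal_mul (Real.exp_pos _).le]
  gcongr
  exact run_logRatio_lt_le M ν ℓ hθ y₀ hc hk

/-- Visits of every pair that a PAC learner makes with probability at least `1 / 2` when the rewards
are fair coins. -/
noncomputable def visitBound (M : MDP S A) (α β : ℝ) : ℝ :=
  (M.occMin ^ 2 / α ^ 2) *
    (Real.log (1 / (8 * Fintype.card S * Fintype.card A * β)) ^ 2 / 8 /
      (Real.log (16 * Fintype.card S * Fintype.card A) +
        2 * Real.log (1 / (8 * Fintype.card S * Fintype.card A * β))))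

variable [Nonempty S] [Nontrivial A]

/-- The quadratic in `k` is maximal at `k = (X - 2y) / y` with value `(X - 2y)² / (2y)`. Since `y ≤
X / 8`, the numerator is at least `(3X / 4)²`, and `2yl ≤ X² / 2` leaves room. -/
lemma exists_exponent {X l y : ℝ} (hX : 0 < X) (hl : 0 < l)
    (hy : y = X ^ 2 / (4 * (l + 2 * X))) :
    ∃ k, 0 ≤ k ∧ l ≤ k * X - 2 * k * y - k ^ 2 * y / 2 := by
  have hy0 : 0 < y := by rw [hy]; positivity
  have hy8 : y ≤ X / 8 := by
    rw [hy, div_le_iff₀ (by positivity)]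
    nlinarith
  refine ⟨(X - 2 * y) / y, div_nonneg (by linarith) hy0.le, ?_⟩
  have e : (X - 2 * y) / y * X - 2 * ((X - 2 * y) / y) * y - ((X - 2 * y) / y) ^ 2 * y / 2 =
      (X - 2 * y) ^ 2 / (2 * y) := by
    field_simp
    ring
  rw [e, le_div_iff₀ (by positivity)]
  have h1 : (3 / 4 * X) ^ 2 ≤ (X - 2 * y) ^ 2 := pow_le_pow_left₀ (by positivity) (by linarith) 2
  have h2 : l * (2 * y) ≤ X ^ 2 / 2 := by
    rw [hy, show l * (2 * (X ^ 2 / (4 * (l + 2 * X)))) = X ^ 2 / 2 * (l / (l + 2 * X)) by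
      field_simp; ring]
    refine mul_le_of_le_one_right (by positivity) ?_
    rw [div_le_one (by positivity)]
    linarith
  nlinarith [sq_nonneg X]

/-- This is a two-environment lower bound. Bias `-η` at the pair makes every policy that uses it
worse than `α`-optimal, and bias `η` every policy that does not. On the event of few visits both
biases resemble the fair coin, yet the output either uses the pair or does not, so the event is
improbable. -/
lemma run_few_visits_le {M : MDP S A} (ν : Kernel (S × A) ℝ) [IsMarkovKernel ν]
    {ℓ : Learner S A T} {θ : Mode S A} (hθ : θ.1 = true) {α β : ℝ} (hα : 0 < α)
    (hα' : α < M.occMin / (2 * √2)) (hβ : 0 < β)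
    (hβ' : β < 1 / (8 * Fintype.card S * Fintype.card A)) (hPAC : IsPAC M α β ℓ)
    (s₀ : S) (a₀ : A) :
    run M (attackChannel M ν) ℓ T θ {h | (stepVisits h.1 s₀ a₀ : ℝ) < visitBound M α β} ≤
      ENNReal.ofReal (1 / (2 * Fintype.card S * Fintype.card A)) := by
  have hS : (1 : ℝ) ≤ Fintype.card S := by exact_mod_cast Fintype.card_pos (α := S)
  have hA : (2 : ℝ) ≤ Fintype.card A := by exact_mod_cast Fintype.one_lt_card (α := A)
  have hSA : (0 : ℝ) < Fintype.card S * Fintype.card A := by positivity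
  have h2 : 0 < √2 := by positivity
  have h22 : √2 * √2 = 2 := Real.mul_self_sqrt (by norm_num)
  have h21 : 1 < √2 := by
    by_contra h
    nlinarith [not_lt.1 h]
  rw [lt_div_iff₀ (by positivity)] at hα'
  have hμ : 0 < M.occMin := lt_of_le_of_lt (by positivity) hα'
  set X := Real.log (1 / (8 * Fintype.card S * Fintype.card A * β)) with hX
  set l := Real.log (16 * Fintype.card S * Fintype.card A) with hl
  rw [lt_div_iff₀ (by positivity)] at hβ'
  have hX0 : 0 < X := Real.log_pos (by rw [lt_div_iff₀ (by positivity)]; linarith)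
  have hl0 : 0 < l := Real.log_pos (by nlinarith)
  -- The factor `√2 > 1` makes the score gap strictly exceed `α`. The upper bound on `α` says `η < 1
  -- / 2`, and `η² * visitBound` is exactly the `y` required by `exists_exponent`.
  set η := √2 * α / M.occMin with hη
  have hη0 : 0 < η := by positivity
  have hη2 : η ≤ 1 / 2 := by
    rw [hη, div_le_iff₀ hμ]
    linarith
  have hημ : α < η * M.occMin := by
    rw [hη, div_mul_cancel₀ _ hμ.ne']
    nlinarith
  obtain ⟨k, hk0, hk⟩ := exists_exponent (y := η ^ 2 * visitBound M α β) hX0 hl0 (by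
    rw [visitBound, ← hX, ← hl, hη, div_pow, mul_pow, sq √2, h22]
    field_simp
    ring)
  have hocc : ∀ π, M.occMin ≤ M.occ π s₀ := fun π => M.occMin_le π s₀
  obtain ⟨a₁, ha₁⟩ := exists_ne a₀
  -- the two biased environments
  have key : ∀ c : ℝ, |c| ≤ 1 / 2 → c ^ 2 = η ^ 2 → ∀ B : Set (S → A), MeasurableSet B →
      (∀ π ∈ B, (M.withReward fun s a => if (s, a) = (s₀, a₀) then c else 0).score π <
      (M.withReward fun s a => if (s, a) = (s₀, a₀) then c else 0).optScore - α) →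
      ∫⁻ h in {h | (stepVisits h.1 s₀ a₀ : ℝ) < visitBound M α β}, ℓ.out (shown h) B
        ∂run M (attackChannel M ν) ℓ T θ ≤
        ENNReal.ofReal (1 / (4 * Fintype.card S * Fintype.card A)) := by
    intro c hc hc2 B hB hBs
    have hc1 : ∀ y : S × A, |if y = (s₀, a₀) then c else 0| ≤ 1 := fun y => by
      split_ifs
      · linarith
      · simp
    refine (lintegral_low_visits_le ν hθ (y₀ := (s₀, a₀)) hc hk0 (X := X)
      (n := visitBound M α β) hB (lintegral_out_le_of_isPAC hPAC hc1 hB hBs)).trans ?_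
    rw [← ENNReal.ofReal_add (by positivity) (by positivity)]
    refine ENNReal.ofReal_le_ofReal ?_
    -- `X` is chosen so that the PAC failure probability, inflated by `exp X`, is `1 / (8SA)`; `l`
    -- makes the deviation term at most `1 / (16SA)`.
    have e1 : Real.exp X * β = 1 / (8 * Fintype.card S * Fintype.card A) := by
      rw [hX, Real.exp_log (by positivity)]
      field_simp
    have e2 : Real.exp (-(k * X - (2 * k * c ^ 2 + k ^ 2 * c ^ 2 / 2) * visitBound M α β)) ≤
        1 / (16 * Fintype.card S * Fintype.card A) := by
      rw [one_div, ← Real.exp_log (show 0 < (16 * (Fintype.card S : ℝ) * Fintype.card A)⁻¹ by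
        positivity), Real.log_inv, ← hl]
      refine Real.exp_le_exp.2 ?_
      rw [hc2]
      linarith
    have e3 : 1 / (8 * (Fintype.card S : ℝ) * Fintype.card A) +
        1 / (16 * Fintype.card S * Fintype.card A) ≤
        1 / (4 * Fintype.card S * Fintype.card A) := by
      have : 0 ≤ 1 / ((Fintype.card S : ℝ) * Fintype.card A) := by positivity
      have f : ∀ x : ℝ, 1 / (x * Fintype.card S * Fintype.card A) =
          1 / x * (1 / ((Fintype.card S : ℝ) * Fintype.card A)) := fun x => by
        rw [mul_assoc, one_div_mul_one_div]
      rw [f, f, f]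
      linarith
    linarith
  have hBm : MeasurableSet {π : S → A | π s₀ = a₀} :=
    (measurableSet_singleton a₀).preimage (measurable_pi_apply s₀)
  have k1 := key (-η) (by rw [abs_neg, abs_of_pos hη0]; exact hη2) (by ring)
    {π | π s₀ = a₀} hBm (fun π hπ => by
      have hb := (M.withReward fun s a => if (s, a) = (s₀, a₀) then -η else 0).score_le_optScore
        fun _ => a₁
      rw [score_withReward_single, if_neg ha₁] at hb
      rw [score_withReward_single, if_pos (show π s₀ = a₀ from hπ)]
      nlinarith [hocc π])
  have k2 := key η (by rw [abs_of_pos hη0]; exact hη2) rfl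
    {π | π s₀ = a₀}ᶜ hBm.compl (fun π hπ => by
      have hb := (M.withReward fun s a => if (s, a) = (s₀, a₀) then η else 0).score_le_optScore
        fun _ => a₀
      rw [score_withReward_single, if_pos rfl] at hb
      rw [score_withReward_single, if_neg (show ¬ π s₀ = a₀ from hπ)]
      nlinarith [hocc fun _ => a₀])
  -- The output law has total mass one, which is split between the policies that use the pair and
  -- those that do not.
  calc run M (attackChannel M ν) ℓ T θ {h | (stepVisits h.1 s₀ a₀ : ℝ) < visitBound M α β}
      = ∫⁻ h in {h | (stepVisits h.1 s₀ a₀ : ℝ) < visitBound M α β},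
        (ℓ.out (shown h) {π | π s₀ = a₀} + ℓ.out (shown h) {π | π s₀ = a₀}ᶜ)
        ∂run M (attackChannel M ν) ℓ T θ := by
        simp only [prob_add_prob_compl hBm]
        simp
    _ = _ := lintegral_add_left (measurable_out ℓ hBm) _
    _ ≤ _ := add_le_add k1 k2
    _ = _ := by
        rw [← ENNReal.ofReal_add (by positivity) (by positivity)]
        congr 1
        field_simp
        norm_num

/-- A PAC learner that is shown fair coins visits every pair often with probability at least
`1 / 2`. -/
lemma run_exists_few_visits_le {M : MDP S A} (ν : Kernel (S × A) ℝ) [IsMarkovKernel ν]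
    {ℓ : Learner S A T} {θ : Mode S A} (hθ : θ.1 = true) {α β : ℝ} (hα : 0 < α)
    (hα' : α < M.occMin / (2 * √2)) (hβ : 0 < β)
    (hβ' : β < 1 / (8 * Fintype.card S * Fintype.card A)) (hPAC : IsPAC M α β ℓ) :
    run M (attackChannel M ν) ℓ T θ
      {h | ∃ s a, (stepVisits h.1 s a : ℝ) < visitBound M α β} ≤ 2⁻¹ := by
  have hset : {h : (Fin T → Rec S A) × S | ∃ s a, (stepVisits h.1 s a : ℝ) < visitBound M α β} ⊆
      ⋃ y : S × A, {h | (stepVisits h.1 y.1 y.2 : ℝ) < visitBound M α β} := by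
    rintro h ⟨s, a, hh⟩
    exact Set.mem_iUnion.2 ⟨(s, a), hh⟩
  refine (measure_mono hset).trans ((measure_iUnion_fintype_le _ _).trans ?_)
  calc _ ≤ ∑ _y : S × A, ENNReal.ofReal (1 / (2 * Fintype.card S * Fintype.card A)) :=
        Finset.sum_le_sum fun y _ => run_few_visits_le ν hθ hα hα' hβ hβ' hPAC y.1 y.2
    _ = 2⁻¹ := by
        have hS : (0 : ℝ) < Fintype.card S := by exact_mod_cast Fintype.card_pos (α := S)
        have hA : (0 : ℝ) < Fintype.card A := by exact_mod_cast Fintype.card_pos (α := A)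
        rw [Finset.sum_const, Finset.card_univ, Fintype.card_prod, nsmul_eq_mul,
          ← ENNReal.ofReal_natCast, ← ENNReal.ofReal_mul (by positivity), Nat.cast_mul]
        rw [show (Fintype.card S : ℝ) * Fintype.card A *
          (1 / (2 * Fintype.card S * Fintype.card A)) = 2⁻¹ by field_simp,
          ENNReal.ofReal_inv_of_pos (by norm_num), ENNReal.ofReal_ofNat]

end explore

end RewardPoisoning

namespace RewardPoisoning

/-! ## Measurability of the attack -/

namespace Stats

variable {S A : Type*} [Fintype S] [Fintype A] [DecidableEq S] [DecidableEq A]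
  [Nonempty S] [Nontrivial A] {N : S → A → ℕ} {Ph : S → A → S → ℝ} {σ p : ℝ}

/-- A change of the empirical means merely translates the confidence set in its reward coordinate. A
supremum of functions Lipschitz in the rewards is therefore Lipschitz in the means, hence measurable
although the set is uncountable. -/
lemma iSup_confSet_le_add {f : (S → A → ℝ) × (S → A → PMF S) → ℝ} {C : ℝ} (hC : 0 ≤ C)
    (hf : ∀ X v, f (X.1 + v, X.2) ≤ f X + C * ‖v‖) (Rh Rh' : S → A → ℝ)
    (hb : BddAbove (Set.range fun X : (Stats.mk N Rh Ph).confSet σ p => f X)) :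
    ⨆ X : (Stats.mk N Rh' Ph).confSet σ p, f X ≤
      (⨆ X : (Stats.mk N Rh Ph).confSet σ p, f X) + C * ‖Rh' - Rh‖ := by
  have hshift : ∀ (Q Q' : S → A → ℝ) X, X ∈ (Stats.mk N Q Ph).confSet σ p →
      (X.1 + (Q' - Q), X.2) ∈ (Stats.mk N Q' Ph).confSet σ p := by
    intro Q Q' X hX s a hs
    refine ⟨?_, (hX s a hs).2⟩
    have h := (hX s a hs).1
    simp only [Pi.add_apply, Pi.sub_apply] at h ⊢
    rwa [show X.1 s a + (Q' s a - Q s a) - Q' s a = X.1 s a - Q s a by ring]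
  -- The translated sets are empty together, and then both real suprema are `0`.
  rcases isEmpty_or_nonempty ((Stats.mk N Rh' Ph).confSet σ p) with he | hne
  · have : IsEmpty ((Stats.mk N Rh Ph).confSet σ p) :=
      ⟨fun X => he.false ⟨_, hshift Rh Rh' X.1 X.2⟩⟩
    rw [Real.iSup_of_isEmpty, Real.iSup_of_isEmpty, zero_add]
    positivity
  · refine ciSup_le fun X => ?_
    have h1 := hf (X.1.1 + (Rh - Rh'), X.1.2) (Rh' - Rh)
    rw [show X.1.1 + (Rh - Rh') + (Rh' - Rh) = X.1.1 by abel] at h1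
    exact h1.trans (add_le_add (le_ciSup hb ⟨_, hshift Rh' Rh X.1 X.2⟩) le_rfl)

lemma measurable_iSup_confSet {f : (S → A → ℝ) × (S → A → PMF S) → ℝ} {C : ℝ} (hC : 0 ≤ C)
    (hf : ∀ X v, f (X.1 + v, X.2) ≤ f X + C * ‖v‖)
    (hb : ∀ Rh, BddAbove (Set.range fun X : (Stats.mk N Rh Ph).confSet σ p => f X)) :
    Measurable fun Rh => ⨆ X : (Stats.mk N Rh Ph).confSet σ p, f X := by
  refine (LipschitzWith.of_le_add_mul C.toNNReal fun Rh' Rh => ?_).continuous.measurable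
  rw [Real.coe_toNNReal _ hC, dist_eq_norm]
  exact iSup_confSet_le_add hC hf Rh Rh' (hb Rh)

lemma measurable_iInf_confSet {f : (S → A → ℝ) × (S → A → PMF S) → ℝ} {C : ℝ} (hC : 0 ≤ C)
    (hf : ∀ X v, f X ≤ f (X.1 + v, X.2) + C * ‖v‖)
    (hb : ∀ Rh, BddBelow (Set.range fun X : (Stats.mk N Rh Ph).confSet σ p => f X)) :
    Measurable fun Rh => ⨅ X : (Stats.mk N Rh Ph).confSet σ p, f X := by
  have h := (measurable_iSup_confSet (N := N) (Ph := Ph) (σ := σ) (p := p) (f := fun X => -f X) hC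
    (fun X v => by linarith [hf X v]) (fun Rh => by
      obtain ⟨b, hb⟩ := hb Rh
      exact ⟨-b, Set.forall_mem_range.2 fun X => neg_le_neg (hb (Set.mem_range_self X))⟩)).neg
  have e : (fun Rh => ⨅ X : (Stats.mk N Rh Ph).confSet σ p, f X) =
      -fun Rh => ⨆ X : (Stats.mk N Rh Ph).confSet σ p, -f X := by
    funext Rh
    change sInf _ = -sSup _
    rw [Real.sInf_def, ← Set.image_neg_eq_neg, ← Set.range_comp]
    rfl
  rwa [e]

variable (M : MDP S A) (π : S → A)

/-- This is the simulation lemma with equal transitions: `eP = 0` cancels whatever bound `B` is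
supplied for the values. -/
lemma Q_withModel_add_sub_le (X : (S → A → ℝ) × (S → A → PMF S)) (v : S → A → ℝ) (s : S) (a : A) :
    |(M.withModel (X.1 + v, X.2)).Q π s a - (M.withModel X).Q π s a| ≤ 1 / (1 - M.γ) * ‖v‖ := by
  refine (M.abs_Q_sub_Q_withModel_le π (X := (X.1 + v, X.2)) (Y := X) (eR := ‖v‖) (eP := 0)
    (c := 0) (B := ‖(M.withModel X).V π‖) (fun s a => ?_) (fun s a => by simp)
    (fun s => by simpa using norm_le_pi_norm ((M.withModel X).V π) s) s a).trans_eq (by ring)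
  simp only [Pi.add_apply, add_sub_cancel_left]
  exact (norm_le_pi_norm (v s) a).trans (norm_le_pi_norm v s)

variable (hN : ∀ Rh, 0 < (Stats.mk N Rh Ph).Nmin) (hσ : 0 ≤ σ) (hp : p ∈ Set.Ioo (0 : ℝ) 1)
include hN hp

/-- Occupancies do not depend on rewards, so the Lipschitz constant is `0`. -/
lemma measurable_occLow (s : S) :
    Measurable fun Rh => (Stats.mk N Rh Ph).occLow M σ p π s :=
  measurable_iInf_confSet (f := fun X => (M.withModel X).occ π s) le_rfl
    (fun X v => by
      have : (M.withModel (X.1 + v, X.2)).occ π s = (M.withModel X).occ π s := rfl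
      rw [this]
      simp)
    (fun Rh => ⟨0, Set.forall_mem_range.2 fun X => (M.withModel X).occ_nonneg π s⟩)

include hσ

lemma measurable_Qhigh (s : S) (a : A) :
    Measurable fun Rh => (Stats.mk N Rh Ph).Qhigh M σ p π s a := by
  have hγ : 0 < 1 - M.γ := by linarith [M.γ_lt_one]
  refine measurable_iSup_confSet (f := fun X => (M.withModel X).Q π s a)
    (C := 1 / (1 - M.γ)) (by positivity)
    (fun X v => by linarith [(abs_le.1 (Q_withModel_add_sub_le M π X v s a)).2]) (fun Rh => ?_)
  rcases isEmpty_or_nonempty ((Stats.mk N Rh Ph).confSet σ p) with he | ⟨⟨Y⟩⟩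
  · rw [Set.range_eq_empty]
    exact bddAbove_empty
  · exact ⟨_, Set.forall_mem_range.2 fun X => sub_le_iff_le_add.1
      (abs_le.1 (abs_Q_sub_Q_le (hN Rh) M π hσ hp X.2 Y.2 s a)).2⟩

lemma measurable_Vlow (s : S) :
    Measurable fun Rh => (Stats.mk N Rh Ph).Vlow M σ p π s := by
  have hγ : 0 < 1 - M.γ := by linarith [M.γ_lt_one]
  refine measurable_iInf_confSet (f := fun X => (M.withModel X).V π s)
    (C := 1 / (1 - M.γ)) (by positivity) (fun X v => ?_) (fun Rh => ?_)
  · have := (abs_le.1 (Q_withModel_add_sub_le M π X v s (π s))).1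
    rw [← MDP.V_eq_Q, ← MDP.V_eq_Q] at this
    linarith
  rcases isEmpty_or_nonempty ((Stats.mk N Rh Ph).confSet σ p) with he | ⟨⟨Y⟩⟩
  · rw [Set.range_eq_empty]
    exact bddBelow_empty
  · exact ⟨(M.withModel Y).V π s - (Stats.mk N Rh Ph).eQ M σ p, Set.forall_mem_range.2 fun X => by
      linarith [(abs_le.1 (abs_V_sub_V_le (hN Rh) M π hσ hp X.2 Y.2 s)).1]⟩

lemma measurable_deltaHat (ε : ℝ) (πT : S → A) :
    Measurable fun Rh => (Stats.mk N Rh Ph).deltaHat M σ p ε πT := by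
  refine measurable_pi_iff.2 fun s => measurable_pi_iff.2 fun a => ?_
  unfold deltaHat
  split_ifs
  · exact measurable_const
  · exact measurable_const.max (((measurable_Qhigh M πT hN hσ hp s a).sub
      (measurable_Vlow M πT hN hσ hp s)).add
      (measurable_const.div (measurable_occLow M (Function.update πT s a) hN hp s)))

lemma measurableSet_stop (m ε : ℝ) (πT : S → A) :
    MeasurableSet {Rh | (Stats.mk N Rh Ph).Stop M σ p m ε πT} := by
  have hrange : Measurable fun Rh => (Stats.mk N Rh Ph).rangeHat σ p := by
    unfold rangeHat
    refine Measurable.sub ?_ ?_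
    · exact Measurable.iSup fun x => by fun_prop
    · exact Measurable.iInf fun x => by fun_prop
  have heQ : Measurable fun Rh => (Stats.mk N Rh Ph).eQ M σ p := by
    unfold eQ
    simp only [Nmin]
    fun_prop
  have heq : {Rh | (Stats.mk N Rh Ph).Stop M σ p m ε πT} = ⋂ s, ⋂ a, {Rh | a ≠ πT s →
      0 < (Stats.mk N Rh Ph).occLow M σ p (Function.update πT s a) s ∧
      2 * (Stats.mk N Rh Ph).eQ M σ p +
        ε / (Stats.mk N Rh Ph).occLow M σ p (Function.update πT s a) s -
        ε / ((Stats.mk N Rh Ph).occLow M σ p (Function.update πT s a) s +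
          (Stats.mk N Rh Ph).eMu M p) ≤ m} := by
    ext Rh
    simp [Stop, hN Rh]
  rw [heq]
  refine MeasurableSet.iInter fun s => MeasurableSet.iInter fun a => ?_
  have hocc := measurable_occLow (σ := σ) M (Function.update πT s a) hN hp s
  have heMu : Measurable fun Rh => (Stats.mk N Rh Ph).eMu M p := by
    simp only [eMu, Nmin]
    exact measurable_const
  by_cases ha : a = πT s
  · simp [ha]
  · simp only [ne_eq, ha, not_false_eq_true, forall_const]
    have hf : Measurable fun Rh => 2 * (Stats.mk N Rh Ph).eQ M σ p +
        ε / (Stats.mk N Rh Ph).occLow M σ p (Function.update πT s a) s -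
        ε / ((Stats.mk N Rh Ph).occLow M σ p (Function.update πT s a) s +
          (Stats.mk N Rh Ph).eMu M p) :=
      ((heQ.const_mul 2).add (measurable_const.div hocc)).sub
        (measurable_const.div (hocc.add heMu))
    exact (measurableSet_lt measurable_const hocc).inter (measurableSet_le hf measurable_const)

end Stats

open Classical in
/-- The value of `f` at the first `j ≤ n` with `P j`, and `b` if there is none. -/
noncomputable def firstHit {β : Type*} (P : ℕ → Prop) (f : ℕ → β) (b : β) (n : ℕ) : β :=
  if h : ∃ j, j ≤ n ∧ P j then f (Nat.find h) else b

open Classical in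
lemma firstHit_zero {β : Type*} (P : ℕ → Prop) (f : ℕ → β) (b : β) :
    firstHit P f b 0 = if P 0 then f 0 else b := by
  rw [firstHit]
  by_cases h : ∃ j, j ≤ 0 ∧ P j
  · have h0 : Nat.find h = 0 := Nat.le_zero.1 (Nat.find_spec h).1
    have hs := (Nat.find_spec h).2
    rw [h0] at hs
    rw [dif_pos h, if_pos hs, h0]
  · rw [dif_neg h, if_neg fun hs => h ⟨0, le_rfl, hs⟩]

-- The recursion in the horizon permits induction for the measurability of `attackMode`, whose
-- `Nat.find` offers no direct handle.
open Classical in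
lemma firstHit_succ {β : Type*} (P : ℕ → Prop) (f : ℕ → β) (b : β) (n : ℕ) :
    firstHit P f b (n + 1) = if ∃ j, j ≤ n ∧ P j then firstHit P f b n
      else if P (n + 1) then f (n + 1) else b := by
  by_cases hn : ∃ j, j ≤ n ∧ P j
  · have hs := Nat.find_spec hn
    have h : ∃ j, j ≤ n + 1 ∧ P j := ⟨_, hs.1.trans (Nat.le_succ n), hs.2⟩
    have hle : Nat.find h ≤ Nat.find hn := Nat.find_min' h ⟨hs.1.trans (Nat.le_succ n), hs.2⟩
    have hf : Nat.find h = Nat.find hn :=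
      le_antisymm hle (Nat.find_min' hn ⟨hle.trans hs.1, (Nat.find_spec h).2⟩)
    rw [if_pos hn, firstHit, firstHit, dif_pos h, dif_pos hn, hf]
  · rw [if_neg hn, firstHit]
    by_cases h : ∃ j, j ≤ n + 1 ∧ P j
    · have h0 : Nat.find h = n + 1 := by
        refine le_antisymm (Nat.find_spec h).1 ?_
        by_contra hlt
        exact hn ⟨_, by omega, (Nat.find_spec h).2⟩
      have hs := (Nat.find_spec h).2
      rw [h0] at hs
      rw [dif_pos h, if_pos hs, h0]
    · rw [dif_neg h, if_neg fun hs => h ⟨_, le_rfl, hs⟩]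

/-! ### Measurability of the statistics and of the attacker's mode -/

section statsOf

variable {S A : Type*} [MeasurableSpace S] [MeasurableSpace A]
  [Fintype S] [MeasurableSingletonClass S] [Fintype A] [MeasurableSingletonClass A] {T l : ℕ}
  [DecidableEq S] [DecidableEq A]

/-- A function of the statistics is measurable if it depends measurably on the empirical means
for given visit counts and transition frequencies. -/
lemma measurable_comp_statsOf {β : Type*} [MeasurableSpace β] {G : Stats S A → β}
    (hG : ∀ N Ph, Measurable fun Rh => G (Stats.mk N Rh Ph)) (j : ℕ) :
    Measurable fun d : Fin l → Fin T → Rec S A => G (statsOf d j) := by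
  -- The data split into a countable part, which fixes counts and frequencies, and the real rewards,
  -- in which the empirical means are linear. Statistics ignore the shown rewards, so these are set
  -- to `0`.
  let mk : (Fin l → Fin T → (S × A) × S) × (Fin l → Fin T → ℝ) → Fin l → Fin T → Rec S A :=
    fun x i t => ((x.1 i t).1, (x.2 i t, 0), (x.1 i t).2)
  have h1 : Measurable fun x => G (statsOf (mk x) j) := by
    refine measurable_from_prod_countable_right fun k => ?_
    refine (hG (statsOf (mk (k, 0)) j).N (statsOf (mk (k, 0)) j).Phat).comp
      (g := fun Rh => G (Stats.mk (statsOf (mk (k, 0)) j).N Rh (statsOf (mk (k, 0)) j).Phat))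
      (f := fun r => (statsOf (mk (k, r)) j).Rhat) ?_
    refine measurable_pi_iff.2 fun s => measurable_pi_iff.2 fun a => ?_
    change Measurable fun r : Fin l → Fin T → ℝ => (∑ x ∈ visits (mk (k, 0)) j s a, r x.1 x.2) /
      ((visits (mk (k, 0)) j s a).card : ℝ)
    fun_prop
  exact h1.comp (f := fun d : Fin l → Fin T → Rec S A =>
    (fun i t => ((d i t).1, (d i t).2.2), fun i t => (d i t).2.1.1)) (by fun_prop)

variable [Nonempty S] [Nontrivial A]

open Classical in
lemma measurable_attackMode (M : MDP S A) {σ p : ℝ} (m ε : ℝ) (πT : S → A) (hσ : 0 ≤ σ)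
    (hp : p ∈ Set.Ioo (0 : ℝ) 1) :
    Measurable fun d : Fin l → Fin T → Rec S A => attackMode M σ p m ε πT d := by
  have hStop : ∀ j, MeasurableSet {d : Fin l → Fin T → Rec S A |
      (statsOf d j).Stop M σ p m ε πT} := fun j => by
    refine measurableSet_setOfPred.2 (measurable_comp_statsOf
      (G := fun D => D.Stop M σ p m ε πT) (fun N Ph => measurableSet_setOfPred.1 ?_) j)
    by_cases hN : 0 < (Stats.mk N 0 Ph : Stats S A).Nmin
    · exact Stats.measurableSet_stop M (fun Rh => hN) hσ hp m ε πT
    · have : {Rh | (Stats.mk N Rh Ph).Stop M σ p m ε πT} = ∅ :=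
        Set.eq_empty_of_forall_notMem fun Rh h => hN h.1
      rw [this]
      exact MeasurableSet.empty
  -- `deltaHat` is known to be measurable only where every pair has been visited. Cutting it off by
  -- the stopping condition, which includes this, loses nothing.
  have hD : ∀ j, Measurable fun d : Fin l → Fin T → Rec S A =>
      if (statsOf d j).Stop M σ p m ε πT then (statsOf d j).deltaHat M σ p ε πT else 0 :=
    fun j => by
    refine measurable_comp_statsOf (G := fun D => if D.Stop M σ p m ε πT then
      D.deltaHat M σ p ε πT else 0) (fun N Ph => ?_) j
    by_cases hN : 0 < (Stats.mk N 0 Ph : Stats S A).Nmin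
    · exact Measurable.ite (Stats.measurableSet_stop M (fun Rh => hN) hσ hp m ε πT)
        (Stats.measurable_deltaHat M (fun Rh => hN) hσ hp ε πT) measurable_const
    · have : ∀ Rh, ¬ (Stats.mk N Rh Ph).Stop M σ p m ε πT := fun Rh h => hN h.1
      simp only [this, if_false]
      exact measurable_const
  have hmode : ∀ n, Measurable fun d : Fin l → Fin T → Rec S A =>
      firstHit (fun j => (statsOf d j).Stop M σ p m ε πT)
        (fun j => ((false, (statsOf d j).deltaHat M σ p ε πT) : Mode S A)) (true, 0) n := by
    have hstep : ∀ j (g : (Fin l → Fin T → Rec S A) → Mode S A), Measurable g →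
        Measurable fun d => if (statsOf d j).Stop M σ p m ε πT then
          ((false, (statsOf d j).deltaHat M σ p ε πT) : Mode S A) else g d := fun j g hg => by
      have e : (fun d => if (statsOf d j).Stop M σ p m ε πT then
          ((false, (statsOf d j).deltaHat M σ p ε πT) : Mode S A) else g d) =
          fun d => if (statsOf d j).Stop M σ p m ε πT then
          ((false, if (statsOf d j).Stop M σ p m ε πT then (statsOf d j).deltaHat M σ p ε πT
            else 0) : Mode S A) else g d := by
        funext d
        split_ifs <;> rfl
      rw [e]
      exact Measurable.ite (hStop j) (measurable_const.prodMk (hD j)) hg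
    intro n
    induction n with
    | zero =>
      simp only [firstHit_zero]
      exact hstep 0 _ measurable_const
    | succ n ih =>
      have hex : MeasurableSet {d : Fin l → Fin T → Rec S A |
          ∃ j, j ≤ n ∧ (statsOf d j).Stop M σ p m ε πT} := by
        have : {d : Fin l → Fin T → Rec S A | ∃ j, j ≤ n ∧ (statsOf d j).Stop M σ p m ε πT} =
            ⋃ j, ⋃ (_ : j ≤ n), {d | (statsOf d j).Stop M σ p m ε πT} := by
          ext d
          simp
        rw [this]
        exact MeasurableSet.iUnion fun j => MeasurableSet.iUnion fun _ => hStop j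
      simp only [firstHit_succ]
      exact Measurable.ite hex ih (hstep _ _ measurable_const)
  exact hmode l

end statsOf

end RewardPoisoning

namespace RewardPoisoning

/-! ## The law of the attack on a sequence of learners -/

section attackLaw

variable {S A : Type*} [MeasurableSpace S] [MeasurableSpace A]
  [Fintype S] [MeasurableSingletonClass S] [Fintype A] [MeasurableSingletonClass A] {T : ℕ}
  [DecidableEq S] [DecidableEq A] [Nonempty S] [Nontrivial A]
  {M : MDP S A} {ν : Kernel (S × A) ℝ} [IsMarkovKernel ν] {σ p m ε : ℝ} {πT : S → A}
  {ℓ : ℕ → Learner S A T}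

/-- Append the trajectory of one more learner. -/
def snocTraj {l : ℕ} (d : Fin l → Fin T → Rec S A) (τ : Fin T → Rec S A) :
    Fin (l + 1) → Fin T → Rec S A :=
  Fin.snoc (α := fun _ => Fin T → Rec S A) d τ

/-- The trajectories of the first `j` learners. -/
def takeTraj {l j : ℕ} (h : j ≤ l) (d : Fin l → Fin T → Rec S A) : Fin j → Fin T → Rec S A :=
  fun i => d (Fin.castLE h i)

lemma measurable_snocTraj {l : ℕ} : Measurable fun x : (Fin l → Fin T → Rec S A) ×
    (Fin T → Rec S A) => snocTraj x.1 x.2 := by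
  unfold snocTraj
  refine measurable_pi_iff.2 fun i => ?_
  refine Fin.lastCases ?_ (fun j => ?_) i
  · simpa using measurable_snd
  · simp only [Fin.snoc_castSucc]
    exact (measurable_pi_apply j).comp measurable_fst

lemma measurable_takeTraj {l j : ℕ} (h : j ≤ l) :
    Measurable (takeTraj (S := S) (A := A) (T := T) h) := by
  unfold takeTraj
  fun_prop

lemma takeTraj_self {l : ℕ} (h : l ≤ l) (d : Fin l → Fin T → Rec S A) : takeTraj h d = d := rfl

lemma takeTraj_snocTraj {l j : ℕ} (h : j ≤ l) (h' : j ≤ l + 1) (d : Fin l → Fin T → Rec S A)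
    (τ : Fin T → Rec S A) : takeTraj h' (snocTraj d τ) = takeTraj h d := by
  funext i
  exact Fin.snoc_castSucc (α := fun _ => Fin T → Rec S A) (x := τ) (p := d) (i := Fin.castLE h i)

lemma snocTraj_last {l : ℕ} (h : l < l + 1) (d : Fin l → Fin T → Rec S A)
    (τ : Fin T → Rec S A) : snocTraj d τ ⟨l, h⟩ = τ :=
  Fin.snoc_last (α := fun _ => Fin T → Rec S A) τ d

lemma snocTraj_castSucc {l : ℕ} (d : Fin l → Fin T → Rec S A) (τ : Fin T → Rec S A) (i : Fin l) :
    snocTraj d τ i.castSucc = d i :=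
  Fin.snoc_castSucc (α := fun _ => Fin T → Rec S A) (x := τ) (p := d) (i := i)

/-- Integrals against `bind` unfold only for measurable kernels; this is where the measurability of
the mode pays off. -/
lemma lintegral_attackLaw_succ (hσ : 0 ≤ σ) (hp : p ∈ Set.Ioo (0 : ℝ) 1) (l : ℕ)
    {F : (Fin (l + 1) → Fin T → Rec S A) → ℝ≥0∞} (hF : Measurable F) :
    ∫⁻ d, F d ∂attackLaw M ν σ p m ε πT ℓ (l + 1) =
      ∫⁻ d, ∫⁻ h, F (snocTraj d h.1)
        ∂run M (attackChannel M ν) (ℓ l) T (attackMode M σ p m ε πT d)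
        ∂attackLaw M ν σ p m ε πT ℓ l := by
  have hmode := measurable_attackMode (T := T) (l := l) M m ε πT hσ hp
  have hf : Measurable fun x : (Fin l → Fin T → Rec S A) × ((Fin T → Rec S A) × S) =>
      snocTraj x.1 x.2.1 :=
    measurable_snocTraj.comp (f := fun x : (Fin l → Fin T → Rec S A) × ((Fin T → Rec S A) × S) =>
      (x.1, x.2.1)) (by fun_prop)
  have hkern : Measurable fun d : Fin l → Fin T → Rec S A =>
      ((run M (attackChannel M ν) (ℓ l) T (attackMode M σ p m ε πT d)).map Prod.fst).map
        fun τ => Fin.snoc (α := fun _ => Fin T → Rec S A) d τ := by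
    have e : (fun d : Fin l → Fin T → Rec S A =>
        ((run M (attackChannel M ν) (ℓ l) T (attackMode M σ p m ε πT d)).map Prod.fst).map
        fun τ => Fin.snoc (α := fun _ => Fin T → Rec S A) d τ) =
        (Kernel.id ×ₖ (run M (attackChannel M ν) (ℓ l) T).comap _ hmode).map
          fun x => snocTraj x.1 x.2.1 := by
      funext d
      rw [Kernel.map_apply _ hf, Kernel.prod_apply, Kernel.id_apply, Measure.dirac_prod,
        Measure.map_map hf (by fun_prop), Measure.map_map _ measurable_fst, Kernel.comap_apply]
      · rfl
      · exact measurable_snocTraj.comp (f := fun τ => (d, τ)) (by fun_prop)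
    rw [e]
    exact Kernel.measurable _
  rw [attackLaw, Measure.lintegral_bind hkern.aemeasurable hF.aemeasurable]
  refine lintegral_congr fun d => ?_
  have hs : Measurable fun τ : Fin T → Rec S A =>
      Fin.snoc (α := fun _ => Fin T → Rec S A) d τ :=
    measurable_snocTraj.comp (f := fun τ => (d, τ)) (by fun_prop)
  have hFs : Measurable fun τ : Fin T → Rec S A =>
      F (Fin.snoc (α := fun _ => Fin T → Rec S A) d τ) := hF.comp hs
  rw [lintegral_map hF hs, lintegral_map hFs measurable_fst]
  rfl

lemma isProbabilityMeasure_attackLaw (hσ : 0 ≤ σ) (hp : p ∈ Set.Ioo (0 : ℝ) 1) (l : ℕ) :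
    IsProbabilityMeasure (attackLaw M ν σ p m ε πT ℓ l) := by
  induction l with
  | zero =>
    unfold attackLaw
    infer_instance
  | succ l ih =>
    refine ⟨?_⟩
    rw [← lintegral_one, lintegral_attackLaw_succ hσ hp l measurable_const]
    simp

/-- Ville's inequality for supermartingales along the sequence of learners. -/
lemma attackLaw_exists_le (hσ : 0 ≤ σ) (hp : p ∈ Set.Ioo (0 : ℝ) 1)
    {V : (l : ℕ) → (Fin l → Fin T → Rec S A) → ℝ≥0∞} (hVm : ∀ l, Measurable (V l))
    {L : ℕ} (hV : ∀ l < L, ∀ d : Fin l → Fin T → Rec S A, ∫⁻ h, V (l + 1) (snocTraj d h.1)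
      ∂run M (attackChannel M ν) (ℓ l) T (attackMode M σ p m ε πT d) ≤ V l d)
    (hV0 : ∀ d, V 0 d ≤ 1) (c : ℝ≥0∞) :
    c * attackLaw M ν σ p m ε πT ℓ L {d | ∃ j, ∃ h : j ≤ L, c ≤ V j (takeTraj h d)} ≤ 1 := by
  classical
  let Cr : (l : ℕ) → Set (Fin l → Fin T → Rec S A) :=
    fun l => {d | ∃ j, ∃ h : j ≤ l, c ≤ V j (takeTraj h d)}
  have hCr : ∀ l, MeasurableSet (Cr l) := fun l => by
    have : Cr l = ⋃ j, ⋃ h : j ≤ l, {d | c ≤ V j (takeTraj h d)} := by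
      ext d
      simp [Cr]
    rw [this]
    exact MeasurableSet.iUnion fun j => MeasurableSet.iUnion fun h =>
      measurableSet_le measurable_const ((hVm j).comp (measurable_takeTraj h))
  -- The process is frozen at `c` from its first crossing on. Freezing can only lower it at the
  -- crossing, so its mean stays at most one, and at time `L` it dominates `c` times the indicator
  -- of a crossing.
  have hU : ∀ l ≤ L, ∫⁻ d, (if d ∈ Cr l then c else V l d) ∂attackLaw M ν σ p m ε πT ℓ l ≤ 1 := by
    intro l
    induction l with
    | zero =>
      intro _
      have hle : ∀ d, (if d ∈ Cr 0 then c else V 0 d) ≤ 1 := fun d => by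
        split_ifs with hd
        · obtain ⟨j, hj, hd⟩ := hd
          obtain rfl : j = 0 := by omega
          exact hd.trans (hV0 _)
        · exact hV0 d
      refine (lintegral_mono hle).trans ?_
      have := isProbabilityMeasure_attackLaw (M := M) (ν := ν) (m := m) (ε := ε) (πT := πT)
        (ℓ := ℓ) hσ hp 0
      simp
    | succ l ih =>
      intro hl
      have hFm : Measurable fun d => if d ∈ Cr (l + 1) then c else V (l + 1) d :=
        Measurable.ite (hCr _) measurable_const (hVm _)
      rw [lintegral_attackLaw_succ hσ hp l hFm]
      refine le_trans (lintegral_mono fun d => ?_) (ih (by omega))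
      by_cases hd : d ∈ Cr l
      · rw [if_pos hd]
        have : ∀ τ, snocTraj d τ ∈ Cr (l + 1) := fun τ => by
          obtain ⟨j, hj, hd⟩ := hd
          exact ⟨j, by omega, by rwa [takeTraj_snocTraj hj]⟩
        simp [this]
      · rw [if_neg hd]
        refine le_trans (lintegral_mono fun h => ?_) (hV l (by omega) d)
        split_ifs with hs
        · obtain ⟨j, hj, hs⟩ := hs
          rcases Nat.lt_or_ge j (l + 1) with hlt | hge
          · rw [takeTraj_snocTraj (by omega)] at hs
            exact absurd ⟨j, by omega, hs⟩ hd
          · obtain rfl : j = l + 1 := by omega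
            exact hs
        · exact le_rfl
  have h1 : c * attackLaw M ν σ p m ε πT ℓ L (Cr L) ≤
      ∫⁻ d, (if d ∈ Cr L then c else V L d) ∂attackLaw M ν σ p m ε πT ℓ L := by
    rw [← lintegral_indicator_const (hCr L)]
    refine lintegral_mono fun d => ?_
    by_cases hd : d ∈ Cr L
    · simp [hd]
    · simp [hd]
  exact h1.trans (hU L le_rfl)

/-- Union bound over the learners. -/
lemma attackLaw_union_le (hσ : 0 ≤ σ) (hp : p ∈ Set.Ioo (0 : ℝ) 1)
    {B : (l : ℕ) → Set ((Fin l → Fin T → Rec S A) × (Fin T → Rec S A))}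
    (hB : ∀ l, MeasurableSet (B l)) {δ : ℕ → ℝ≥0∞} (L : ℕ)
    (hδ : ∀ l < L, ∀ d : Fin l → Fin T → Rec S A,
      run M (attackChannel M ν) (ℓ l) T (attackMode M σ p m ε πT d) {h | (d, h.1) ∈ B l} ≤ δ l) :
    attackLaw M ν σ p m ε πT ℓ L
      {d | ∃ l, ∃ h : l < L, (takeTraj h.le d, d ⟨l, h⟩) ∈ B l} ≤ ∑ l ∈ Finset.range L, δ l := by
  have hm : ∀ L, MeasurableSet {d : Fin L → Fin T → Rec S A |
      ∃ l, ∃ h : l < L, (takeTraj h.le d, d ⟨l, h⟩) ∈ B l} := fun L => by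
    have : {d : Fin L → Fin T → Rec S A |
        ∃ l, ∃ h : l < L, (takeTraj h.le d, d ⟨l, h⟩) ∈ B l} =
        ⋃ l, ⋃ h : l < L, {d | (takeTraj h.le d, d ⟨l, h⟩) ∈ B l} := by
      ext d
      simp
    rw [this]
    exact MeasurableSet.iUnion fun l => MeasurableSet.iUnion fun h => (hB l).preimage
      ((measurable_takeTraj h.le).prodMk (measurable_pi_apply _))
  induction L with
  | zero => simp
  | succ L ih =>
    rw [Finset.sum_range_succ, ← lintegral_indicator_one (hm (L + 1)),
      lintegral_attackLaw_succ hσ hp L (measurable_one.indicator (hm (L + 1)))]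
    have := isProbabilityMeasure_attackLaw (M := M) (ν := ν) (m := m) (ε := ε) (πT := πT)
        (ℓ := ℓ) hσ hp L
    have hBd : ∀ d, MeasurableSet {h : (Fin T → Rec S A) × S | (d, h.1) ∈ B L} := fun d =>
      (hB L).preimage (by fun_prop)
    calc _ ≤ ∫⁻ d, ({d : Fin L → Fin T → Rec S A |
          ∃ l, ∃ h : l < L, (takeTraj h.le d, d ⟨l, h⟩) ∈ B l}.indicator 1 d + δ L)
          ∂attackLaw M ν σ p m ε πT ℓ L := by
          refine lintegral_mono fun d => ?_
          calc _ ≤ ∫⁻ h, ({d : Fin L → Fin T → Rec S A | ∃ l, ∃ h : l < L,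
                (takeTraj h.le d, d ⟨l, h⟩) ∈ B l}.indicator 1 d +
                {h : (Fin T → Rec S A) × S | (d, h.1) ∈ B L}.indicator 1 h)
                ∂run M (attackChannel M ν) (ℓ L) T (attackMode M σ p m ε πT d) := by
                refine lintegral_mono fun h => Set.indicator_apply_le' (fun hh => ?_)
                  fun _ => zero_le
                obtain ⟨l, hl, hh⟩ := hh
                rcases Nat.lt_or_ge l L with hlt | hge
                · rw [takeTraj_snocTraj hlt.le] at hh
                  refine le_add_right (le_of_eq ?_)
                  rw [Set.indicator_of_mem]
                  · rfl
                  · refine ⟨l, hlt, ?_⟩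
                    rwa [← snocTraj_castSucc d h.1 ⟨l, hlt⟩]
                · obtain rfl : l = L := by omega
                  rw [takeTraj_snocTraj le_rfl, takeTraj_self, snocTraj_last] at hh
                  refine le_add_left (le_of_eq ?_)
                  rw [Set.indicator_of_mem]
                  · rfl
                  · exact hh
            _ ≤ _ := by
                rw [lintegral_add_left measurable_const, lintegral_const, measure_univ, mul_one,
                  lintegral_indicator_one (hBd d)]
                gcongr
                exact hδ L (by omega) d
      _ ≤ _ := by
          rw [lintegral_add_right _ measurable_const, lintegral_indicator_one (hm L),
            lintegral_const, measure_univ, mul_one]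
          gcongr
          exact ih fun l hl => hδ l (by omega)

/-- Ville's inequality for products of a step functional. -/
lemma attackLaw_exists_prod_le (hσ : 0 ≤ σ) (hp : p ∈ Set.Ioo (0 : ℝ) 1) {g : Rec S A → ℝ≥0∞}
    (hg : Measurable g) (h1 : ∀ (θ : Mode S A) s a, ∫⁻ z, ∫⁻ s', g ((s, a), z, s')
      ∂(M.P s a).toMeasure ∂attackChannel M ν (θ, (s, a)) ≤ 1) (L : ℕ) (c : ℝ≥0∞) :
    c * attackLaw M ν σ p m ε πT ℓ L
      {d | ∃ j ≤ L, c ≤ ∏ l : Fin L, if l.val < j then ∏ t, g (d l t) else 1} ≤ 1 := by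
  have h := attackLaw_exists_le (M := M) (ν := ν) (m := m) (ε := ε) (πT := πT) (ℓ := ℓ) hσ hp
    (V := fun l d => ∏ i, ∏ t, g (d i t))
    (fun l => Finset.measurable_prod _ fun i _ => Finset.measurable_prod _ fun t _ =>
      hg.comp (by fun_prop)) (L := L) (fun l _ d => by
        simp only [Fin.prod_univ_castSucc (n := l), snocTraj_castSucc]
        rw [lintegral_const_mul]
        · refine mul_le_of_le_one_right zero_le ?_
          have e : ∀ h : (Fin T → Rec S A) × S, snocTraj d h.1 (Fin.last l) = h.1 := fun h =>
            snocTraj_last _ d h.1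
          simp only [e]
          exact lintegral_run_prod_le M _ (ℓ l) hg _ (h1 _) T
        · have e : ∀ h : (Fin T → Rec S A) × S, snocTraj d h.1 (Fin.last l) = h.1 := fun h =>
            snocTraj_last _ d h.1
          simp only [e]
          fun_prop) (fun d => by simp) c
  refine le_trans ?_ h
  gcongr c * ?_
  refine measure_mono ?_
  rintro d ⟨j, hj, hd⟩
  refine ⟨j, hj, hd.trans_eq ?_⟩
  rw [← Finset.prod_filter]
  symm
  refine Finset.prod_bij (fun i _ => Fin.castLE hj i) (fun i _ => by simp)
    (fun i _ i' _ h => Fin.castLE_injective hj h) (fun b hb => ?_) (fun i _ => rfl)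
  exact ⟨⟨b, by simpa using hb⟩, Finset.mem_univ _, rfl⟩

end attackLaw

end RewardPoisoning

namespace RewardPoisoning

/-! ## Validity of the confidence set -/

section confidence

variable {S A : Type*} [MeasurableSpace S] [MeasurableSpace A]
  [Fintype S] [MeasurableSingletonClass S] [Fintype A] [MeasurableSingletonClass A] {T : ℕ}
  [DecidableEq S] [DecidableEq A] [Nonempty S] [Nontrivial A]
  {M : MDP S A} {ν : Kernel (S × A) ℝ} [IsMarkovKernel ν] {σ p m ε : ℝ} {πT : S → A}
  {ℓ : ℕ → Learner S A T}

lemma prod_exp_visits {L : ℕ} (d : Fin L → Fin T → Rec S A) (j : ℕ) (s : S) (a : A)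
    (φ : Rec S A → ℝ) (x K : ℝ) :
    (∏ l : Fin L, if l.val < j then ∏ t, (if (d l t).1 = (s, a) then
      ENNReal.ofReal (Real.exp (x * φ (d l t) - K)) else 1) else 1) =
    ENNReal.ofReal (Real.exp (x * ∑ y ∈ visits d j s a, φ (d y.1 y.2) -
      (visits d j s a).card * K)) := by
  have e1 : (∏ l : Fin L, if l.val < j then ∏ t, (if (d l t).1 = (s, a) then
      ENNReal.ofReal (Real.exp (x * φ (d l t) - K)) else 1) else 1) =
      ∏ y ∈ visits d j s a, ENNReal.ofReal (Real.exp (x * φ (d y.1 y.2) - K)) := by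
    rw [visits, Finset.prod_filter, Fintype.prod_prod_type]
    refine Finset.prod_congr rfl fun l _ => ?_
    split_ifs with h
    · refine Finset.prod_congr rfl fun t _ => ?_
      simp [h]
    · simp [h]
  rw [e1, ← ENNReal.ofReal_prod_of_nonneg fun _ _ => (Real.exp_pos _).le, ← Real.exp_sum,
    Finset.sum_sub_distrib, ← Finset.mul_sum, Finset.sum_const, nsmul_eq_mul]

/-- Concentration of adaptively collected sums with positive variance proxy. -/
lemma attackLaw_sum_ge_le (hσ : 0 ≤ σ) (hp : p ∈ Set.Ioo (0 : ℝ) 1) {φ : Rec S A → ℝ}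
    (hφ : Measurable φ) {s : S} {a : A} {v : ℝ} (hv : 0 < v)
    (h1 : ∀ (θ : Mode S A) (x : ℝ), ∫⁻ z, ∫⁻ s', ENNReal.ofReal (Real.exp (x * φ ((s, a), z, s')))
      ∂(M.P s a).toMeasure ∂attackChannel M ν (θ, (s, a)) ≤
        ENNReal.ofReal (Real.exp (v * x ^ 2 / 2)))
    (L : ℕ) {n : ℕ} (hn : 0 < n) {K : ℝ} (hK : 0 ≤ K) :
    attackLaw M ν σ p m ε πT ℓ L {d | ∃ j ≤ L, (visits d j s a).card = n ∧
      √(v * (2 * K * n)) ≤ ∑ y ∈ visits d j s a, φ (d y.1 y.2)} ≤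
      ENNReal.ofReal (Real.exp (-K)) := by
  have hn' : (0 : ℝ) < n := by exact_mod_cast hn
  -- This exponent balances the two terms: `x` times the threshold is `2K`, and the compensator over
  -- `n` visits is `K`.
  set x := √(2 * K / (v * n)) with hx
  have hx0 : 0 ≤ x := Real.sqrt_nonneg _
  have hxsq : x ^ 2 = 2 * K / (v * n) := Real.sq_sqrt (by positivity)
  have hxa : x * √(v * (2 * K * n)) = 2 * K := by
    rw [hx, ← Real.sqrt_mul (by positivity),
      show 2 * K / (v * n) * (v * (2 * K * n)) = (2 * K) ^ 2 by field_simp,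
      Real.sqrt_sq (by positivity)]
  have hg1 : Measurable fun r : Rec S A => ENNReal.ofReal (Real.exp (x * φ r - v * x ^ 2 / 2)) :=
    ((hφ.const_mul x).sub_const _).exp.ennreal_ofReal
  have hg : Measurable fun r : Rec S A => if r.1 = (s, a) then
      ENNReal.ofReal (Real.exp (x * φ r - v * x ^ 2 / 2)) else 1 :=
    Measurable.ite ((measurableSet_singleton (s, a)).preimage measurable_fst) hg1 measurable_const
  have h := attackLaw_exists_prod_le (M := M) (ν := ν) (m := m) (ε := ε) (πT := πT) (ℓ := ℓ)
    hσ hp hg (fun θ s' a' => by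
      by_cases hsa : (s', a') = (s, a)
      · simp only [hsa, if_true]
        obtain ⟨rfl, rfl⟩ := Prod.mk.inj hsa
        have e : ∀ r : Rec S A, ENNReal.ofReal (Real.exp (x * φ r - v * x ^ 2 / 2)) =
            ENNReal.ofReal (Real.exp (x * φ r)) * ENNReal.ofReal (Real.exp (-(v * x ^ 2 / 2))) :=
          fun r => by
            rw [← ENNReal.ofReal_mul (Real.exp_pos _).le, ← Real.exp_add, sub_eq_add_neg]
        simp only [e]
        have hm : Measurable fun r : Rec S A => ENNReal.ofReal (Real.exp (x * φ r)) :=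
          (hφ.const_mul x).exp.ennreal_ofReal
        have hmz : ∀ z, Measurable fun s'' : S =>
            ENNReal.ofReal (Real.exp (x * φ ((s', a'), z, s''))) := fun z =>
          hm.comp (f := fun s'' : S => (((s', a'), z, s'') : Rec S A)) (by fun_prop)
        simp only [fun z => lintegral_mul_const (μ := (M.P s' a').toMeasure)
          (ENNReal.ofReal (Real.exp (-(v * x ^ 2 / 2)))) (hmz z)]
        rw [lintegral_mul_const]
        · refine (mul_le_mul' (h1 θ x) le_rfl).trans_eq ?_
          rw [← ENNReal.ofReal_mul (Real.exp_pos _).le, ← Real.exp_add, add_neg_cancel,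
            Real.exp_zero, ENNReal.ofReal_one]
        · exact Measurable.lintegral_prod_right' (f := fun q : (ℝ × ℝ) × S =>
            ENNReal.ofReal (Real.exp (x * φ ((s', a'), q.1, q.2)))) (hm.comp (by fun_prop))
      · simp [hsa]) L (ENNReal.ofReal (Real.exp K))
  rw [Real.exp_neg, ENNReal.ofReal_inv_of_pos (Real.exp_pos _), ENNReal.le_inv_iff_mul_le, mul_comm]
  refine le_trans ?_ h
  gcongr _ * ?_
  refine measure_mono ?_
  rintro d ⟨j, hj, hc, hd⟩
  refine ⟨j, hj, ?_⟩
  rw [prod_exp_visits d j s a φ x (v * x ^ 2 / 2), hc]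
  refine ENNReal.ofReal_le_ofReal (Real.exp_le_exp.2 ?_)
  have h2 := mul_le_mul_of_nonneg_left hd hx0
  have h3 : n * (v * x ^ 2 / 2) = K := by
    rw [hxsq]
    field_simp
  linarith

/-- Concentration of adaptively collected sums. -/
lemma attackLaw_sum_gt_le (hσ : 0 ≤ σ) (hp : p ∈ Set.Ioo (0 : ℝ) 1) {φ : Rec S A → ℝ}
    (hφ : Measurable φ) {s : S} {a : A} {v : ℝ} (hv : 0 ≤ v)
    (h1 : ∀ (θ : Mode S A) (x : ℝ), ∫⁻ z, ∫⁻ s', ENNReal.ofReal (Real.exp (x * φ ((s, a), z, s')))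
      ∂(M.P s a).toMeasure ∂attackChannel M ν (θ, (s, a)) ≤
        ENNReal.ofReal (Real.exp (v * x ^ 2 / 2)))
    (L : ℕ) {n : ℕ} (hn : 0 < n) {K : ℝ} (hK : 0 ≤ K) :
    attackLaw M ν σ p m ε πT ℓ L {d | ∃ j ≤ L, (visits d j s a).card = n ∧
      √(v * (2 * K * n)) < ∑ y ∈ visits d j s a, φ (d y.1 y.2)} ≤
      ENNReal.ofReal (Real.exp (-K)) := by
  -- The optimal exponent needs a positive proxy, so `v` is approached from above. The inequality in
  -- the event is strict, so it is the limit of the increasing events for the larger proxies and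
  -- nothing is lost.
  let w : ℕ → ℝ := fun k => v + 1 / ((k : ℝ) + 1)
  have hw : ∀ k, v < w k := fun k => lt_add_of_pos_right v (by positivity)
  have hsub : {d : Fin L → Fin T → Rec S A | ∃ j ≤ L, (visits d j s a).card = n ∧
      √(v * (2 * K * n)) < ∑ y ∈ visits d j s a, φ (d y.1 y.2)} ⊆
      ⋃ k : ℕ, {d | ∃ j ≤ L, (visits d j s a).card = n ∧
        √(w k * (2 * K * n)) ≤ ∑ y ∈ visits d j s a, φ (d y.1 y.2)} := by
    rintro d ⟨j, hj, hc, hd⟩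
    have hlim : Filter.Tendsto (fun k => √(w k * (2 * K * n))) Filter.atTop
        (nhds (√(v * (2 * K * n)))) := by
      have := ((tendsto_one_div_add_atTop_nhds_zero_nat (𝕜 := ℝ)).const_add v).mul_const
        (2 * K * n)
      rw [add_zero] at this
      exact this.sqrt
    obtain ⟨k, hk⟩ := (hlim.eventually (gt_mem_nhds hd)).exists
    exact Set.mem_iUnion.2 ⟨k, j, hj, hc, hk.le⟩
  refine (measure_mono hsub).trans ?_
  rw [Directed.measure_iUnion]
  · refine iSup_le fun k => attackLaw_sum_ge_le hσ hp hφ (hv.trans_lt (hw k))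
      (fun θ x => (h1 θ x).trans (ENNReal.ofReal_le_ofReal (Real.exp_le_exp.2 ?_))) L hn hK
    have := (hw k).le
    gcongr
  · refine Monotone.directed_le fun k k' hkk => ?_
    rintro d ⟨j, hj, hc, hd⟩
    refine ⟨j, hj, hc, le_trans (Real.sqrt_le_sqrt ?_) hd⟩
    have : w k' ≤ w k := by
      have : (k : ℝ) ≤ k' := by exact_mod_cast hkk
      simp only [w]
      gcongr
    gcongr

lemma lintegral_exp_noise_le {τ : ℝ≥0} (hν : ∀ y, HasSubgaussianMGF id (τ ^ 2) (ν y))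
    (y : S × A) (x : ℝ) :
    ∫⁻ ξ, ENNReal.ofReal (Real.exp (x * ξ)) ∂ν y ≤
      ENNReal.ofReal (Real.exp ((τ : ℝ) ^ 2 * x ^ 2 / 2)) := by
  have h := hν y
  have hi : Integrable (fun ξ => Real.exp (x * ξ)) (ν y) := h.integrable_exp_mul x
  rw [← ofReal_integral_eq_lintegral_ofReal hi
    (Filter.Eventually.of_forall fun _ => (Real.exp_pos _).le)]
  refine ENNReal.ofReal_le_ofReal ((h.mgf_le x).trans_eq ?_)
  simp

lemma lintegral_exp_reward_le {τ : ℝ≥0} (hν : ∀ y, HasSubgaussianMGF id (τ ^ 2) (ν y))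
    (θ : Mode S A) (s : S) (a : A) {e : ℝ} (he : e ^ 2 = 1) (x : ℝ) :
    ∫⁻ z, ∫⁻ _s', ENNReal.ofReal (Real.exp (x * (e * (z.1 - M.R s a)))) ∂(M.P s a).toMeasure
      ∂attackChannel M ν (θ, (s, a)) ≤ ENNReal.ofReal (Real.exp ((τ : ℝ) ^ 2 * x ^ 2 / 2)) := by
  simp only [lintegral_const, measure_univ, mul_one]
  rw [lintegral_attackChannel _ _ _ _ (by fun_prop)]
  simp only [lintegral_const, measure_univ, mul_one, add_sub_cancel_left, ← mul_assoc]
  refine (lintegral_exp_noise_le hν (s, a) (x * e)).trans_eq ?_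
  rw [mul_pow, he, mul_one]

/-- Hoeffding's lemma on an interval of length `2` has variance proxy `1`. -/
lemma lintegral_exp_trans_le (θ : Mode S A) (s : S) (a : A) {f : S → ℝ}
    (hf : ∀ s, f s ∈ Set.Icc (-1 : ℝ) 1) (x : ℝ) :
    ∫⁻ _z, ∫⁻ s', ENNReal.ofReal (Real.exp (x * (f s' - ∑ s'', (M.P s a s'').toReal * f s'')))
      ∂(M.P s a).toMeasure ∂attackChannel M ν (θ, (s, a)) ≤
      ENNReal.ofReal (Real.exp (1 * x ^ 2 / 2)) := by
  simp only [lintegral_const, measure_univ, mul_one]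
  have hfm : Measurable f := measurable_of_countable f
  have h := hasSubgaussianMGF_of_mem_Icc (μ := (M.P s a).toMeasure) hfm.aemeasurable
    (Filter.Eventually.of_forall hf)
  have hint : ∫ s', f s' ∂(M.P s a).toMeasure = ∑ s'', (M.P s a s'').toReal * f s'' := by
    rw [PMF.integral_eq_sum]
    rfl
  rw [hint] at h
  rw [← ofReal_integral_eq_lintegral_ofReal (h.integrable_exp_mul x)
    (Filter.Eventually.of_forall fun _ => (Real.exp_pos _).le)]
  refine ENNReal.ofReal_le_ofReal ((h.mgf_le x).trans_eq ?_)
  congr 2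
  norm_num

/-- With `f` the sign pattern of `Phat - P`, the right side is the count times the `ℓ¹` error, which
becomes a centred sum. -/
lemma sum_visits_trans {L : ℕ} (d : Fin L → Fin T → Rec S A) (j : ℕ) (s : S) (a : A)
    (f : S → ℝ) (hn : (visits d j s a).card ≠ 0) :
    ∑ y ∈ visits d j s a, (f (d y.1 y.2).2.2 - ∑ s'', (M.P s a s'').toReal * f s'') =
      (visits d j s a).card *
        ∑ s', f s' * ((statsOf d j).Phat s a s' - (M.P s a s').toReal) := by
  have hn' : ((visits d j s a).card : ℝ) ≠ 0 := by exact_mod_cast hn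
  have h1 : ∑ y ∈ visits d j s a, f (d y.1 y.2).2.2 =
      ∑ s', f s' * ((visits d j s a).filter fun x => (d x.1 x.2).2.2 = s').card := by
    rw [← Finset.sum_fiberwise (s := visits d j s a) (g := fun x => (d x.1 x.2).2.2)]
    refine Finset.sum_congr rfl fun s' _ => ?_
    rw [Finset.sum_congr rfl (g := fun _ => f s') fun x hx => by
      rw [(Finset.mem_filter.1 hx).2], Finset.sum_const, nsmul_eq_mul, mul_comm]
  rw [Finset.sum_sub_distrib, h1, Finset.sum_const, nsmul_eq_mul]
  simp only [statsOf, mul_sub, Finset.sum_sub_distrib, Finset.mul_sum]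
  congr 1
  · refine Finset.sum_congr rfl fun s' _ => ?_
    field_simp
  · exact Finset.sum_congr rfl fun s' _ => by ring

/-- The confidence intervals of a pair fail at its `n`-th visit with small probability. -/
lemma attackLaw_conf_fail_le {τ : ℝ≥0} (hσ : σ = τ) (hp : p ∈ Set.Ioo (0 : ℝ) 1)
    (hν : ∀ y, HasSubgaussianMGF id (τ ^ 2) (ν y)) (L : ℕ) (s : S) (a : A) {n : ℕ} (hn : 0 < n) :
    attackLaw M ν σ p m ε πT ℓ L {d | ∃ j ≤ L, (statsOf d j).N s a = n ∧
      ¬ (|M.R s a - (statsOf d j).Rhat s a| ≤ uConf S A σ p n / √n ∧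
        ∑ s' : S, |(M.P s a s').toReal - (statsOf d j).Phat s a s'| ≤ wConf S A p n / √n)} ≤
      ENNReal.ofReal (p / (Fintype.card S * Fintype.card A * (n * (n + 1)))) := by
  have hp0 := hp.1
  have hσ0 : 0 ≤ σ := hσ ▸ τ.2
  have hn' : (0 : ℝ) < n := by exact_mod_cast hn
  have hn1 : (1 : ℝ) ≤ n := by exact_mod_cast hn
  have hS : (0 : ℝ) < Fintype.card S := by exact_mod_cast Fintype.card_pos (α := S)
  have hA : (0 : ℝ) < Fintype.card A := by exact_mod_cast Fintype.card_pos (α := A)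
  set Ku := Real.log (4 * Fintype.card S * Fintype.card A * (n * (n + 1)) / p) with hKu
  set Kw := Real.log (2 ^ Fintype.card S * (2 * Fintype.card S * Fintype.card A *
    (n * (n + 1))) / p) with hKw
  have hc1 : 1 ≤ (n : ℝ) * (n + 1) := by nlinarith
  have hKu0 : 0 ≤ Ku := by
    refine Real.log_nonneg ?_
    have := eight_le_uConst S A hp
    rw [mul_div_right_comm]
    nlinarith
  have hKw0 : 0 ≤ Kw := by
    refine Real.log_nonneg ?_
    have := eight_le_wConst S A hp
    rw [← mul_assoc, mul_div_right_comm]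
    nlinarith
  let ER : ℝ → Set (Fin L → Fin T → Rec S A) := fun e =>
    {d | ∃ j ≤ L, (visits d j s a).card = n ∧ √((τ : ℝ) ^ 2 * (2 * Ku * n)) <
      ∑ y ∈ visits d j s a, e * ((d y.1 y.2).2.1.1 - M.R s a)}
  let sg : (S → Bool) → S → ℝ := fun b s' => if b s' = true then 1 else -1
  let EP : (S → Bool) → Set (Fin L → Fin T → Rec S A) := fun b =>
    {d | ∃ j ≤ L, (visits d j s a).card = n ∧ √(1 * (2 * Kw * n)) <
      ∑ y ∈ visits d j s a, (sg b (d y.1 y.2).2.2 - ∑ s'', (M.P s a s'').toReal * sg b s'')}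
  have hER : ∀ e : ℝ, e ^ 2 = 1 → attackLaw M ν σ p m ε πT ℓ L (ER e) ≤
      ENNReal.ofReal (Real.exp (-Ku)) := fun e he =>
    attackLaw_sum_gt_le hσ0 hp (φ := fun r => e * (r.2.1.1 - M.R s a)) (by fun_prop)
      (by positivity) (fun θ x => lintegral_exp_reward_le hν θ s a he x) L hn hKu0
  have hEP : ∀ b, attackLaw M ν σ p m ε πT ℓ L (EP b) ≤ ENNReal.ofReal (Real.exp (-Kw)) :=
    fun b => attackLaw_sum_gt_le hσ0 hp
      (φ := fun r => sg b r.2.2 - ∑ s'', (M.P s a s'').toReal * sg b s'')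
      ((((measurable_of_countable (sg b)).comp (measurable_snd.comp measurable_snd))).sub_const _)
      zero_le_one (fun θ x => lintegral_exp_trans_le θ s a (fun s' => by
        simp only [sg]
        split_ifs <;> norm_num) x) L hn hKw0
  have hsub : {d : Fin L → Fin T → Rec S A | ∃ j ≤ L, (statsOf d j).N s a = n ∧
      ¬ (|M.R s a - (statsOf d j).Rhat s a| ≤ uConf S A σ p n / √n ∧
        ∑ s' : S, |(M.P s a s').toReal - (statsOf d j).Phat s a s'| ≤ wConf S A p n / √n)} ⊆
      (ER 1 ∪ ER (-1)) ∪ ⋃ b, EP b := by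
    rintro d ⟨j, hj, hN, hbad⟩
    by_contra hd
    simp only [Set.mem_union, Set.mem_iUnion, not_or, not_exists] at hd
    obtain ⟨⟨hd1, hd2⟩, hd3⟩ := hd
    have hN' : (visits d j s a).card = n := hN
    refine hbad ⟨?_, ?_⟩
    · have r1 := not_lt.1 fun h => hd1 ⟨j, hj, hN', h⟩
      have r2 := not_lt.1 fun h => hd2 ⟨j, hj, hN', h⟩
      rw [← Finset.mul_sum, Finset.sum_sub_distrib, Finset.sum_const, hN', nsmul_eq_mul] at r1 r2
      have e1 : (statsOf d j).Rhat s a = (∑ y ∈ visits d j s a, (d y.1 y.2).2.1.1) / n := by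
        simp only [statsOf, hN']
      have e2 : √((τ : ℝ) ^ 2 * (2 * Ku * n)) = uConf S A σ p n * √n := by
        rw [uConf, ← hKu, hσ, Real.sqrt_mul (by positivity), Real.sqrt_sq (NNReal.coe_nonneg τ),
          Real.sqrt_mul (by positivity), mul_assoc]
      rw [e2] at r1 r2
      have e3 : uConf S A σ p n / √n = uConf S A σ p n * √n / n := by
        rw [div_eq_div_iff (by positivity) (by positivity), mul_assoc,
          Real.mul_self_sqrt (by positivity)]
      rw [e1, e3, abs_le]
      constructor
      · rw [neg_le, neg_sub, sub_le_iff_le_add, div_add' _ _ _ hn'.ne']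
        exact div_le_div_of_nonneg_right (by linarith) hn'.le
      · rw [sub_le_iff_le_add, ← add_div, le_div_iff₀ hn']
        linarith
    -- The sign vector depends on the data, which is why the union over all `2 ^ S` of them is
    -- excluded.
    · set b : S → Bool := fun s' =>
        decide (0 ≤ (statsOf d j).Phat s a s' - (M.P s a s').toReal) with hb
      have r1 := not_lt.1 fun h => hd3 b ⟨j, hj, hN', h⟩
      rw [sum_visits_trans d j s a (sg b) (by omega), hN', one_mul] at r1
      have e1 : ∑ s' : S, |(M.P s a s').toReal - (statsOf d j).Phat s a s'| =
          ∑ s', sg b s' * ((statsOf d j).Phat s a s' - (M.P s a s').toReal) := by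
        refine Finset.sum_congr rfl fun s' _ => ?_
        rw [abs_sub_comm]
        by_cases h : 0 ≤ (statsOf d j).Phat s a s' - (M.P s a s').toReal
        · simp only [sg, hb, h, decide_true, if_true, one_mul, abs_of_nonneg h]
        · simp only [sg, hb, h, decide_false, abs_of_neg (not_le.1 h)]
          simp
      have e2 : √(2 * Kw * n) = wConf S A p n * √n := by
        rw [wConf, ← hKw, Real.sqrt_mul (by positivity)]
      rw [e1, le_div_iff₀ (by positivity)]
      rw [e2] at r1
      have h3 : √(n : ℝ) * √n = n := Real.mul_self_sqrt hn'.le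
      refine le_of_mul_le_mul_right ?_ (show 0 < √(n : ℝ) by positivity)
      rw [mul_assoc, h3, mul_comm]
      exact r1
  refine (measure_mono hsub).trans ((measure_union_le _ _).trans ?_)
  have hU : attackLaw M ν σ p m ε πT ℓ L (⋃ b, EP b) ≤
      ENNReal.ofReal (2 ^ Fintype.card S * Real.exp (-Kw)) := by
    refine (measure_iUnion_fintype_le _ _).trans ((Finset.sum_le_sum fun b _ => hEP b).trans_eq ?_)
    rw [Finset.sum_const, Finset.card_univ, Fintype.card_fun, Fintype.card_bool, nsmul_eq_mul,
      ENNReal.ofReal_mul (by positivity)]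
    norm_num
  refine (add_le_add ((measure_union_le _ _).trans (add_le_add (hER 1 (by norm_num))
    (hER (-1) (by norm_num)))) hU).trans ?_
  rw [← ENNReal.ofReal_add (Real.exp_pos _).le (Real.exp_pos _).le,
    ← ENNReal.ofReal_add (by positivity) (by positivity)]
  refine ENNReal.ofReal_le_ofReal (le_of_eq ?_)
  -- The two signs of the reward error and the `2 ^ S` sign vectors contribute `p / (2SA n(n + 1))`
  -- each.
  rw [Real.exp_neg, Real.exp_neg, hKu, hKw, Real.exp_log (by positivity),
    Real.exp_log (by positivity)]
  field_simp
  norm_num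

lemma sum_range_inv_mul_succ_le (n : ℕ) :
    ∑ k ∈ Finset.range n, 1 / (((k + 1 : ℕ) : ℝ) * ((k + 1 : ℕ) + 1)) ≤ 1 := by
  have h : ∑ k ∈ Finset.range n, 1 / (((k + 1 : ℕ) : ℝ) * ((k + 1 : ℕ) + 1)) =
      1 - 1 / ((n : ℝ) + 1) := by
    induction n with
    | zero => simp
    | succ n ih =>
      rw [Finset.sum_range_succ, ih]
      push_cast
      field_simp
      ring
  rw [h]
  have : 0 ≤ 1 / ((n : ℝ) + 1) := by positivity
  linarith

/-- The true model is in all confidence sets with probability at least `1 - p`. -/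
lemma attackLaw_notMem_confSet_le {τ : ℝ≥0} (hσ : σ = τ) (hp : p ∈ Set.Ioo (0 : ℝ) 1)
    (hν : ∀ y, HasSubgaussianMGF id (τ ^ 2) (ν y)) (L : ℕ) :
    attackLaw M ν σ p m ε πT ℓ L {d | ∃ j ≤ L, (M.R, M.P) ∉ (statsOf d j).confSet σ p} ≤
      ENNReal.ofReal p := by
  have hp0 := hp.1
  have hS : (0 : ℝ) < Fintype.card S := by exact_mod_cast Fintype.card_pos (α := S)
  have hA : (0 : ℝ) < Fintype.card A := by exact_mod_cast Fintype.card_pos (α := A)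
  let E : S × A → ℕ → Set (Fin L → Fin T → Rec S A) := fun y n =>
    {d | ∃ j ≤ L, (statsOf d j).N y.1 y.2 = n ∧
      ¬ (|M.R y.1 y.2 - (statsOf d j).Rhat y.1 y.2| ≤ uConf S A σ p n / √n ∧
        ∑ s' : S, |(M.P y.1 y.2 s').toReal - (statsOf d j).Phat y.1 y.2 s'| ≤
          wConf S A p n / √n)}
  have hsub : {d : Fin L → Fin T → Rec S A | ∃ j ≤ L, (M.R, M.P) ∉ (statsOf d j).confSet σ p} ⊆
      ⋃ y : S × A, ⋃ k ∈ Finset.range (L * T), E y (k + 1) := by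
    rintro d ⟨j, hj, hd⟩
    simp only [Stats.confSet, Set.mem_ofPred_eq, not_forall] at hd
    obtain ⟨s, a, hN, hd⟩ := hd
    have hle : (statsOf d j).N s a ≤ L * T := by
      refine (Finset.card_filter_le _ _).trans_eq ?_
      simp
    -- Counts start at one, so the range is shifted. The union runs over counts and not over
    -- learners, since each event already covers all `j`.
    refine Set.mem_iUnion.2 ⟨(s, a), Set.mem_iUnion₂.2 ⟨(statsOf d j).N s a - 1, ?_, ?_⟩⟩
    · exact Finset.mem_range.2 (by omega)
    · rw [Nat.sub_add_cancel (Nat.one_le_iff_ne_zero.2 hN)]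
      exact ⟨j, hj, rfl, hd⟩
  refine (measure_mono hsub).trans ((measure_iUnion_fintype_le _ _).trans ?_)
  calc _ ≤ ∑ _y : S × A, ENNReal.ofReal (p / (Fintype.card S * Fintype.card A)) := by
        refine Finset.sum_le_sum fun y _ => (measure_biUnion_finset_le _ _).trans ?_
        refine (Finset.sum_le_sum fun k _ =>
          attackLaw_conf_fail_le hσ hp hν L y.1 y.2 (Nat.succ_pos k)).trans ?_
        rw [← ENNReal.ofReal_sum_of_nonneg fun k _ => by positivity]
        refine ENNReal.ofReal_le_ofReal ?_
        calc _ = p / (Fintype.card S * Fintype.card A) * ∑ k ∈ Finset.range (L * T),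
              1 / (((k + 1 : ℕ) : ℝ) * ((k + 1 : ℕ) + 1)) := by
              rw [Finset.mul_sum]
              refine Finset.sum_congr rfl fun k _ => ?_
              rw [div_mul_div_comm, mul_one]
          _ ≤ _ := mul_le_of_le_one_right (by positivity) (sum_range_inv_mul_succ_le _)
    _ = _ := by
        rw [Finset.sum_const, Finset.card_univ, Fintype.card_prod, nsmul_eq_mul,
          ← ENNReal.ofReal_natCast, ← ENNReal.ofReal_mul (by positivity)]
        congr 1
        push_cast
        field_simp

end confidence

end RewardPoisoning

namespace RewardPoisoning

/-! ## Exceptional events of the attack -/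

/-! ### Sub-Gaussian tails -/

section tail

variable {Ω : Type*} [MeasurableSpace Ω]

/-- Chernoff's bound with exponent `√(2K / v)`: Markov's inequality at level `exp(2K)` meets a
moment of at most `exp K`. -/
lemma measure_sqrt_le_le {μ : Measure Ω} {X : Ω → ℝ} (hX : Measurable X) {v : ℝ} (hv : 0 < v)
    (h1 : ∀ x : ℝ, ∫⁻ ω, ENNReal.ofReal (Real.exp (x * X ω)) ∂μ ≤
      ENNReal.ofReal (Real.exp (v * x ^ 2 / 2))) {K : ℝ} (hK : 0 ≤ K) :
    μ {ω | √(v * (2 * K)) ≤ X ω} ≤ ENNReal.ofReal (Real.exp (-K)) := by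
  set x := √(2 * K / v) with hx
  have hx0 : 0 ≤ x := Real.sqrt_nonneg _
  have hxsq : x ^ 2 = 2 * K / v := Real.sq_sqrt (by positivity)
  have hxa : x * √(v * (2 * K)) = 2 * K := by
    rw [hx, ← Real.sqrt_mul (by positivity),
      show 2 * K / v * (v * (2 * K)) = (2 * K) ^ 2 by field_simp, Real.sqrt_sq (by positivity)]
  have hm := mul_meas_ge_le_lintegral (μ := μ)
    (f := fun ω => ENNReal.ofReal (Real.exp (x * X ω))) (by fun_prop)
    (ENNReal.ofReal (Real.exp (2 * K)))
  have h2 : μ {ω | √(v * (2 * K)) ≤ X ω} ≤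
      μ {ω | ENNReal.ofReal (Real.exp (2 * K)) ≤ ENNReal.ofReal (Real.exp (x * X ω))} := by
    refine measure_mono fun ω hω => ENNReal.ofReal_le_ofReal (Real.exp_le_exp.2 ?_)
    rw [← hxa]
    exact mul_le_mul_of_nonneg_left hω hx0
  have h3 : v * x ^ 2 / 2 = K := by
    rw [hxsq]
    field_simp
  have h4 := (mul_le_mul' le_rfl h2).trans (hm.trans (h1 x))
  rw [h3] at h4
  rw [Real.exp_neg, ENNReal.ofReal_inv_of_pos (Real.exp_pos _), ENNReal.le_inv_iff_mul_le]
  rw [show Real.exp (2 * K) = Real.exp K * Real.exp K by rw [two_mul, Real.exp_add],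
    ENNReal.ofReal_mul (Real.exp_pos _).le, mul_assoc] at h4
  have h5 : ENNReal.ofReal (Real.exp K) ≠ 0 := by simp [Real.exp_pos]
  rw [mul_comm]
  refine (ENNReal.mul_le_mul_iff_right h5 ENNReal.ofReal_ne_top).1 ?_
  rwa [mul_one]

/-- Tail bound for sub-Gaussian variables, valid also for variance proxy `0`. -/
lemma measure_sqrt_lt_le {μ : Measure Ω} {X : Ω → ℝ} (hX : Measurable X) {v : ℝ} (hv : 0 ≤ v)
    (h1 : ∀ x : ℝ, ∫⁻ ω, ENNReal.ofReal (Real.exp (x * X ω)) ∂μ ≤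
      ENNReal.ofReal (Real.exp (v * x ^ 2 / 2))) {K : ℝ} (hK : 0 ≤ K) :
    μ {ω | √(v * (2 * K)) < X ω} ≤ ENNReal.ofReal (Real.exp (-K)) := by
  let w : ℕ → ℝ := fun k => v + 1 / ((k : ℝ) + 1)
  have hw : ∀ k, v < w k := fun k => lt_add_of_pos_right v (by positivity)
  have hsub : {ω | √(v * (2 * K)) < X ω} ⊆ ⋃ k : ℕ, {ω | √(w k * (2 * K)) ≤ X ω} := by
    intro ω hω
    have hlim : Filter.Tendsto (fun k => √(w k * (2 * K))) Filter.atTop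
        (nhds (√(v * (2 * K)))) := by
      have := ((tendsto_one_div_add_atTop_nhds_zero_nat (𝕜 := ℝ)).const_add v).mul_const (2 * K)
      rw [add_zero] at this
      exact this.sqrt
    obtain ⟨k, hk⟩ := (hlim.eventually (gt_mem_nhds hω)).exists
    exact Set.mem_iUnion.2 ⟨k, hk.le⟩
  refine (measure_mono hsub).trans ?_
  rw [Directed.measure_iUnion]
  · refine iSup_le fun k => measure_sqrt_le_le hX (hv.trans_lt (hw k))
      (fun x => (h1 x).trans (ENNReal.ofReal_le_ofReal (Real.exp_le_exp.2 ?_))) hK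
    have := (hw k).le
    gcongr
  · refine Monotone.directed_le fun k k' hkk ω hω => le_trans (Real.sqrt_le_sqrt ?_) hω
    have : w k' ≤ w k := by
      have : (k : ℝ) ≤ k' := by exact_mod_cast hkk
      simp only [w]
      gcongr
    gcongr

end tail

section events

variable {S A : Type*} [MeasurableSpace S] [MeasurableSpace A]
  [Fintype S] [MeasurableSingletonClass S] [Fintype A] [MeasurableSingletonClass A] {T : ℕ}
  [DecidableEq S] [DecidableEq A] [Nonempty S] [Nontrivial A]
  {M : MDP S A} {ν : Kernel (S × A) ℝ} [IsMarkovKernel ν] {σ p m ε : ℝ} {πT : S → A}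
  {ℓ : ℕ → Learner S A T}

/-! ### Large noise during the exploration phase -/

lemma noise_tail_le {τ : ℝ≥0} (hν : ∀ y, HasSubgaussianMGF id (τ ^ 2) (ν y)) (y : S × A)
    {K : ℝ} (hK : 0 ≤ K) :
    ν y {ξ | τ * √(2 * K) < |ξ|} ≤ ENNReal.ofReal (2 * Real.exp (-K)) := by
  have e : (τ : ℝ) * √(2 * K) = √((τ : ℝ) ^ 2 * (2 * K)) := by
    rw [Real.sqrt_mul (show (0 : ℝ) ≤ (τ : ℝ) ^ 2 by positivity),
      Real.sqrt_sq (NNReal.coe_nonneg τ)]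
  have hsub : {ξ : ℝ | τ * √(2 * K) < |ξ|} ⊆ {ξ | √((τ : ℝ) ^ 2 * (2 * K)) < ξ} ∪
      {ξ | √((τ : ℝ) ^ 2 * (2 * K)) < -ξ} := by
    intro ξ hξ
    have hξ' : τ * √(2 * K) < |ξ| := hξ
    rw [e] at hξ'
    exact lt_abs.1 hξ'
  refine (measure_mono hsub).trans ((measure_union_le _ _).trans ?_)
  rw [show 2 * Real.exp (-K) = Real.exp (-K) + Real.exp (-K) from two_mul _,
    ENNReal.ofReal_add (Real.exp_pos _).le (Real.exp_pos _).le]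
  refine add_le_add (measure_sqrt_lt_le measurable_id (by positivity)
    (lintegral_exp_noise_le hν y) hK) (measure_sqrt_lt_le measurable_neg (by positivity)
    (fun x => ?_) hK)
  refine Eq.trans_le ?_ ((lintegral_exp_noise_le hν y (-x)).trans_eq ?_)
  · simp only [neg_mul, mul_neg]
  · rw [neg_sq]

lemma run_noise_le {τ : ℝ≥0} (hν : ∀ y, HasSubgaussianMGF id (τ ^ 2) (ν y))
    (l : Learner S A T) (θ : Mode S A) {K : ℝ} (hK : 0 ≤ K) :
    run M (attackChannel M ν) l T θ {h | ∃ t, τ * √(2 * K) <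
      |(h.1 t).2.1.1 - M.R (h.1 t).1.1 (h.1 t).1.2|} ≤
      T * ENNReal.ofReal (2 * Real.exp (-K)) := by
  have hR : Measurable fun x : Rec S A => M.R x.1.1 x.1.2 :=
    (measurable_of_countable fun y : S × A => M.R y.1 y.2).comp measurable_fst
  have hB : MeasurableSet {x : Rec S A | τ * √(2 * K) < |x.2.1.1 - M.R x.1.1 x.1.2|} :=
    measurableSet_lt measurable_const (by
      have : Measurable fun x : Rec S A => x.2.1.1 - M.R x.1.1 x.1.2 :=
        Measurable.sub (by fun_prop) hR
      exact continuous_abs.measurable.comp this)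
  refine run_exists_le M (attackChannel M ν) l hB θ (fun s a => ?_) T
  have e : ∀ z : ℝ × ℝ, ∫⁻ s', {x : Rec S A | τ * √(2 * K) <
      |x.2.1.1 - M.R x.1.1 x.1.2|}.indicator 1 ((s, a), z, s') ∂(M.P s a).toMeasure =
      {ξ : ℝ | τ * √(2 * K) < |ξ|}.indicator 1 (z.1 - M.R s a) := fun z => by
    have : ∀ s' : S, ({x : Rec S A | τ * √(2 * K) < |x.2.1.1 - M.R x.1.1 x.1.2|}.indicator 1
        ((s, a), z, s') : ℝ≥0∞) =
        {ξ : ℝ | τ * √(2 * K) < |ξ|}.indicator 1 (z.1 - M.R s a) := fun s' => rfl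
    simp only [this, lintegral_const, measure_univ, mul_one]
  have hA : MeasurableSet {ξ : ℝ | τ * √(2 * K) < |ξ|} :=
    measurableSet_lt measurable_const continuous_abs.measurable
  have hm : Measurable fun z : ℝ × ℝ =>
      ({ξ : ℝ | τ * √(2 * K) < |ξ|}.indicator 1 (z.1 - M.R s a) : ℝ≥0∞) :=
    (measurable_one.indicator hA).comp (f := fun z : ℝ × ℝ => z.1 - M.R s a) (by fun_prop)
  simp only [e]
  rw [lintegral_attackChannel _ _ _ _ hm]
  simp only [add_sub_cancel_left, lintegral_const, measure_univ, mul_one]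
  rw [lintegral_indicator_one hA]
  exact noise_tail_le hν (s, a) hK

/-- The level makes the failure probability `p / k` per learner. Only the first `k` learners matter,
because the cost of an attack step does not involve the noise. -/
lemma attackLaw_noise_le {τ : ℝ≥0} (hσ : σ = τ) (hp : p ∈ Set.Ioo (0 : ℝ) 1)
    (hν : ∀ y, HasSubgaussianMGF id (τ ^ 2) (ν y)) {k : ℕ} (hk : 1 ≤ k) (hT : 1 ≤ T) (L : ℕ) :
    attackLaw M ν σ p m ε πT ℓ L {d | ∃ l, ∃ h : l < L, l < k ∧
      ∃ t, τ * √(2 * Real.log (2 * k * T / p)) <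
        |(d ⟨l, h⟩ t).2.1.1 - M.R (d ⟨l, h⟩ t).1.1 (d ⟨l, h⟩ t).1.2|} ≤ ENNReal.ofReal p := by
  have hp0 := hp.1
  have hk' : (1 : ℝ) ≤ k := by exact_mod_cast hk
  have hT' : (1 : ℝ) ≤ T := by exact_mod_cast hT
  have hσ0 : 0 ≤ σ := hσ ▸ τ.2
  have hK : 0 ≤ Real.log (2 * k * T / p) := by
    refine Real.log_nonneg ?_
    rw [le_div_iff₀ hp0]
    nlinarith [hp.2, mul_le_mul hk' hT' zero_le_one (by linarith)]
  have hR : Measurable fun x : Rec S A => M.R x.1.1 x.1.2 :=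
    (measurable_of_countable fun y : S × A => M.R y.1 y.2).comp measurable_fst
  have hB : MeasurableSet {x : Rec S A | τ * √(2 * Real.log (2 * k * T / p)) <
      |x.2.1.1 - M.R x.1.1 x.1.2|} :=
    measurableSet_lt measurable_const (by
      have : Measurable fun x : Rec S A => x.2.1.1 - M.R x.1.1 x.1.2 :=
        Measurable.sub (by fun_prop) hR
      exact continuous_abs.measurable.comp this)
  refine (attackLaw_union_le (M := M) (ν := ν) (m := m) (ε := ε) (πT := πT) (ℓ := ℓ) hσ0 hp
    (B := fun l => {x | l < k ∧ ∃ t, x.2 t ∈ {x : Rec S A |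
      τ * √(2 * Real.log (2 * k * T / p)) < |x.2.1.1 - M.R x.1.1 x.1.2|}})
    (δ := fun l => if l < k then ENNReal.ofReal (p / k) else 0) (fun l => ?_) L
    (fun l _ d => ?_)).trans ?_
  · have : {x : (Fin l → Fin T → Rec S A) × (Fin T → Rec S A) | l < k ∧ ∃ t, x.2 t ∈
        {x : Rec S A | τ * √(2 * Real.log (2 * k * T / p)) < |x.2.1.1 - M.R x.1.1 x.1.2|}} =
        {_x | l < k} ∩ ⋃ t, {x | x.2 t ∈ {x : Rec S A |
          τ * √(2 * Real.log (2 * k * T / p)) < |x.2.1.1 - M.R x.1.1 x.1.2|}} := by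
      ext x
      simp
    rw [this]
    exact (MeasurableSet.const _).inter (MeasurableSet.iUnion fun t => hB.preimage (by fun_prop))
  · by_cases hl : l < k
    · simp only [hl, if_true, true_and]
      refine (run_noise_le hν (ℓ l) _ hK).trans ?_
      rw [Real.exp_neg, Real.exp_log (by positivity), ← ENNReal.ofReal_natCast,
        ← ENNReal.ofReal_mul (by positivity)]
      refine ENNReal.ofReal_le_ofReal (le_of_eq ?_)
      field_simp
    · simp [hl]
  · rw [← Finset.sum_filter, Finset.sum_const, nsmul_eq_mul, ← ENNReal.ofReal_natCast,
      ← ENNReal.ofReal_mul (by positivity)]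
    refine ENNReal.ofReal_le_ofReal ?_
    have hc : ((Finset.range L).filter fun l => l < k).card ≤ k := by
      calc _ ≤ (Finset.range k).card := Finset.card_le_card fun x hx => by
            simpa using (Finset.mem_filter.1 hx).2
        _ = k := Finset.card_range k
    have hc' : (((Finset.range L).filter fun l => l < k).card : ℝ) ≤ k := by exact_mod_cast hc
    rw [← mul_div_assoc, div_le_iff₀ (by positivity), mul_comm]
    exact mul_le_mul_of_nonneg_left hc' hp0.le

/-! ### Consistency of the shown rewards -/

/-- Records in which the shown reward is not the one the attacker's mode prescribes. -/
def inconsistent (θ : Mode S A) : Set (Rec S A) :=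
  {x | if θ.1 = true then 1 < |x.2.1.2| else x.2.1.2 ≠ x.2.1.1 - θ.2 x.1.1 x.1.2}

lemma measurable_modeEval :
    Measurable fun x : Mode S A × Rec S A => x.1.2 x.2.1.1 x.2.1.2 := by
  have h' : Measurable (Function.uncurry fun (y : S × A) (D : S → A → ℝ) => D y.1 y.2) :=
    measurable_from_prod_countable_right fun y => by
      simp only [Function.uncurry_apply_pair]
      fun_prop
  exact h'.comp (g := Function.uncurry fun (y : S × A) (D : S → A → ℝ) => D y.1 y.2)
    (f := fun x : Mode S A × Rec S A => (x.2.1, x.1.2)) (by fun_prop)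

lemma measurableSet_inconsistent :
    MeasurableSet {x : Mode S A × Rec S A | x.2 ∈ inconsistent x.1} := by
  have h1 : MeasurableSet {x : Mode S A × Rec S A | x.1.1 = true} :=
    (measurableSet_singleton true).preimage (f := fun x : Mode S A × Rec S A => x.1.1)
      (by fun_prop)
  have h2 : MeasurableSet {x : Mode S A × Rec S A | 1 < |x.2.2.1.2|} :=
    measurableSet_lt measurable_const (continuous_abs.measurable.comp (by fun_prop))
  have h3 : MeasurableSet {x : Mode S A × Rec S A |
      x.2.2.1.2 = x.2.2.1.1 - x.1.2 x.2.1.1 x.2.1.2} :=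
    measurableSet_eq_fun (by fun_prop) (Measurable.sub (by fun_prop) measurable_modeEval)
  have e : {x : Mode S A × Rec S A | x.2 ∈ inconsistent x.1} =
      ({x | x.1.1 = true} ∩ {x | 1 < |x.2.2.1.2|}) ∪ ({x | x.1.1 = true}ᶜ ∩
        {x | x.2.2.1.2 = x.2.2.1.1 - x.1.2 x.2.1.1 x.2.1.2}ᶜ) := by
    ext x
    by_cases h : x.1.1 = true
    · simp [inconsistent, h]
    · simp [inconsistent, h]
  rw [e]
  exact (h1.inter h2).union (h1.compl.inter h3.compl)

/-- Trajectories record both rewards as free coordinates, so their relation holds only almost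
surely; this null event must be excluded before costs are estimated pointwise. -/
lemma run_inconsistent (l : Learner S A T) (θ : Mode S A) :
    run M (attackChannel M ν) l T θ {h | ∃ t, h.1 t ∈ inconsistent θ} = 0 := by
  have hB : MeasurableSet (inconsistent θ) :=
    measurableSet_inconsistent.preimage (f := fun x : Rec S A => (θ, x)) (by fun_prop)
  refine le_antisymm ?_ zero_le
  refine (run_exists_le M (attackChannel M ν) l hB θ (δ := 0) (fun s a => ?_) T).trans_eq
    (mul_zero _)
  have hi : Measurable ((inconsistent θ).indicator (1 : Rec S A → ℝ≥0∞)) :=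
    measurable_one.indicator hB
  have hm : Measurable fun z : ℝ × ℝ => ∫⁻ s', (inconsistent θ).indicator 1 ((s, a), z, s')
      ∂(M.P s a).toMeasure :=
    Measurable.lintegral_prod_right' (f := fun q : (ℝ × ℝ) × S =>
      ((inconsistent θ).indicator 1 ((s, a), q.1, q.2) : ℝ≥0∞)) (hi.comp (by fun_prop))
  rw [lintegral_attackChannel _ _ _ _ hm]
  refine le_of_eq ?_
  by_cases hθ : θ.1 = true
  · have hz : ∀ (r c : ℝ), |c| ≤ 1 → ∫⁻ s', (inconsistent θ).indicator (1 : Rec S A → ℝ≥0∞)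
        ((s, a), (r, c), s') ∂(M.P s a).toMeasure = 0 := fun r c hc => by
      have : ∀ s' : S, (inconsistent θ).indicator (1 : Rec S A → ℝ≥0∞) ((s, a), (r, c), s') = 0 :=
        fun s' => Set.indicator_of_notMem (by simp [inconsistent, hθ, hc]) _
      simp only [this, lintegral_zero]
    simp only [hθ, if_true]
    have : ∀ x : ℝ, ∫⁻ c, ∫⁻ s', (inconsistent θ).indicator (1 : Rec S A → ℝ≥0∞)
        ((s, a), (M.R s a + x, c), s') ∂(M.P s a).toMeasure ∂coin = 0 := fun x => by
      rw [lintegral_coin]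
      · rw [hz _ _ (by norm_num), hz _ _ (by norm_num)]
        simp
      · exact hm.comp (f := fun c : ℝ => (M.R s a + x, c)) (by fun_prop)
    simp only [this, lintegral_zero]
  · have : ∀ (x : ℝ) (s' : S), (inconsistent θ).indicator (1 : Rec S A → ℝ≥0∞)
        ((s, a), (M.R s a + x, M.R s a + x - θ.2 s a), s') = 0 :=
      fun x s' => Set.indicator_of_notMem (by simp [inconsistent, hθ]) _
    simp only [hθ, if_false, this, lintegral_zero, Bool.false_eq_true]

lemma attackLaw_inconsistent (hσ : 0 ≤ σ) (hp : p ∈ Set.Ioo (0 : ℝ) 1) (L : ℕ) :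
    attackLaw M ν σ p m ε πT ℓ L {d | ∃ l, ∃ h : l < L,
      ∃ t, d ⟨l, h⟩ t ∈ inconsistent (attackMode M σ p m ε πT (takeTraj h.le d))} = 0 := by
  refine le_antisymm ?_ zero_le
  refine (attackLaw_union_le (M := M) (ν := ν) (m := m) (ε := ε) (πT := πT) (ℓ := ℓ) hσ hp
    (B := fun l => {x | ∃ t, x.2 t ∈ inconsistent (attackMode M σ p m ε πT x.1)})
    (δ := fun _ => 0) (fun l => ?_) L (fun l _ d => (run_inconsistent (ℓ l) _).le)).trans_eq
    (by simp)
  rw [Set.ofPred_exists]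
  refine MeasurableSet.iUnion fun t => ?_
  exact measurableSet_inconsistent.preimage
    (f := fun x : (Fin l → Fin T → Rec S A) × (Fin T → Rec S A) =>
      (attackMode M σ p m ε πT x.1, x.2 t))
    (((measurable_attackMode M m ε πT hσ hp).comp measurable_fst).prodMk (by fun_prop))

/-! ### Deviations from the target policy in the attack phase -/

/-- Number of steps in which the target policy is not followed. -/
def offSteps (πT : S → A) (τ : Fin T → Rec S A) : ℕ :=
  (Finset.univ.filter fun t => (τ t).1.2 ≠ πT (τ t).1.1).card

/-- Reward reductions that make all deviations from the target policy suboptimal. -/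
def effective (M : MDP S A) (ε : ℝ) (πT : S → A) : Set (S → A → ℝ) :=
  {D | (∀ s, D s (πT s) = 0) ∧ ∀ s a, a ≠ πT s →
    M.Q πT s a - M.V πT s + ε / M.occ (Function.update πT s a) s ≤ D s a}

lemma measurableSet_effective : MeasurableSet (effective M ε πT) := by
  have e : effective M ε πT = (⋂ s, {D | D s (πT s) = 0}) ∩ ⋂ s, ⋂ a, ⋂ _ : a ≠ πT s,
      {D | M.Q πT s a - M.V πT s + ε / M.occ (Function.update πT s a) s ≤ D s a} := by
    ext D
    simp [effective]
  rw [e]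
  refine MeasurableSet.inter ?_ ?_
  · exact MeasurableSet.iInter fun s => measurableSet_eq_fun (by fun_prop) measurable_const
  · exact MeasurableSet.iInter fun s => MeasurableSet.iInter fun a => MeasurableSet.iInter fun _ =>
      measurableSet_le measurable_const (by fun_prop)

/-- Under attack the learner acts as in a clean run with means `R - D`. There each step off the
target is `ε`-suboptimal, so guarantee (ii) counts it. -/
lemma run_offSteps_le {l : Learner S A T} (hε : 0 < ε) (hocc : ∀ π s, 0 < M.occ π s)
    {δ b : ℝ} (hSub : HasSuboptBound M ν ε δ b l) {θ : Mode S A} (hθ : θ.1 = false)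
    (hD : θ.2 ∈ effective M ε πT) :
    run M (attackChannel M ν) l T θ {h | b < offSteps πT h.1} ≤ ENNReal.ofReal δ := by
  classical
  set R' : S → A → ℝ := fun s a => M.R s a - θ.2 s a with hR'
  set κ := noisyReward R' ν with hκ
  have : IsMarkovKernel (κ.map fun r => (r, r)) := Kernel.IsMarkovKernel.map _ (by fun_prop)
  set G : Set ((Fin T → Rec S A) × S) := {h | b < suboptSteps (M.withReward R') ε h.1} with hG
  have hGm : MeasurableSet G := by
    have e : (fun h : (Fin T → Rec S A) × S => (suboptSteps (M.withReward R') ε h.1 : ℝ)) =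
        fun h => ∑ t, if (M.withReward R').IsSubopt ε (h.1 t).1.1 (h.1 t).1.2 then 1 else 0 := by
      funext h
      simp [suboptSteps]
    refine measurableSet_lt measurable_const ?_
    rw [e]
    refine Finset.measurable_sum _ fun t _ => Measurable.ite ?_ measurable_const measurable_const
    exact (Set.to_countable {y : S × A | (M.withReward R').IsSubopt ε y.1 y.2}).measurableSet.preimage
      (f := fun h : (Fin T → Rec S A) × S => (h.1 t).1) (by fun_prop)
  have hsub : {h : (Fin T → Rec S A) × S | b < offSteps πT h.1} ⊆ G := by
    intro h hh
    have hh' : b < (offSteps πT h.1 : ℝ) := hh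
    refine lt_of_lt_of_le hh' (Nat.cast_le.2 ?_)
    unfold suboptSteps offSteps
    refine Finset.card_le_card fun t ht => ?_
    rw [Finset.mem_filter] at ht ⊢
    exact ⟨ht.1, M.isSubopt_withReward_sub hε hocc hD.1 hD.2 ht.2⟩
  refine (measure_mono hsub).trans ?_
  -- This is the change of measure with weight one. The event depends on the visited pairs alone,
  -- which relabelling preserves.
  have heq : cleanRun M κ l G = run M (attackChannel M ν) l T θ G := by
    rw [← lintegral_indicator_one hGm, cleanRun, lintegral_run_eq M (attackChannel M ν) _ l θ ()
      (D := fun _ => 1) measurable_const ?_ T (measurable_one.indicator hGm),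
      ← lintegral_indicator_one hGm]
    · refine lintegral_congr fun h => ?_
      rw [Finset.prod_const_one, one_mul]
      rfl
    · intro y f hf
      rw [Kernel.comap_apply, Kernel.lintegral_map _ (by fun_prop) _ hf, hκ,
        lintegral_noisyReward _ _ _ (by fun_prop), lintegral_attackChannel _ _ _ _ (by fun_prop)]
      refine lintegral_congr fun x => ?_
      simp only [hθ, Bool.false_eq_true, if_false, one_mul, lintegral_const, measure_univ, mul_one,
        hR']
      rw [show M.R y.1 y.2 - θ.2 y.1 y.2 + x = M.R y.1 y.2 + x - θ.2 y.1 y.2 by ring]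
  rw [← heq, ← ofReal_measureReal (measure_ne_top _ _)]
  refine ENNReal.ofReal_le_ofReal ?_
  have h1 := hSub R'
  have h2 : {h : (Fin T → Rec S A) × S | (suboptSteps (M.withReward R') ε h.1 : ℝ) ≤ b} = Gᶜ := by
    ext h
    simp [hG]
  rw [h2, probReal_compl_eq_one_sub hGm] at h1
  linarith

/-- Effectiveness of the mode is part of the event, so that the guarantee applies conditionally on
any past; outside that case the conditional probability is zero. -/
lemma attackLaw_offSteps_le (hσ : 0 ≤ σ) (hp : p ∈ Set.Ioo (0 : ℝ) 1) (hε : 0 < ε)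
    (hocc : ∀ π s, 0 < M.occ π s) {L : ℕ} (hL : 1 ≤ L) {b : ℝ}
    (hSub : ∀ l < L, HasSuboptBound M ν ε (p / L) b (ℓ l)) :
    attackLaw M ν σ p m ε πT ℓ L {d | ∃ l, ∃ h : l < L,
      (attackMode M σ p m ε πT (takeTraj h.le d)).1 = false ∧
      (attackMode M σ p m ε πT (takeTraj h.le d)).2 ∈ effective M ε πT ∧
      b < offSteps πT (d ⟨l, h⟩)} ≤ ENNReal.ofReal p := by
  have hoff : Measurable fun τ : Fin T → Rec S A => (offSteps πT τ : ℝ) := by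
    have e : (fun τ : Fin T → Rec S A => (offSteps πT τ : ℝ)) =
        fun τ => ∑ t, if (τ t).1.2 ≠ πT (τ t).1.1 then 1 else 0 := by
      funext h
      rw [offSteps, Finset.natCast_card_filter]
    rw [e]
    refine Finset.measurable_sum _ fun t _ => Measurable.ite ?_ measurable_const measurable_const
    exact (Set.to_countable {y : S × A | y.2 ≠ πT y.1}).measurableSet.preimage
      (f := fun τ : Fin T → Rec S A => (τ t).1) (by fun_prop)
  refine (attackLaw_union_le (M := M) (ν := ν) (m := m) (ε := ε) (πT := πT) (ℓ := ℓ) hσ hp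
    (B := fun l => {x | (attackMode M σ p m ε πT x.1).1 = false ∧
      (attackMode M σ p m ε πT x.1).2 ∈ effective M ε πT ∧ b < offSteps πT x.2})
    (δ := fun _ => ENNReal.ofReal (p / L)) (fun l => ?_) L (fun l hl d => ?_)).trans_eq ?_
  · have hmode : Measurable fun x : (Fin l → Fin T → Rec S A) × (Fin T → Rec S A) =>
        attackMode M σ p m ε πT x.1 := (measurable_attackMode M m ε πT hσ hp).comp measurable_fst
    have h1 : MeasurableSet {x : (Fin l → Fin T → Rec S A) × (Fin T → Rec S A) |
        (attackMode M σ p m ε πT x.1).1 = false} :=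
      (measurableSet_singleton false).preimage (measurable_fst.comp hmode)
    have h2 : MeasurableSet {x : (Fin l → Fin T → Rec S A) × (Fin T → Rec S A) |
        (attackMode M σ p m ε πT x.1).2 ∈ effective M ε πT} :=
      measurableSet_effective.preimage (measurable_snd.comp hmode)
    have h3 : MeasurableSet {x : (Fin l → Fin T → Rec S A) × (Fin T → Rec S A) |
        b < offSteps πT x.2} := measurableSet_lt measurable_const (hoff.comp measurable_snd)
    exact h1.inter (h2.inter h3)
  · by_cases h : (attackMode M σ p m ε πT d).1 = false ∧
      (attackMode M σ p m ε πT d).2 ∈ effective M ε πT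
    · refine le_trans (measure_mono fun x hx => hx.2.2)
        (run_offSteps_le hε hocc (hSub l hl) h.1 h.2)
    · refine le_trans (le_of_eq ?_) zero_le
      convert measure_empty (μ := run M (attackChannel M ν) (ℓ l) T (attackMode M σ p m ε πT d))
      ext x
      simp only [Set.mem_ofPred_eq, Set.mem_empty_iff_false, iff_false]
      exact fun hx => h ⟨hx.1, hx.2.1⟩
  · have hL' : (L : ℝ) ≠ 0 := by positivity
    rw [Finset.sum_const, Finset.card_range, nsmul_eq_mul, ← ENNReal.ofReal_natCast,
      ← ENNReal.ofReal_mul (by positivity), mul_div_cancel₀ _ hL']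

/-! ### Length of the exploration phase -/

/-- Trajectories in which every pair is visited often. -/
def goodTraj (M : MDP S A) (α β : ℝ) : Set (Fin T → Rec S A) :=
  {τ | ∀ s a, visitBound M α β ≤ stepVisits τ s a}

lemma measurableSet_goodTraj (M : MDP S A) (α β : ℝ) :
    MeasurableSet (goodTraj (T := T) M α β) := by
  have e : goodTraj (T := T) M α β =
      ⋂ s, ⋂ a, {τ | visitBound M α β ≤ stepVisits τ s a} := by
    ext τ
    simp [goodTraj]
  rw [e]
  refine MeasurableSet.iInter fun s => MeasurableSet.iInter fun a =>
    measurableSet_le measurable_const ?_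
  have : (fun τ : Fin T → Rec S A => (stepVisits τ s a : ℝ)) =
      fun τ => ∑ t, if (τ t).1 = (s, a) then (1 : ℝ) else 0 := by
    funext τ
    simp [stepVisits]
  rw [this]
  exact Finset.measurable_sum _ fun t _ => Measurable.ite
    ((measurableSet_singleton (s, a)).preimage (by fun_prop)) measurable_const measurable_const

open Classical in
/-- Few of the first `k` learners visit every pair often, although the attacker explores, with small
probability. -/
lemma attackLaw_few_good_le (hσ : 0 ≤ σ) (hp : p ∈ Set.Ioo (0 : ℝ) 1) {α β : ℝ} (hα : 0 < α)
    (hα' : α < M.occMin / (2 * √2)) (hβ : 0 < β)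
    (hβ' : β < 1 / (8 * Fintype.card S * Fintype.card A)) {L : ℕ}
    (hPAC : ∀ l < L, IsPAC M α β (ℓ l)) {k : ℕ} (hk : 8 * Real.log (1 / p) ≤ k) :
    attackLaw M ν σ p m ε πT ℓ L {d | ∃ h : k ≤ L,
      (∀ i : Fin k, (attackMode M σ p m ε πT (takeTraj (i.2.le.trans h) d)).1 = true) ∧
      4 * (Finset.univ.filter fun i : Fin k =>
        takeTraj h d i ∈ goodTraj M α β).card < k} ≤ ENNReal.ofReal p := by
  have hp0 := hp.1
  -- While exploring, the factor is `exp(3 / 8 - 1[good])`; under attack it is `1`, so the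
  -- supermartingale property needs no condition on the past.
  let q : Mode S A → (Fin T → Rec S A) → ℝ≥0∞ := fun θ τ =>
    if θ.1 = true then (if τ ∈ goodTraj M α β then ENNReal.ofReal (Real.exp (-(5 / 8)))
      else ENNReal.ofReal (Real.exp (3 / 8))) else 1
  have hqm : Measurable (Function.uncurry q) := by
    refine Measurable.ite ((measurableSet_singleton true).preimage
      (measurable_fst.comp measurable_fst)) (Measurable.ite
      ((measurableSet_goodTraj M α β).preimage measurable_snd) measurable_const measurable_const)
      measurable_const
  have hqmθ : ∀ θ, Measurable (q θ) := fun θ =>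
    hqm.comp (f := fun τ => (θ, τ)) (by fun_prop)
  have hq : ∀ l < L, ∀ θ : Mode S A,
      ∫⁻ h, q θ h.1 ∂run M (attackChannel M ν) (ℓ l) T θ ≤ 1 := by
    intro l hl θ
    by_cases hθ : θ.1 = true
    · have hbad := run_exists_few_visits_le ν hθ hα hα' hβ hβ' (hPAC l hl)
      set Bad : Set ((Fin T → Rec S A) × S) :=
        {h | ∃ s a, (stepVisits h.1 s a : ℝ) < visitBound M α β} with hBad
      have hBg : ∀ h : (Fin T → Rec S A) × S, h ∈ Bad ↔ h.1 ∉ goodTraj M α β := fun h => by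
        simp [hBad, goodTraj]
      have hBm : MeasurableSet Bad := by
        have : Bad = (Prod.fst ⁻¹' goodTraj M α β)ᶜ := by
          ext h
          rw [hBg]
          rfl
        rw [this]
        exact ((measurableSet_goodTraj M α β).preimage measurable_fst).compl
      have h58 : Real.exp (-(5 / 8)) ≤ Real.exp (3 / 8) := Real.exp_le_exp.2 (by norm_num)
      have e : ∀ h : (Fin T → Rec S A) × S, q θ h.1 = ENNReal.ofReal (Real.exp (-(5 / 8))) +
          Bad.indicator (fun _ => ENNReal.ofReal (Real.exp (3 / 8) - Real.exp (-(5 / 8)))) h := by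
        intro h
        by_cases hg : h.1 ∈ goodTraj M α β
        · rw [Set.indicator_of_notMem (by rw [hBg]; exact not_not.2 hg)]
          simp [q, hθ, hg]
        · rw [Set.indicator_of_mem ((hBg h).2 hg), ← ENNReal.ofReal_add (Real.exp_pos _).le
            (by linarith)]
          simp [q, hθ, hg]
      simp only [e]
      rw [lintegral_add_left measurable_const, lintegral_const, measure_univ, mul_one,
        lintegral_indicator_const hBm]
      calc _ ≤ ENNReal.ofReal (Real.exp (-(5 / 8))) +
            ENNReal.ofReal (Real.exp (3 / 8) - Real.exp (-(5 / 8))) * ENNReal.ofReal 2⁻¹ := by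
            rw [ENNReal.ofReal_inv_of_pos (by norm_num : (0 : ℝ) < 2), ENNReal.ofReal_ofNat]
            gcongr
        _ = ENNReal.ofReal ((Real.exp (-(5 / 8)) + Real.exp (3 / 8)) / 2) := by
            rw [← ENNReal.ofReal_mul (by linarith), ← ENNReal.ofReal_add (Real.exp_pos _).le
              (mul_nonneg (by linarith) (by norm_num))]
            congr 1
            ring
        _ ≤ ENNReal.ofReal 1 := by
            refine ENNReal.ofReal_le_ofReal ?_
            -- With success probability one half the mean is `exp(-1 / 8) cosh(1 / 2)`, which is at
            -- most one.
            have h := Real.cosh_le_exp_half_sq (1 / 2)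
            rw [Real.cosh_eq] at h
            have h2 := mul_le_mul_of_nonneg_right h (Real.exp_pos (-(1 / 8))).le
            rw [← Real.exp_add, div_mul_eq_mul_div, add_mul, ← Real.exp_add, ← Real.exp_add] at h2
            norm_num at h2 ⊢
            linarith
        _ = 1 := ENNReal.ofReal_one
    · simp [q, hθ]
  let V : (l : ℕ) → (Fin l → Fin T → Rec S A) → ℝ≥0∞ := fun l d =>
    ∏ i : Fin l, q (attackMode M σ p m ε πT (takeTraj i.2.le d)) (d i)
  have hVm : ∀ l, Measurable (V l) := fun l => Finset.measurable_prod _ fun i _ =>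
    hqm.comp (f := fun d : Fin l → Fin T → Rec S A =>
      (attackMode M σ p m ε πT (takeTraj i.2.le d), d i))
      (((measurable_attackMode M m ε πT hσ hp).comp (measurable_takeTraj _)).prodMk
        (measurable_pi_apply i))
  have hV : ∀ l < L, ∀ d : Fin l → Fin T → Rec S A, ∫⁻ h, V (l + 1) (snocTraj d h.1)
      ∂run M (attackChannel M ν) (ℓ l) T (attackMode M σ p m ε πT d) ≤ V l d := by
    intro l hl d
    have e : ∀ h : (Fin T → Rec S A) × S, V (l + 1) (snocTraj d h.1) =
        V l d * q (attackMode M σ p m ε πT d) h.1 := fun h => by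
      simp only [V, Fin.prod_univ_castSucc, snocTraj_castSucc]
      refine congrArg₂ (· * ·) (Finset.prod_congr rfl fun i _ => congrArg (fun x =>
        q (attackMode M σ p m ε πT x) (d i)) (takeTraj_snocTraj i.2.le _ d h.1)) ?_
      have e2 : snocTraj d h.1 (Fin.last l) = h.1 := snocTraj_last _ d h.1
      rw [e2]
      have e3 := takeTraj_snocTraj (le_refl l) (Fin.last l).2.le d h.1
      exact congrArg (fun x => q (attackMode M σ p m ε πT x) h.1) e3
    simp only [e]
    rw [lintegral_const_mul]
    · exact mul_le_of_le_one_right zero_le (hq l hl _)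
    · exact (hqmθ _).comp measurable_fst
  -- Fewer than `k / 4` good learners among `k` exploring ones push the product above `exp(3k / 8 -
  -- k / 4) = exp(k / 8)`, which is at least `1 / p`.
  have hmain := attackLaw_exists_le (M := M) (ν := ν) (m := m) (ε := ε) (πT := πT) (ℓ := ℓ) hσ hp
    hVm hV (fun d => by simp [V]) (ENNReal.ofReal (Real.exp (k / 8)))
  have h1 : ENNReal.ofReal (1 / p) ≤ ENNReal.ofReal (Real.exp (k / 8)) := by
    refine ENNReal.ofReal_le_ofReal ?_
    rw [← Real.exp_log (show 0 < 1 / p by positivity)]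
    exact Real.exp_le_exp.2 (by linarith)
  have hip : ENNReal.ofReal p = (ENNReal.ofReal (1 / p))⁻¹ := by
    rw [← ENNReal.ofReal_inv_of_pos (by positivity), one_div, inv_inv]
  rw [hip, ENNReal.le_inv_iff_mul_le, mul_comm]
  refine le_trans (mul_le_mul' h1 (measure_mono ?_)) hmain
  rintro d ⟨hkL, hmode, hcard⟩
  refine ⟨k, hkL, ?_⟩
  have hVk : V k (takeTraj hkL d) = ENNReal.ofReal (Real.exp (3 / 8 * k -
      (Finset.univ.filter fun i : Fin k => takeTraj hkL d i ∈ goodTraj M α β).card)) := by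
    have e1 : ∀ i : Fin k, q (attackMode M σ p m ε πT (takeTraj i.2.le (takeTraj hkL d)))
        (takeTraj hkL d i) = ENNReal.ofReal (Real.exp (3 / 8 -
          if takeTraj hkL d i ∈ goodTraj M α β then 1 else 0)) := fun i => by
      have hm' : (attackMode M σ p m ε πT (takeTraj i.2.le (takeTraj hkL d))).1 = true := hmode i
      simp only [q, hm', if_true]
      split_ifs
      · norm_num
      · norm_num
    simp only [V, e1]
    rw [← ENNReal.ofReal_prod_of_nonneg fun _ _ => (Real.exp_pos _).le, ← Real.exp_sum,
      Finset.sum_sub_distrib]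
    congr 2
    simp [mul_comm]
  rw [hVk]
  refine ENNReal.ofReal_le_ofReal (Real.exp_le_exp.2 ?_)
  have : (4 : ℝ) * (Finset.univ.filter fun i : Fin k =>
      takeTraj hkL d i ∈ goodTraj M α β).card < k := by exact_mod_cast hcard
  linarith

end events

end RewardPoisoning

namespace RewardPoisoning

/-! ## The cost of the attack -/

section cost

variable {S A : Type*} [Fintype S] [Fintype A] {T : ℕ}
  [DecidableEq S] [DecidableEq A] {M : MDP S A} {σ p m ε α β : ℝ} {πT : S → A}

lemma visits_takeTraj {L l j : ℕ} (h : l ≤ L) (hj : j ≤ l) (d : Fin L → Fin T → Rec S A)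
    (s : S) (a : A) : visits d j s a = (visits (takeTraj h d) j s a).map
      ⟨Prod.map (Fin.castLE h) id, (Fin.castLE_injective h).prodMap Function.injective_id⟩ := by
  ext ⟨i, t⟩
  simp only [visits, Finset.mem_filter, Finset.mem_univ, true_and, Finset.mem_map,
    Function.Embedding.coeFn_mk, takeTraj]
  constructor
  · rintro ⟨h1, h2⟩
    exact ⟨(⟨i, h1.trans_le hj⟩, t), Finset.mem_filter.2 ⟨Finset.mem_univ _, h1, h2⟩, rfl⟩
  · rintro ⟨⟨i', t'⟩, h1, h2⟩
    obtain ⟨rfl, rfl⟩ := Prod.mk.inj h2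
    exact (Finset.mem_filter.1 h1).2

/-- Modes are computed from prefixes but the confidence event speaks of the whole sequence; this
identifies the two. -/
lemma statsOf_takeTraj {L l j : ℕ} (h : l ≤ L) (hj : j ≤ l) (d : Fin L → Fin T → Rec S A) :
    statsOf (takeTraj h d) j = statsOf d j := by
  simp only [statsOf, visits_takeTraj h hj d, Finset.card_map, Finset.sum_map, Finset.filter_map]
  rfl

lemma statsOf_N {l : ℕ} (d : Fin l → Fin T → Rec S A) (s : S) (a : A) :
    (statsOf d l).N s a = ∑ i, stepVisits (d i) s a := by
  simp only [statsOf, visits, stepVisits, Fin.is_lt, true_and, Finset.card_filter,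
    Fintype.sum_prod_type]

lemma attackMode_cases (M : MDP S A) (σ p m ε : ℝ) (πT : S → A) {l : ℕ}
    (d : Fin l → Fin T → Rec S A) :
    ((attackMode M σ p m ε πT d).1 = true ∧ ∀ j ≤ l, ¬ (statsOf d j).Stop M σ p m ε πT) ∨
    ∃ j ≤ l, (statsOf d j).Stop M σ p m ε πT ∧
      attackMode M σ p m ε πT d = (false, (statsOf d j).deltaHat M σ p ε πT) := by
  classical
  by_cases h : ∃ j, j ≤ l ∧ (statsOf d j).Stop M σ p m ε πT
  · refine Or.inr ⟨Nat.find h, (Nat.find_spec h).1, (Nat.find_spec h).2, ?_⟩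
    rw [attackMode, dif_pos h]
  · refine Or.inl ⟨by rw [attackMode, dif_neg h], fun j hj hs => h ⟨j, hj, hs⟩⟩

variable [Nonempty S] [Nontrivial A]

lemma exploration_constants_pos (hα : 0 < α) (hα' : α < M.occMin / (2 * √2)) (hβ : 0 < β)
    (hβ' : β < 1 / (8 * Fintype.card S * Fintype.card A)) :
    0 < M.occMin ∧ 0 < Real.log (1 / (8 * Fintype.card S * Fintype.card A * β)) ∧
      0 < Real.log (16 * Fintype.card S * Fintype.card A) := by
  have hS : (1 : ℝ) ≤ Fintype.card S := by exact_mod_cast Fintype.card_pos (α := S)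
  have hA : (1 : ℝ) ≤ Fintype.card A := by exact_mod_cast Fintype.card_pos (α := A)
  refine ⟨?_, Real.log_pos ?_, Real.log_pos ?_⟩
  · have := hα.trans hα'
    by_contra hc
    exact absurd this (not_lt.2 (div_nonpos_of_nonpos_of_nonneg (not_lt.1 hc) (by positivity)))
  · rw [lt_div_iff₀ (by positivity)] at hβ' ⊢
    linarith
  · nlinarith [mul_le_mul hS hA zero_le_one (by linarith)]

/-- The second entry of the maximum in `k0` is exactly `4 * N0 / visitBound`, so a quarter of `k0`
thorough learners supplies `N0` visits. -/
lemma N0_le_mul_visitBound (hα : 0 < α) (hα' : α < M.occMin / (2 * √2)) (hβ : 0 < β)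
    (hβ' : β < 1 / (8 * Fintype.card S * Fintype.card A)) :
    0 < visitBound M α β ∧
      4 * (N0 M σ p m ε : ℝ) ≤ k0 M σ p α β m ε * visitBound M α β := by
  obtain ⟨h1, h2, h3⟩ := exploration_constants_pos (M := M) hα hα' hβ hβ'
  have hv : 0 < visitBound M α β := by
    unfold visitBound
    positivity
  refine ⟨hv, ?_⟩
  have h := (le_max_right _ _).trans (Nat.le_ceil (max (8 * Real.log (1 / p))
    (4 * N0 M σ p m ε * (α ^ 2 / M.occMin ^ 2) *
      ((Real.log (16 * Fintype.card S * Fintype.card A) +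
          2 * Real.log (1 / (8 * Fintype.card S * Fintype.card A * β))) /
        (1 / 8 * Real.log (1 / (8 * Fintype.card S * Fintype.card A * β)) ^ 2)))))
  refine Eq.trans_le ?_ (mul_le_mul_of_nonneg_right h hv.le)
  unfold visitBound
  generalize Real.log (1 / (8 * Fintype.card S * Fintype.card A * β)) = X at h2 ⊢
  generalize Real.log (16 * Fintype.card S * Fintype.card A) = Y at h3 ⊢
  have : Y + 2 * X ≠ 0 := by positivity
  field_simp

lemma log_le_k0 : 8 * Real.log (1 / p) ≤ k0 M σ p α β m ε :=
  (le_max_left _ _).trans (Nat.le_ceil _)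

lemma one_le_k0 (hp : p ∈ Set.Ioo (0 : ℝ) 1) : 1 ≤ k0 M σ p α β m ε := by
  have h := Real.log_pos ((one_lt_div hp.1).2 hp.2)
  have : (0 : ℝ) < k0 M σ p α β m ε := lt_of_lt_of_le (by linarith) log_le_k0
  exact_mod_cast this

open Classical in
/-- Exploration stops after `k₀` learners if a quarter of them visit every pair often. -/
lemma stop_of_many_good [MeasurableSpace S] [MeasurableSpace A] [MeasurableSingletonClass S]
    [MeasurableSingletonClass A] (hσ : 0 ≤ σ) (hp : p ∈ Set.Ioo (0 : ℝ) 1) (hε : 0 < ε)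
    (hm : 0 < m) (hR : 0 < M.rewardRange) (hα : 0 < α) (hα' : α < M.occMin / (2 * √2))
    (hβ : 0 < β) (hβ' : β < 1 / (8 * Fintype.card S * Fintype.card A))
    (d : Fin (k0 M σ p α β m ε) → Fin T → Rec S A)
    (hM : (M.R, M.P) ∈ (statsOf d (k0 M σ p α β m ε)).confSet σ p)
    (hd : k0 M σ p α β m ε ≤ 4 * (Finset.univ.filter fun i => d i ∈ goodTraj M α β).card) :
    (statsOf d (k0 M σ p α β m ε)).Stop M σ p m ε πT := by
  refine Stats.stop_of_N0_le hσ hp hε hm hR (exploration_constants_pos hα hα' hβ hβ').1 hM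
    (Stats.le_Nmin fun s a => ?_)
  obtain ⟨hv, h⟩ := N0_le_mul_visitBound (M := M) (σ := σ) (p := p) (m := m) (ε := ε)
    hα hα' hβ hβ'
  set G := Finset.univ.filter fun i => d i ∈ goodTraj M α β with hG
  have hd' : (k0 M σ p α β m ε : ℝ) ≤ 4 * G.card := by exact_mod_cast hd
  have h1 : (G.card : ℝ) * visitBound M α β ≤ ((statsOf d (k0 M σ p α β m ε)).N s a : ℝ) := by
    rw [statsOf_N, Nat.cast_sum]
    calc (G.card : ℝ) * visitBound M α β = ∑ _i ∈ G, visitBound M α β := by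
          rw [Finset.sum_const, nsmul_eq_mul]
      _ ≤ ∑ i ∈ G, (stepVisits (d i) s a : ℝ) :=
          Finset.sum_le_sum fun i hi => (Finset.mem_filter.1 hi).2 s a
      _ ≤ _ := Finset.sum_le_univ_sum_of_nonneg fun _ => Nat.cast_nonneg _
  have h2 := mul_le_mul_of_nonneg_right hd' hv.le
  have : (N0 M σ p m ε : ℝ) ≤ ((statsOf d (k0 M σ p α β m ε)).N s a : ℝ) := by linarith
  exact_mod_cast this

/-- Summing a bound on the learners before `k` and a bound on the others. -/
lemma sum_le_of_forall_lt_or {L k : ℕ} {f : Fin L → ℝ} {x y : ℝ} (hx : 0 ≤ x) (hy : 0 ≤ y)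
    (h : ∀ l : Fin L, (l.1 < k ∧ f l ≤ x) ∨ f l ≤ y) : ∑ l, f l ≤ k * x + L * y := by
  calc ∑ l, f l ≤ ∑ l : Fin L, ((if l.1 < k then x else 0) + y) := by
        refine Finset.sum_le_sum fun l _ => ?_
        rcases h l with ⟨h1, h2⟩ | h2
        · rw [if_pos h1]
          linarith
        · split_ifs <;> linarith
    _ = ((Finset.univ.filter fun l : Fin L => l.1 < k).card : ℝ) * x + L * y := by
        rw [Finset.sum_add_distrib, ← Finset.sum_filter, Finset.sum_const, Finset.sum_const,
          Finset.card_univ, Fintype.card_fin, nsmul_eq_mul, nsmul_eq_mul]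
    _ ≤ k * x + L * y := by
        have : (Finset.univ.filter fun l : Fin L => l.1 < k).card ≤ k := by
          calc _ ≤ (Finset.range k).card := Finset.card_le_card_of_injOn Fin.val
                (fun l hl => Finset.mem_coe.2 (Finset.mem_range.2 (by simpa using hl)))
                Fin.val_injective.injOn
            _ = k := Finset.card_range k
        have : ((Finset.univ.filter fun l : Fin L => l.1 < k).card : ℝ) ≤ k := by
          exact_mod_cast this
        gcongr

/-- Cost of one learner. -/
def learnerCost (lam : ℝ) (πT : S → A) (τ : Fin T → Rec S A) : ℝ :=
  ∑ t, (|(τ t).2.1.1 - (τ t).2.1.2| + lam * if (τ t).1.2 ≠ πT (τ t).1.1 then 1 else 0)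

variable {lam : ℝ} {τ : Fin T → Rec S A} {θ : Mode S A}

lemma learnerCost_le_of_explore (hlam : 0 ≤ lam) (hθ : θ.1 = true) {c : ℝ}
    (h1 : ∀ t, τ t ∉ inconsistent θ)
    (h2 : ∀ t, |(τ t).2.1.1 - M.R (τ t).1.1 (τ t).1.2| ≤ c) :
    learnerCost lam πT τ ≤ T * (‖M.R‖ + c + 1 + lam) := by
  calc learnerCost lam πT τ ≤ ∑ _t : Fin T, (‖M.R‖ + c + 1 + lam) := by
        refine Finset.sum_le_sum fun t _ => ?_
        have h3 : |(τ t).2.1.2| ≤ 1 := by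
          have := h1 t
          simpa [inconsistent, hθ] using this
        have h4 : |M.R (τ t).1.1 (τ t).1.2| ≤ ‖M.R‖ :=
          (norm_le_pi_norm (M.R (τ t).1.1) (τ t).1.2).trans (norm_le_pi_norm M.R (τ t).1.1)
        have h5 : |(τ t).2.1.1 - (τ t).2.1.2| ≤ ‖M.R‖ + c + 1 := by
          have := h2 t
          rw [abs_le] at *
          constructor <;> linarith
        split_ifs <;> linarith
    _ = T * (‖M.R‖ + c + 1 + lam) := by
        rw [Finset.sum_const, Finset.card_univ, Fintype.card_fin, nsmul_eq_mul]

/-- The difference of the two rewards is exactly the reduction, which vanishes on the target policy;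
only the other steps are charged. -/
lemma learnerCost_le_of_attack (hθ : θ.1 = false) {c : ℝ}
    (h0 : ∀ s, θ.2 s (πT s) = 0) (hc : ∀ s a, |θ.2 s a| ≤ c) (h1 : ∀ t, τ t ∉ inconsistent θ) :
    learnerCost lam πT τ ≤ (c + lam) * offSteps πT τ := by
  rw [learnerCost, offSteps, Finset.natCast_card_filter, Finset.mul_sum]
  refine Finset.sum_le_sum fun t _ => ?_
  have h2 : (τ t).2.1.2 = (τ t).2.1.1 - θ.2 (τ t).1.1 (τ t).1.2 := by
    have := h1 t
    simpa [inconsistent, hθ] using this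
  rw [h2, sub_sub_cancel]
  split_ifs with h
  · linarith [hc (τ t).1.1 (τ t).1.2]
  · rw [not_not.1 h, h0]
    simp

lemma abs_deltaHat_le {D : Stats S A} (hσ : 0 ≤ σ) (hp : p ∈ Set.Ioo (0 : ℝ) 1) (hε : 0 < ε)
    (hm : 0 ≤ m) (hM : (M.R, M.P) ∈ D.confSet σ p) (hS : D.Stop M σ p m ε πT)
    (hocc : ∀ π s, 0 < M.occ π s) (s : S) (a : A) :
    |D.deltaHat M σ p ε πT s a| ≤ ‖M.whiteBox ε πT‖ + m := by
  rw [abs_of_nonneg (Stats.deltaHat_nonneg s a)]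
  refine (Stats.deltaHat_le hσ hp hε hm hM hS hocc s a).trans ?_
  have := (le_abs_self _).trans ((norm_le_pi_norm (M.whiteBox ε πT s) a).trans
    (norm_le_pi_norm (M.whiteBox ε πT) s))
  linarith

lemma deltaHat_mem_effective {D : Stats S A} (hσ : 0 ≤ σ) (hp : p ∈ Set.Ioo (0 : ℝ) 1)
    (hε : 0 < ε) (hM : (M.R, M.P) ∈ D.confSet σ p) (hS : D.Stop M σ p m ε πT) :
    D.deltaHat M σ p ε πT ∈ effective M ε πT :=
  ⟨fun s => by simp [Stats.deltaHat], fun _ _ ha => Stats.le_deltaHat hσ hp hε hM hS ha⟩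

open Classical in
/-- The cost outside the exceptional events. -/
lemma cost_le [MeasurableSpace S] [MeasurableSpace A] [MeasurableSingletonClass S]
    [MeasurableSingletonClass A] (hσ : 0 ≤ σ) (hp : p ∈ Set.Ioo (0 : ℝ) 1) (hε : 0 < ε)
    (hm : 0 < m) (hlam : 0 ≤ lam) (hR : 0 < M.rewardRange) (hα : 0 < α)
    (hα' : α < M.occMin / (2 * √2)) (hβ : 0 < β)
    (hβ' : β < 1 / (8 * Fintype.card S * Fintype.card A)) (hT : 1 ≤ T) {L : ℕ} (hL : 1 ≤ L)
    {b c : ℝ} (hb : 0 ≤ b) (hc : 0 ≤ c) (d : Fin L → Fin T → Rec S A)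
    (hconf : ¬ ∃ j ≤ L, (M.R, M.P) ∉ (statsOf d j).confSet σ p)
    (hgood : ¬ ∃ h : k0 M σ p α β m ε ≤ L,
      (∀ i : Fin (k0 M σ p α β m ε),
        (attackMode M σ p m ε πT (takeTraj (i.2.le.trans h) d)).1 = true) ∧
      4 * (Finset.univ.filter fun i : Fin (k0 M σ p α β m ε) =>
        takeTraj h d i ∈ goodTraj M α β).card < k0 M σ p α β m ε)
    (hnoise : ¬ ∃ l, ∃ h : l < L, l < k0 M σ p α β m ε ∧
      ∃ t, c < |(d ⟨l, h⟩ t).2.1.1 - M.R (d ⟨l, h⟩ t).1.1 (d ⟨l, h⟩ t).1.2|)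
    (hcons : ¬ ∃ l, ∃ h : l < L,
      ∃ t, d ⟨l, h⟩ t ∈ inconsistent (attackMode M σ p m ε πT (takeTraj h.le d)))
    (hoff : ¬ ∃ l, ∃ h : l < L,
      (attackMode M σ p m ε πT (takeTraj h.le d)).1 = false ∧
      (attackMode M σ p m ε πT (takeTraj h.le d)).2 ∈ effective M ε πT ∧
      b < offSteps πT (d ⟨l, h⟩)) :
    cost lam πT d ≤ (k0 M σ p α β m ε : ℝ) / L * (‖M.R‖ + c + 1 + lam) +
      (‖M.whiteBox ε πT‖ + lam + m) * (b / T) := by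
  have hocc : ∀ π s, 0 < M.occ π s := fun π s =>
    (exploration_constants_pos hα hα' hβ hβ').1.trans_le (M.occMin_le π s)
  have hconf' : ∀ j ≤ L, (M.R, M.P) ∈ (statsOf d j).confSet σ p := by
    push Not at hconf
    exact hconf
  set k := k0 M σ p α β m ε with hk
  have key : ∀ l : Fin L, (l.1 < k ∧ learnerCost lam πT (d l) ≤ T * (‖M.R‖ + c + 1 + lam)) ∨
      learnerCost lam πT (d l) ≤ (‖M.whiteBox ε πT‖ + m + lam) * b := by
    intro l
    have hin : ∀ t, d l t ∉ inconsistent (attackMode M σ p m ε πT (takeTraj l.2.le d)) :=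
      fun t ht => hcons ⟨l.1, l.2, t, ht⟩
    rcases attackMode_cases M σ p m ε πT (takeTraj l.2.le d) with ⟨hmode, hSt⟩ |
      ⟨j, hj, hSt, hmode⟩
    -- If a learner with index at least `k` were still exploring, the first `k` learners would all
    -- have explored. A quarter of them would then be thorough, and exploration would have stopped
    -- after `k` learners.
    · have hlk : l.1 < k := by
        by_contra hkl
        rw [not_lt] at hkl
        have hkL : k ≤ L := hkl.trans l.2.le
        have hnostop : ∀ j ≤ l.1, ¬ (statsOf d j).Stop M σ p m ε πT := fun j hj => by
          rw [← statsOf_takeTraj l.2.le hj d]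
          exact hSt j hj
        refine hnostop k hkl ?_
        rw [← statsOf_takeTraj hkL le_rfl d]
        refine stop_of_many_good hσ hp hε hm hR hα hα' hβ hβ' _ ?_ ?_
        · rw [statsOf_takeTraj hkL le_rfl d]
          exact hconf' k hkL
        · by_contra hlt
          refine hgood ⟨hkL, fun i => ?_, not_le.1 hlt⟩
          rcases attackMode_cases M σ p m ε πT (takeTraj (i.2.le.trans hkL) d) with
            ⟨h1, _⟩ | ⟨j, hj, hs, _⟩
          · exact h1
          · rw [statsOf_takeTraj _ hj] at hs
            exact absurd hs (hnostop j (hj.trans (i.2.le.trans hkl)))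
      refine Or.inl ⟨hlk, learnerCost_le_of_explore hlam hmode hin fun t => ?_⟩
      by_contra ht
      exact hnoise ⟨l.1, l.2, hlk, t, not_le.1 ht⟩
    · rw [statsOf_takeTraj l.2.le hj] at hSt hmode
      have hMj := hconf' j (hj.trans l.2.le)
      have heff : (attackMode M σ p m ε πT (takeTraj l.2.le d)).2 ∈ effective M ε πT := by
        rw [hmode]
        exact deltaHat_mem_effective hσ hp hε hMj hSt
      have hfalse : (attackMode M σ p m ε πT (takeTraj l.2.le d)).1 = false := by rw [hmode]
      refine Or.inr ((learnerCost_le_of_attack (c := ‖M.whiteBox ε πT‖ + m) hfalse heff.1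
        (fun s a => ?_) hin).trans ?_)
      · rw [hmode]
        exact abs_deltaHat_le hσ hp hε hm.le hMj hSt hocc s a
      · refine mul_le_mul_of_nonneg_left ?_ (by positivity)
        by_contra hlt
        exact hoff ⟨l.1, l.2, hfalse, heff, not_le.1 hlt⟩
  have hsum := sum_le_of_forall_lt_or (x := T * (‖M.R‖ + c + 1 + lam))
    (y := (‖M.whiteBox ε πT‖ + m + lam) * b) (by positivity) (by positivity) key
  have hL' : (0 : ℝ) < L := by exact_mod_cast hL
  have hT' : (0 : ℝ) < T := by exact_mod_cast hT
  calc cost lam πT d = 1 / (L * T) * ∑ l, learnerCost lam πT (d l) := rfl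
    _ ≤ 1 / (L * T) * (k * (T * (‖M.R‖ + c + 1 + lam)) +
        L * ((‖M.whiteBox ε πT‖ + m + lam) * b)) :=
      mul_le_mul_of_nonneg_left hsum (by positivity)
    _ = _ := by
      field_simp
      ring

end cost

/-! ### Auxiliary facts for the final union bound -/

section probability

variable {S A : Type*} [MeasurableSpace S] [MeasurableSpace A]
  [Fintype S] [MeasurableSingletonClass S] [Fintype A] [MeasurableSingletonClass A] {T : ℕ}
  [DecidableEq S] {M : MDP S A} {ν : Kernel (S × A) ℝ} [IsMarkovKernel ν] {l : Learner S A T}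

/-- A count is never below a negative bound, whereas the guarantee gives it positive probability.
Nothing else makes `SubOpt` nonnegative. -/
lemma HasSuboptBound.nonneg {ε δ b : ℝ} (h : HasSuboptBound M ν ε δ b l) (hδ : δ < 1) :
    0 ≤ b := by
  by_contra hb
  have h1 := h M.R
  have : {τ : (Fin T → Rec S A) × S | (suboptSteps (M.withReward M.R) ε τ.1 : ℝ) ≤ b} = ∅ := by
    ext τ
    simp only [Set.mem_ofPred_eq, Set.mem_empty_iff_false, iff_false, not_le]
    exact (not_le.1 hb).trans_le (Nat.cast_nonneg _)
  rw [this, measureReal_empty] at h1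
  linarith

/-- Subadditivity replaces the complement rule, so the event of the theorem need not be shown
measurable. -/
lemma one_sub_le_measureReal {Ω : Type*} [MeasurableSpace Ω] {μ : Measure Ω}
    [IsProbabilityMeasure μ] {E : Set Ω} {x : ℝ} (hx : 0 ≤ x) (h : μ Eᶜ ≤ ENNReal.ofReal x) :
    1 - x ≤ μ.real E := by
  have h1 : (1 : ℝ) ≤ μ.real E + μ.real Eᶜ := by
    rw [← probReal_univ (μ := μ), ← Set.union_compl_self E]
    exact measureReal_union_le _ _
  have h2 : μ.real Eᶜ ≤ x := ENNReal.toReal_le_of_le_ofReal hx h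
  linarith

end probability

end RewardPoisoning

theorem mainTheorem1 {S A : Type*} [Fintype S] [DecidableEq S] [Nonempty S] [MeasurableSpace S]
    [MeasurableSingletonClass S] [Fintype A] [DecidableEq A] [Nontrivial A] [MeasurableSpace A]
    [MeasurableSingletonClass A]
    (M : MDP S A) (hR : 0 < M.rewardRange)
    (σ : ℝ≥0) (ν : Kernel (S × A) ℝ) [IsMarkovKernel ν]
    (hν : ∀ x, HasSubgaussianMGF id (σ ^ 2) (ν x))
    (πT : S → A) (ε lam m p : ℝ) (hε : 0 < ε) (hlam : 0 ≤ lam) (hm : 0 < m)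
    (hp : p ∈ Set.Ioo (0 : ℝ) 1)
    (T L : ℕ) (hT : 1 ≤ T) (hL : 1 ≤ L)
    (α β : ℝ) (hα : 0 < α) (hα' : α < M.occMin / (2 * √2))
    (hβ : 0 < β) (hβ' : β < 1 / (8 * Fintype.card S * Fintype.card A))
    (SubOpt : ℕ → ℝ → ℝ → ℝ) (ℓ : ℕ → Learner S A T)
    (hPAC : ∀ l < L, IsPAC M α β (ℓ l))
    (hSub : ∀ l < L, ∀ ε' > 0, ∀ δ ∈ Set.Ioo (0 : ℝ) 1,
      HasSuboptBound M ν ε' δ (SubOpt T ε' δ) (ℓ l)) :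
    1 - 4 * p ≤ (attackLaw M ν σ p m ε πT ℓ L).real
      {d | cost lam πT d ≤
        (k0 M σ p α β m ε : ℝ) / L *
          (‖M.R‖ + σ * √(2 * Real.log (2 * k0 M σ p α β m ε * T / p)) + 1 + lam) +
        (‖M.whiteBox ε πT‖ + lam + m) * (SubOpt T ε (p / L) / T)} := by
  classical
  have hσ : (0 : ℝ) ≤ σ := σ.2
  have hL' : (1 : ℝ) ≤ L := by exact_mod_cast hL
  have hpL : p / L ∈ Set.Ioo (0 : ℝ) 1 :=
    ⟨div_pos hp.1 (by linarith), (div_le_self hp.1.le hL').trans_lt hp.2⟩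
  have hSub' : ∀ l < L, HasSuboptBound M ν ε (p / L) (SubOpt T ε (p / L)) (ℓ l) :=
    fun l hl => hSub l hl ε hε _ hpL
  have hocc : ∀ π s, 0 < M.occ π s := fun π s =>
    (exploration_constants_pos hα hα' hβ hβ').1.trans_le (M.occMin_le π s)
  have := isProbabilityMeasure_attackLaw (M := M) (ν := ν) (m := m) (ε := ε) (πT := πT) (ℓ := ℓ)
    hσ hp L
  have E1 := attackLaw_notMem_confSet_le (M := M) (ν := ν) (m := m) (ε := ε) (πT := πT) (ℓ := ℓ)
    rfl hp hν L
  have E2 := attackLaw_few_good_le (M := M) (ν := ν) (m := m) (ε := ε) (πT := πT) hσ hp hα hα'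
    hβ hβ' hPAC (log_le_k0 (M := M) (σ := σ) (p := p) (α := α) (β := β) (m := m) (ε := ε))
  have E3 := attackLaw_noise_le (M := M) (ν := ν) (m := m) (ε := ε) (πT := πT) (ℓ := ℓ)
    rfl hp hν (one_le_k0 (M := M) (σ := σ) (α := α) (β := β) (m := m) (ε := ε) hp) hT L
  have E4 := attackLaw_offSteps_le (m := m) (πT := πT) hσ hp hε hocc hL hSub'
  have E5 := attackLaw_inconsistent (M := M) (ν := ν) (m := m) (ε := ε) (πT := πT) (ℓ := ℓ)
    hσ hp L
  refine one_sub_le_measureReal (by linarith [hp.1]) ?_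
  -- Five events are excluded; the `0` belongs to the null event of inconsistent rewards.
  have e4 : ENNReal.ofReal (4 * p) = ENNReal.ofReal p + (ENNReal.ofReal p + (ENNReal.ofReal p +
      (0 + ENNReal.ofReal p))) := by
    rw [zero_add, ← ENNReal.ofReal_add hp.1.le hp.1.le,
      ← ENNReal.ofReal_add hp.1.le (by linarith [hp.1]),
      ← ENNReal.ofReal_add hp.1.le (by linarith [hp.1])]
    congr 1
    ring
  rw [e4]
  refine le_trans (measure_mono fun d hd => ?_) ((measure_union_le _ _).trans (add_le_add E1
    ((measure_union_le _ _).trans (add_le_add E2 ((measure_union_le _ _).trans (add_le_add E3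
    ((measure_union_le _ _).trans (add_le_add E5.le E4))))))))
  by_contra hd'
  simp only [Set.mem_union, Set.mem_ofPred_eq, not_or] at hd'
  obtain ⟨h1, h2, h3, h5, h4⟩ := hd'
  exact hd (cost_le hσ hp hε hm hlam hR hα hα' hβ hβ' hT hL ((hSub' 0 hL).nonneg hpL.2)
    (by positivity) d h1 h2 h3 h5 h4)
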